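/- Let $k\ge 2$ and let $F=F(a_1,\dots,a_k)$ be the free group with basis $A=\{a_1,\dots,a_k\}$. For $w\in F$ let $|w|$ be the length of the freely reduced word over $A^{\pm1}$ representing $w$, let $\|w\|$ be the length of the cyclically reduced form of $w$, and let $d(x,y)=|x^{-1}y|$ be the word metric on $F$. Let $\mathcal{CR}\subseteq F$ be the set of cyclically reduced words. A set $C\subseteq\mathcal{CR}$ is \emph{exponentially $\mathcal{CR}$-generic} if there are $0<\sigma<1$ and $D>0$ with $$\left|\frac{\#\{w\in C:|w|=n\}}{\#\{w\in\mathcal{CR}:|w|=n\}}-1\right|\le D\sigma^n\qquad\text{for all } n\ge1.$$ Let $\partial F$ be the set of semi-infinite freely reduced words $\omega$ over $A^{\pm1}$, let $\omega_n\in F$ be the prefix of length $n$ of $\omega$, and let $m_A$ be the uniform Borel probability measure on $\partial F$, for which the set of $\omega$ beginning with $v$ has measure $\frac{1}{2k(2k-1)^{|v|-1}}$ for every $v\in F\setminus\{1\}$. For $\phi\in\mathrm{Aut}(F)$ the \emph{generic stretching factor} $\lambda(\phi)$ is the real number such that $\lim_{n\to\infty}|\phi(\omega_n)|/n=\lambda(\phi)$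 for $m_A$-a.e. $\omega$ and in $L^1(\partial F,m_A)$. An automorphism $\phi$ of $F$ is \emph{simple} if it is the composition of an inner automorphism and an automorphism induced by a permutation of $A^{\pm1}$. The map $\phi:(F,d)\to(F,d)$ is a \emph{rough isometry} if there is $D>0$ with $|d(\phi(x),\phi(y))-d(x,y)|\le D$ for all $x,y\in F$, and a \emph{rough similarity} if there are $c>0$ and $D>0$ with $|d(\phi(x),\phi(y))-c\,d(x,y)|\le D$ for all $x,y\in F$. Put $d_0:=1+\frac{2k-3}{4k^2-2k}$. Then $\lambda(\phi)$ exists for every $\phi\in\mathrm{Aut}(F)$, and there is an exponentially $\mathcal{CR}$-generic set $C\subseteq\mathcal{CR}$ such that for every $\phi\in\mathrm{Aut}(F)$ the following conditions are equivalent: \begin{enumerate} \item $\phi$ is simple; \item $\lambda(\phi)=1$; \item $\lambda(\phi)<1+\frac{2k-3}{2k^2-k}$; \item $\phi:(F,d)\to(F,d)$ is a rough isometry; \item $\phi:(F,d)\to(F,d)$ is a rough similarity; \item $\|\phi(w)\|=\|w\|$ for some $w\in C$; \item $\|\phi(w)\|=\|w\|$ for every $w\in C$; \item $\|\phi(w)\|\le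 d_0\|w\|$ for some $w\in C$; \item $\|\phi(w)\|\le d_0\|w\|$ for every $w\in C$. \end{enumerate} In particular, $\lambda(\phi)\notin\left(1,\,1+\frac{2k-3}{2k^2-k}\right)$ for every $\phi\in\mathrm{Aut}(F)$. -/

import Mathlib

open MeasureTheory ProbabilityTheory Filter Topology

namespace FreeStretch

/-! ### Rays in the free group and the uniform measure on the boundary -/

/-- The alphabet `A^{±1}`: the pair `(i, true)` is `a_i` and `(i, false)` is `a_i⁻¹`. -/
abbrev Letter (k : ℕ) : Type := Fin k × Bool

/-- The inverse letter. -/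
def letterInv {k : ℕ} (x : Letter k) : Letter k := (x.1, !x.2)

/-- The boundary of `F(a_1, …, a_k)`: semi-infinite freely reduced words over `A^{±1}`, with the
σ-algebra induced from the product, which is generated by the cylinders. -/
abbrev Boundary (k : ℕ) : Type :=
  {w : ℕ → Letter k // ∀ n, w (n + 1) ≠ letterInv (w n)}

/-- The vertex at distance `n` from `1` on a ray. -/
def rayPoint {k : ℕ} (w : Boundary k) (n : ℕ) : FreeGroup (Fin k) :=
  FreeGroup.mk (List.ofFn fun i : Fin n => w.1 i)

/-- The step of the non-backtracking walk: given the letters up to time `n`, the next letter is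
uniformly distributed among those that do not cancel the last one. -/
noncomputable def stepKernel (k n : ℕ) :
    Kernel ((i : Finset.Iic n) → (fun _ : ℕ => Letter k) i) ((fun _ : ℕ => Letter k) (n + 1)) :=
  Kernel.ofFunOfCountable fun h =>
    uniformOn {y : Letter k | y ≠ letterInv (h ⟨n, Finset.mem_Iic.2 le_rfl⟩)}

instance (k n : ℕ) : IsMarkovKernel (stepKernel k n) := by
  refine ⟨fun h => isProbabilityMeasure_uniformOn (Set.toFinite _)
    ⟨h ⟨n, Finset.mem_Iic.2 le_rfl⟩, ?_⟩⟩
  intro e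
  have := congrArg Prod.snd e
  simp [letterInv] at this

/-- The law, on all sequences of letters, of the sequence of increments of the non-backtracking
simple random walk. -/
noncomputable def walkMeasure (k : ℕ) : Measure (ℕ → Letter k) :=
  Kernel.trajMeasure (X := fun _ => Letter k) (uniformOn Set.univ) (stepKernel k)

/-- The uniform probability measure on the boundary. -/
noncomputable def uniformMeasure (k : ℕ) : Measure (Boundary k) :=
  (walkMeasure k).comap Subtype.val

lemma stepKernel_prev (k n : ℕ) (h : (i : Finset.Iic n) → Letter k) :
    stepKernel k n h {letterInv (h ⟨n, Finset.mem_Iic.2 le_rfl⟩)} = 0 := by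
  show uniformOn {y : Letter k | y ≠ letterInv (h ⟨n, Finset.mem_Iic.2 le_rfl⟩)} _ = 0
  rw [uniformOn_eq_zero_iff (Set.toFinite _)]
  ext y
  simp

lemma stepKernel_singleton (k n : ℕ) (h : (i : Finset.Iic n) → Letter k) (y : Letter k)
    (hy : y ≠ letterInv (h ⟨n, Finset.mem_Iic.2 le_rfl⟩)) :
    stepKernel k n h {y} = ((2 * k - 1 : ℕ) : ENNReal)⁻¹ := by
  classical
  show uniformOn {y : Letter k | y ≠ letterInv (h ⟨n, Finset.mem_Iic.2 le_rfl⟩)} _ = _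
  have : {y : Letter k | y ≠ letterInv (h ⟨n, Finset.mem_Iic.2 le_rfl⟩)} =
      ((Finset.univ.erase (letterInv (h ⟨n, Finset.mem_Iic.2 le_rfl⟩)) : Finset (Letter k)) :
        Set (Letter k)) := by
    ext; simp
  rw [this, ← Finset.coe_singleton, uniformOn_apply_finset, Finset.inter_singleton_of_mem]
  · simp [Finset.card_erase_of_mem, mul_comm]
  · simpa using hy

lemma walkMeasure_isProbabilityMeasure (k : ℕ) (hk : 1 ≤ k) :
    IsProbabilityMeasure (walkMeasure k) := by
  have : Nonempty (Fin k) := ⟨⟨0, hk⟩⟩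
  have : IsProbabilityMeasure (uniformOn (Set.univ : Set (Letter k))) := inferInstance
  unfold walkMeasure
  infer_instance

lemma walkMeasure_step (k : ℕ) (hk : 1 ≤ k) (a : ℕ)
    {s : Set (((i : Finset.Iic a) → Letter k) × Letter k)} (hs : MeasurableSet s) :
    walkMeasure k {w | (Preorder.frestrictLe (π := fun _ => Letter k) a w, w (a + 1)) ∈ s} =
      ∫⁻ h, stepKernel k a h (Prod.mk h ⁻¹' s)
        ∂((walkMeasure k).map (Preorder.frestrictLe (π := fun _ => Letter k) a)) := by
  have : Nonempty (Fin k) := ⟨⟨0, hk⟩⟩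
  have := walkMeasure_isProbabilityMeasure k hk
  have h := Kernel.map_frestrictLe_trajMeasure_compProd_eq_map_trajMeasure
    (X := fun _ => Letter k) (μ₀ := uniformOn Set.univ) (κ := stepKernel k) (a := a)
  have h2 := congrArg (fun m => m s) h
  beta_reduce at h2
  rw [Measure.map_apply (by fun_prop) hs] at h2
  have : IsProbabilityMeasure
      ((walkMeasure k).map (Preorder.frestrictLe (π := fun _ => Letter k) a)) :=
    Measure.isProbabilityMeasure_map (by fun_prop)
  refine h2.symm.trans ?_
  exact Measure.compProd_apply (μ :=
    (walkMeasure k).map (Preorder.frestrictLe (π := fun _ => Letter k) a)) hs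

lemma walkMeasure_ae_reduced (k : ℕ) (hk : 1 ≤ k) :
    ∀ᵐ w ∂(walkMeasure k), ∀ n, w (n + 1) ≠ letterInv (w n) := by
  rw [ae_all_iff]
  intro n
  have h := walkMeasure_step k hk n
    (s := {p | p.2 = letterInv (p.1 ⟨n, Finset.mem_Iic.2 le_rfl⟩)})
    (Set.to_countable _).measurableSet
  rw [ae_iff]
  simp only [ne_eq, not_not]
  refine h.trans ?_
  rw [lintegral_eq_zero_of_ae_eq_zero]
  exact Eventually.of_forall fun h => stepKernel_prev k n h

lemma measurableSet_boundary (k : ℕ) :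
    MeasurableSet {w : ℕ → Letter k | ∀ n, w (n + 1) ≠ letterInv (w n)} := by
  rw [Set.ofPred_forall]
  refine MeasurableSet.iInter fun n => ?_
  have : Measurable fun w : ℕ → Letter k => (w (n + 1), w n) := by fun_prop
  exact this (Set.to_countable {p : Letter k × Letter k | p.1 ≠ letterInv p.2}).measurableSet

lemma walkMeasure_zero (k : ℕ) (x : Letter k) :
    walkMeasure k {w | w 0 = x} = ((2 * k : ℕ) : ENNReal)⁻¹ := by
  classical
  have hm : (walkMeasure k).map (Preorder.frestrictLe (π := fun _ => Letter k) 0) =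
      (uniformOn Set.univ).map
        (MeasurableEquiv.piUnique fun _ : Finset.Iic (0 : ℕ) => Letter k).symm := by
    unfold walkMeasure Kernel.trajMeasure
    rw [Measure.map_comp _ _ (by fun_prop), Kernel.traj_map_frestrictLe_of_le le_rfl,
      Measure.deterministic_comp_eq_map]
    exact Measure.map_id
  have hs : MeasurableSet {h : (i : Finset.Iic (0 : ℕ)) → Letter k |
      h ⟨0, Finset.mem_Iic.2 le_rfl⟩ = x} := (Set.to_countable _).measurableSet
  have h1 := congrArg (fun m => m {h : (i : Finset.Iic (0 : ℕ)) → Letter k |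
      h ⟨0, Finset.mem_Iic.2 le_rfl⟩ = x}) hm
  beta_reduce at h1
  rw [Measure.map_apply (by fun_prop) hs, Measure.map_apply (by fun_prop) hs] at h1
  refine h1.trans ?_
  have : ((MeasurableEquiv.piUnique fun _ : Finset.Iic (0 : ℕ) => Letter k).symm ⁻¹'
      {h | h ⟨0, Finset.mem_Iic.2 le_rfl⟩ = x}) = (({x} : Finset (Letter k)) : Set _) := by
    ext y
    simp [MeasurableEquiv.piUnique, Equiv.piUnique, uniqueElim]
  rw [this, ← Finset.coe_univ, uniformOn_apply_finset]
  simp [mul_comm]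

lemma walkMeasure_prefix (k : ℕ) (hk : 1 ≤ k) (u : ℕ → Letter k) (n : ℕ)
    (hu : ∀ i < n, u (i + 1) ≠ letterInv (u i)) :
    walkMeasure k {w | ∀ i ≤ n, w i = u i} =
      ((2 * k * (2 * k - 1) ^ n : ℕ) : ENNReal)⁻¹ := by
  classical
  induction n with
  | zero => simpa using walkMeasure_zero k (u 0)
  | succ n ih =>
    have ih := ih fun i hi => hu i (by omega)
    have hs : MeasurableSet {p : ((i : Finset.Iic n) → Letter k) × Letter k |
        p.1 ∈ ({fun i : Finset.Iic n => u i} : Set ((i : Finset.Iic n) → Letter k)) ∧ p.2 = u (n + 1)} :=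
      (Set.to_countable _).measurableSet
    have h := walkMeasure_step k hk n hs
    have hset : {w : ℕ → Letter k | ∀ i ≤ n + 1, w i = u i} =
        {w | (Preorder.frestrictLe (π := fun _ => Letter k) n w, w (n + 1)) ∈
          {p : ((i : Finset.Iic n) → Letter k) × Letter k |
            p.1 ∈ ({fun i : Finset.Iic n => u i} : Set ((i : Finset.Iic n) → Letter k)) ∧
              p.2 = u (n + 1)}} := by
      ext w
      simp only [Set.mem_ofPred_eq, Set.mem_singleton_iff, funext_iff]
      constructor
      · intro h
        exact ⟨fun i => h i ((Finset.mem_Iic.1 i.2).trans n.le_succ), h _ le_rfl⟩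
      · rintro ⟨h1, h2⟩ i hi
        rcases Nat.lt_or_ge n i with h | h
        · obtain rfl : i = n + 1 := by omega
          exact h2
        · exact h1 ⟨i, Finset.mem_Iic.2 h⟩
    rw [hset, h]
    have hint : ∀ h : (i : Finset.Iic n) → Letter k,
        stepKernel k n h (Prod.mk h ⁻¹' {p | p.1 ∈ ({fun i : Finset.Iic n => u i} :
          Set ((i : Finset.Iic n) → Letter k)) ∧ p.2 = u (n + 1)}) =
        Set.indicator {fun i : Finset.Iic n => u i} (fun _ => ((2 * k - 1 : ℕ) : ENNReal)⁻¹) h := by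
      intro h
      by_cases hh : h = fun i : Finset.Iic n => u i
      · subst hh
        rw [Set.indicator_of_mem (Set.mem_singleton _), ← stepKernel_singleton k n
          (fun i : Finset.Iic n => u i) (u (n + 1)) (hu n n.lt_succ_self)]
        congr 1
        ext y
        simp
      · rw [Set.indicator_of_notMem (by simpa using hh)]
        have : (Prod.mk h ⁻¹' {p : ((i : Finset.Iic n) → Letter k) × Letter k |
            p.1 ∈ ({fun i : Finset.Iic n => u i} : Set ((i : Finset.Iic n) → Letter k)) ∧
              p.2 = u (n + 1)}) = ∅ := by
          ext y
          simp [hh]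
        rw [this, measure_empty]
    rw [lintegral_congr hint, lintegral_indicator_const (Set.to_countable _).measurableSet,
      Measure.map_apply (by fun_prop) (Set.to_countable _).measurableSet]
    have hpre : (Preorder.frestrictLe (π := fun _ => Letter k) n ⁻¹' {fun i : Finset.Iic n => u i}) =
        {w : ℕ → Letter k | ∀ i ≤ n, w i = u i} := by
      ext w
      simp only [Set.mem_preimage, Set.mem_singleton_iff, funext_iff, Set.mem_ofPred_eq]
      exact ⟨fun h i hi => h ⟨i, Finset.mem_Iic.2 hi⟩, fun h i => h i (Finset.mem_Iic.1 i.2)⟩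
    rw [hpre, ih, ← ENNReal.mul_inv (Or.inr (ENNReal.natCast_ne_top _))
      (Or.inl (ENNReal.natCast_ne_top _))]
    congr 1
    rw [← Nat.cast_mul]
    congr 1
    ring

lemma uniformMeasure_apply (k : ℕ) (s : Set (Boundary k)) :
    uniformMeasure k s = walkMeasure k (Subtype.val '' s) :=
  (MeasurableEmbedding.subtype_coe (measurableSet_boundary k)).comap_apply _ _

lemma uniformMeasure_isProbabilityMeasure (k : ℕ) (hk : 1 ≤ k) :
    IsProbabilityMeasure (uniformMeasure k) := by
  have := walkMeasure_isProbabilityMeasure k hk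
  refine ⟨?_⟩
  have hr : (Subtype.val '' (Set.univ : Set (Boundary k))) =
      {w : ℕ → Letter k | ∀ n, w (n + 1) ≠ letterInv (w n)} := by
    ext w
    exact ⟨fun ⟨w', _, h⟩ => h ▸ w'.2, fun h => ⟨⟨w, h⟩, trivial, rfl⟩⟩
  rw [uniformMeasure_apply, hr]
  exact (mem_ae_iff_prob_eq_one (measurableSet_boundary k)).1 (walkMeasure_ae_reduced k hk)

/-- The defining property of the uniform measure: the rays that begin with a given freely reduced
word `v ≠ 1` have mass `1 / (2k (2k-1)^(|v|-1))`. -/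
theorem uniformMeasure_cylinder (k : ℕ) (hk : 1 ≤ k) (v : FreeGroup (Fin k)) (hv : v ≠ 1) :
    uniformMeasure k {w | rayPoint w v.norm = v} =
      ((2 * k * (2 * k - 1) ^ (v.norm - 1) : ℕ) : ENNReal)⁻¹ := by
  obtain ⟨m, hm⟩ : ∃ m, v.norm = m + 1 :=
    Nat.exists_eq_succ_of_ne_zero (by simpa [FreeGroup.norm_eq_zero] using hv)
  have hlen : v.toWord.length = m + 1 := hm
  let u : ℕ → Letter k := fun i => v.toWord.getD i (⟨0, hk⟩, true)
  have hget : ∀ i (hi : i < v.toWord.length), u i = v.toWord[i] := fun i hi => by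
    simp [u, hi]
  have hred : ∀ i < m, u (i + 1) ≠ letterInv (u i) := by
    intro i hi
    have h := (FreeGroup.isReduced_toWord (x := v))
    rw [FreeGroup.IsReduced, List.isChain_iff_getElem] at h
    have h := h i (by omega)
    rw [hget _ (by omega), hget _ (by omega)]
    intro e
    rw [e] at h
    simp [letterInv] at h
  rw [hm, Nat.add_sub_cancel, ← walkMeasure_prefix k hk u m hred, uniformMeasure_apply]
  refine measure_congr ?_
  filter_upwards [walkMeasure_ae_reduced k hk] with w hw
  refine propext ?_
  show w ∈ Subtype.val '' _ ↔ ∀ i ≤ m, w i = u i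
  have key : rayPoint (k := k) ⟨w, hw⟩ (m + 1) = v ↔ ∀ i ≤ m, w i = u i := by
    have hL : FreeGroup.IsReduced (List.ofFn fun i : Fin (m + 1) => w i) := by
      rw [FreeGroup.IsReduced, List.isChain_iff_getElem]
      intro i hi h1
      simp only [List.getElem_ofFn] at h1 ⊢
      by_contra h2
      refine hw i (Prod.ext h1.symm ?_)
      simp only [letterInv]
      exact (Bool.eq_not_of_ne (Ne.symm h2))
    have h3 : rayPoint (k := k) ⟨w, hw⟩ (m + 1) = v ↔
        (List.ofFn fun i : Fin (m + 1) => w i) = v.toWord := by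
      rw [← FreeGroup.toWord_inj]
      simp only [rayPoint, FreeGroup.toWord_mk, hL.reduce_eq]
    rw [h3]
    constructor
    · intro h i hi
      rw [hget i (by omega)]
      simp only [← h, List.getElem_ofFn]
    · intro h
      refine List.ext_getElem (by simp [hlen]) fun i h1 h2 => ?_
      rw [← hget i h2, ← h i (by omega)]
      simp only [List.getElem_ofFn]
  rw [← key]
  constructor
  · rintro ⟨w', h, rfl⟩
    exact h
  · intro h
    exact ⟨⟨w, hw⟩, h, rfl⟩

/-! ### Generic stretching factors -/

/-- `l` is the limit of `|φ(w_n)| / n`, almost everywhere and in `L¹` with respect to the uniform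
measure on the boundary. Here `FreeGroup.norm` is the length of the freely reduced word. -/
def IsGenericStretchingFactor {k : ℕ} (φ : FreeGroup (Fin k) →* FreeGroup (Fin k)) (l : ℝ) :
    Prop :=
  (∀ᵐ w ∂(uniformMeasure k),
    Tendsto (fun n : ℕ => ((φ (rayPoint w n)).norm : ℝ) / n) atTop (𝓝 l)) ∧
  Tendsto (fun n : ℕ => eLpNorm (fun w => ((φ (rayPoint w n)).norm : ℝ) / n - l) 1
    (uniformMeasure k)) atTop (𝓝 0)

open Classical in
/-- The generic stretching factor `λ(φ)` of an endomorphism `φ` of `F(a_1, …, a_k)`, with the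
default value `0` should the limit not exist. -/
noncomputable def genericStretchingFactor {k : ℕ}
    (φ : FreeGroup (Fin k) →* FreeGroup (Fin k)) : ℝ :=
  if h : ∃ l, IsGenericStretchingFactor φ l then h.choose else 0

lemma IsGenericStretchingFactor.eq {k : ℕ} (hk : 1 ≤ k)
    {φ : FreeGroup (Fin k) →* FreeGroup (Fin k)} {l : ℝ} (hl : IsGenericStretchingFactor φ l) :
    genericStretchingFactor φ = l := by
  have := uniformMeasure_isProbabilityMeasure k hk
  have h : ∃ l, IsGenericStretchingFactor φ l := ⟨l, hl⟩
  rw [genericStretchingFactor, dif_pos h]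
  obtain ⟨w, h1, h2⟩ := (h.choose_spec.1.and hl.1).exists
  exact tendsto_nhds_unique h1 h2

/-! ### Cyclically reduced words and genericity -/

/-- The cyclically reduced length `‖w‖`: the length of the cyclically reduced form of `w`. -/
def cyclicLength {k : ℕ} (w : FreeGroup (Fin k)) : ℕ :=
  (FreeGroup.reduceCyclically w.toWord).length

/-- The set of cyclically reduced words, as elements of the free group. -/
def cyclicallyReducedWords (k : ℕ) : Set (FreeGroup (Fin k)) :=
  {w | FreeGroup.IsCyclicallyReduced w.toWord}

/-- The number of elements of length `n` in `S`. -/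
noncomputable def sphereCount {k : ℕ} (S : Set (FreeGroup (Fin k))) (n : ℕ) : ℕ :=
  {w ∈ S | w.norm = n}.ncard

/-- `S` is an exponentially `W`-generic subset of `W`: the proportion of elements of `S` among the
elements of `W` of length `n` tends to `1` exponentially fast. -/
def IsExponentiallyGeneric {k : ℕ} (S W : Set (FreeGroup (Fin k))) : Prop :=
  S ⊆ W ∧ ∃ σ D : ℝ, 0 < σ ∧ σ < 1 ∧ 0 < D ∧
    ∀ n : ℕ, 1 ≤ n → |(sphereCount S n : ℝ) / sphereCount W n - 1| ≤ D * σ ^ n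

/-! ### Simple automorphisms -/

/-- `τ` is induced by a permutation of `A^{±1}`. -/
def IsRelabeling {k : ℕ} (τ : MulAut (FreeGroup (Fin k))) : Prop :=
  ∃ t : Equiv.Perm (Letter k), ∀ x : Letter k, τ (FreeGroup.mk [x]) = FreeGroup.mk [t x]

/-- A simple automorphism is the composition of a relabeling automorphism and a conjugation. -/
def IsSimple {k : ℕ} (φ : MulAut (FreeGroup (Fin k))) : Prop :=
  ∃ (g : FreeGroup (Fin k)) (τ : MulAut (FreeGroup (Fin k))),
    IsRelabeling τ ∧ φ = MulAut.conj g * τ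

/-! ### Rough isometries and similarities -/

/-- The word metric on `F(a_1, …, a_k)`. -/
def wordDist {k : ℕ} (x y : FreeGroup (Fin k)) : ℝ := (x⁻¹ * y).norm

/-- `f : (X, d) → (Y, d')` is a rough isometry. -/
def IsRoughIsometry {X Y : Type*} (d : X → X → ℝ) (d' : Y → Y → ℝ) (f : X → Y) : Prop :=
  ∃ D : ℝ, 0 < D ∧ ∀ x y, |d' (f x) (f y) - d x y| ≤ D

/-- `f : (X, d) → (Y, d')` is a rough similarity. -/
def IsRoughSimilarity {X Y : Type*} (d : X → X → ℝ) (d' : Y → Y → ℝ) (f : X → Y) : Prop :=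
  ∃ c D : ℝ, 0 < c ∧ 0 < D ∧ ∀ x y, |d' (f x) (f y) - c * d x y| ≤ D

end FreeStretch

namespace FreeStretch

/-! ### Reduced words -/

section Words

variable {k : ℕ}

/-! The proof counts crossings in the Cayley tree of `F`. For a set `X` of vertices, `crossing X h`
records the translates of the geodesic from `1` to `h` having exactly one end in `X`. If `X` is the
cone of words beginning with `a_i`, this counts the letters `a_i^{±1}` of `h`. Since `φ` carries a
pair `(g, gh)` to `(φ g, φ g * φ h)`, the length `|φ h|` is the sum over `i` of the crossing numbers
of `h` with respect to the sets `X_i = φ⁻¹(cone of a_i)` (`norm_apply_eq_sum`). Each `X_i` has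
finite coboundary.

Existence of `λ(φ)`. A set with finite coboundary is constant on branches far from `1`, so crossing
numbers are additive on reduced concatenations up to a bounded error
(`exists_isQuasiAdditive_norm`). Means of quasi-additive functions grow linearly, and exponential
moments give exponentially small deviation probabilities (`IsQuasiAdditive.exists_card_le`).
Borel–Cantelli and dominated convergence yield the limit. The same estimates apply to the number of
occurrences of a two-letter reduced word, whose frequency is `1 / (2k(2k-1))`.

The gap. A geodesic passing through a vertex between two directions in which `X_i` is eventually
constant, with different constants, must cross `X_i`, up to boundedly many exceptions. If one vertex
`v` has all `2k` directions eventually constant, `a` of them in `X_i` and `b` outside, there are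
`2ab` separated ordered pairs. This is `2(2k-1)` at least, and `4(2k-2)` at least unless `a` or `b`
is `1`, when `X_i` is a cone up to a finite set. If there is no such vertex, two terminal vertices
facing each other contribute `2(2k-2)` each (`IsAlmostInvariant.dichotomy`,
`IsAlmostInvariant.exists_le_ncard_crossing`). Multiplying by the frequency and summing over `i`
gives `λ(φ) ≥ 1`, with an additional `2(2k-3) / (2k(2k-1))` as soon as some `X_i` is not an almost
cone.

If all `X_i` are almost cones, then `|φ g| ≤ |g| + C`. Taking powers shows that `φ` does not
increase cyclic lengths, and such automorphisms are simple (`isSimple_of_cyclicLength_le`). The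
generic set consists of the cyclically reduced words in which all two-letter reduced words are
frequent. On it the lower bound holds word by word, since passing to powers removes the additive
constant. For rough similarities the bound `λ ≥ 1` is applied to the inverse automorphism. -/

@[simp] lemma letterInv_letterInv (x : Letter k) : letterInv (letterInv x) = x := by
  simp [letterInv]

lemma letterInv_ne (x : Letter k) : letterInv x ≠ x := by
  intro h
  have := congrArg Prod.snd h
  simp [letterInv] at this

lemma letterInv_injective : Function.Injective (letterInv (k := k)) := fun x y h => by
  rw [← letterInv_letterInv x, h, letterInv_letterInv]

lemma letterInv_eq_comm {x y : Letter k} : letterInv x = y ↔ x = letterInv y :=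
  ⟨fun h => by rw [← h, letterInv_letterInv], fun h => by rw [h, letterInv_letterInv]⟩

lemma ne_letterInv_iff {x y : Letter k} : y ≠ letterInv x ↔ (x.1 = y.1 → x.2 = y.2) := by
  rcases x with ⟨x, b⟩
  rcases y with ⟨y, c⟩
  simp only [letterInv, ne_eq, Prod.mk.injEq, not_and]
  constructor
  · rintro h rfl
    have := h rfl
    revert this
    cases b <;> cases c <;> simp
  · rintro h rfl
    have := h rfl
    subst this
    cases b <;> simp

lemma isReduced_cons_cons {x y : Letter k} {l : List (Letter k)} :
    FreeGroup.IsReduced (x :: y :: l) ↔ y ≠ letterInv x ∧ FreeGroup.IsReduced (y :: l) := by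
  rw [ne_letterInv_iff, FreeGroup.IsReduced, List.isChain_cons_cons, FreeGroup.IsReduced]

/-- The words `u` of length `n` for which `x u` is freely reduced. -/
noncomputable def words (x : Letter k) (n : ℕ) : Finset (List (Letter k)) :=
  Set.Finite.toFinset (s := {u | u.length = n ∧ FreeGroup.IsReduced (x :: u)})
    ((List.finite_length_eq (Letter k) n).subset fun _ h => h.1)

lemma mem_words {x : Letter k} {n : ℕ} {u : List (Letter k)} :
    u ∈ words x n ↔ u.length = n ∧ FreeGroup.IsReduced (x :: u) := by
  simp [words]

lemma isReduced_of_mem_words {x : Letter k} {n : ℕ} {u : List (Letter k)} (h : u ∈ words x n) :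
    FreeGroup.IsReduced u :=
  (mem_words.1 h).2.infix ⟨[x], [], by simp⟩

lemma words_zero (x : Letter k) : words x 0 = {[]} := by
  ext u
  simp only [mem_words, List.length_eq_zero_iff, Finset.mem_singleton, and_iff_left_iff_imp]
  rintro rfl
  simp

lemma sum_words_succ (x : Letter k) (n : ℕ) (G : List (Letter k) → ℝ) :
    ∑ u ∈ words x (n + 1), G u =
      ∑ y with y ≠ letterInv x, ∑ u ∈ words y n, G (y :: u) := by
  rw [Finset.sum_sigma']
  symm
  refine Finset.sum_bij' (fun p _ => p.1 :: p.2)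
    (fun u _ => ⟨u.headD x, u.tail⟩) ?_ ?_ ?_ ?_ ?_
  · rintro ⟨y, u⟩ h
    simp only [Finset.mem_sigma, Finset.mem_filter, Finset.mem_univ, true_and, mem_words] at h
    rw [mem_words, isReduced_cons_cons]
    simpa [and_left_comm] using h
  · intro u h
    rw [mem_words] at h
    rcases u with _ | ⟨y, u⟩
    · simp at h
    · rw [isReduced_cons_cons] at h
      simpa [mem_words, and_left_comm] using h
  · rintro ⟨y, u⟩ h
    simp
  · intro u h
    rw [mem_words] at h
    rcases u with _ | ⟨y, u⟩
    · simp at h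
    · simp
  · rintro ⟨y, u⟩ h
    simp

lemma card_ne_letterInv (x : Letter k) (hk : 1 ≤ k) :
    (((Finset.univ.filter fun y : Letter k => y ≠ letterInv x).card : ℕ) : ℝ) = 2 * k - 1 := by
  classical
  rw [Finset.filter_ne', Finset.card_erase_of_mem (Finset.mem_univ _)]
  have : Fintype.card (Letter k) = 2 * k := by simp [mul_comm]
  rw [Finset.card_univ, this, Nat.cast_sub (by omega)]
  push_cast
  ring

lemma card_words (hk : 1 ≤ k) (x : Letter k) (n : ℕ) :
    ((words x n).card : ℝ) = (2 * k - 1 : ℝ) ^ n := by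
  induction n generalizing x with
  | zero => simp [words_zero]
  | succ n ih =>
    have := sum_words_succ x n fun _ => 1
    simp only [Finset.sum_const, nsmul_eq_mul, mul_one, ih] at this
    rw [this, card_ne_letterInv x hk, pow_succ']

/-- A word is cut after `a` letters, and the second factor depends on the first only through its
last letter. For an empty first factor the default in `getLastD` is `x` itself, the letter that
precedes the word. -/
lemma sum_words_add (x : Letter k) (a b : ℕ) (G : List (Letter k) → ℝ) :
    ∑ w ∈ words x (a + b), G w =
      ∑ u ∈ words x a, ∑ v ∈ words (u.getLastD x) b, G (u ++ v) := by
  induction a generalizing x G with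
  | zero => simp [words_zero]
  | succ a ih =>
    rw [show a + 1 + b = (a + b) + 1 by ring, sum_words_succ, sum_words_succ]
    refine Finset.sum_congr rfl fun y _ => ?_
    rw [ih]
    simp only [List.getLastD_cons, List.cons_append]

lemma isReduced_append_of_mem_words {x : Letter k} {a b : ℕ} {u v : List (Letter k)}
    (hu : u ∈ words x a) (hv : v ∈ words (u.getLastD x) b) : FreeGroup.IsReduced (u ++ v) := by
  induction a generalizing x u with
  | zero =>
    rw [words_zero, Finset.mem_singleton] at hu
    subst hu
    exact isReduced_of_mem_words hv
  | succ a ih =>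
    rw [mem_words] at hu
    rcases u with _ | ⟨y, u⟩
    · simp at hu
    · rw [isReduced_cons_cons] at hu
      rw [List.getLastD_cons] at hv
      have h1 : u ∈ words y a := mem_words.2 ⟨by simpa using hu.1, hu.2.2⟩
      have h2 := ih h1 hv
      rcases u with _ | ⟨z, u⟩
      · exact (mem_words.1 hv).2
      · rw [List.cons_append, List.cons_append, isReduced_cons_cons]
        have := hu.2.2
        rw [isReduced_cons_cons] at this
        exact ⟨this.1, h2⟩

/-- The average of `G` over the words of length `n` that may follow the letter `x`. -/
noncomputable def avg (x : Letter k) (n : ℕ) (G : List (Letter k) → ℝ) : ℝ :=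
  (∑ u ∈ words x n, G u) / (2 * k - 1 : ℝ) ^ n

lemma two_mul_sub_one_pos (hk : 2 ≤ k) : (3 : ℝ) ≤ 2 * k - 1 := by
  have : (2 : ℝ) ≤ k := by exact_mod_cast hk
  linarith

lemma avg_mono (hk : 2 ≤ k) {x : Letter k} {n : ℕ} {G H : List (Letter k) → ℝ}
    (h : ∀ u ∈ words x n, G u ≤ H u) : avg x n G ≤ avg x n H := by
  have := two_mul_sub_one_pos hk
  exact div_le_div_of_nonneg_right (Finset.sum_le_sum h) (by positivity)

lemma avg_const (hk : 2 ≤ k) (x : Letter k) (n : ℕ) (c : ℝ) : avg x n (fun _ => c) = c := by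
  have := two_mul_sub_one_pos hk
  have h : (0 : ℝ) < (2 * k - 1 : ℝ) ^ n := by positivity
  rw [avg, Finset.sum_const, nsmul_eq_mul, card_words (by omega)]
  field_simp

lemma avg_add (x : Letter k) (n : ℕ) (G H : List (Letter k) → ℝ) :
    avg x n (fun u => G u + H u) = avg x n G + avg x n H := by
  simp [avg, Finset.sum_add_distrib, add_div]

lemma avg_const_mul (x : Letter k) (n : ℕ) (c : ℝ) (G : List (Letter k) → ℝ) :
    avg x n (fun u => c * G u) = c * avg x n G := by
  simp [avg, ← Finset.mul_sum, mul_div_assoc]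

lemma avg_congr {x : Letter k} {n : ℕ} {G H : List (Letter k) → ℝ}
    (h : ∀ u ∈ words x n, G u = H u) : avg x n G = avg x n H := by
  rw [avg, avg, Finset.sum_congr rfl h]

lemma abs_avg_sub_avg_le (hk : 2 ≤ k) {x : Letter k} {n : ℕ} {G H : List (Letter k) → ℝ} {c : ℝ}
    (h : ∀ u ∈ words x n, |G u - H u| ≤ c) : |avg x n G - avg x n H| ≤ c := by
  have h1 : avg x n G ≤ avg x n (fun u => c + H u) :=
    avg_mono hk fun u hu => by linarith [(abs_le.1 (h u hu)).2]
  have h2 : avg x n H ≤ avg x n (fun u => c + G u) :=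
    avg_mono hk fun u hu => by linarith [(abs_le.1 (h u hu)).1]
  rw [avg_add, avg_const hk] at h1 h2
  exact abs_le.2 ⟨by linarith, by linarith⟩

lemma avg_succ (hk : 2 ≤ k) (x : Letter k) (n : ℕ) (G : List (Letter k) → ℝ) :
    avg x (n + 1) G =
      (∑ y with y ≠ letterInv x, avg y n fun u => G (y :: u)) / (2 * k - 1 : ℝ) := by
  have := two_mul_sub_one_pos hk
  have h : (0 : ℝ) < (2 * k - 1 : ℝ) ^ n := by positivity
  simp only [avg]
  rw [sum_words_succ, ← Finset.sum_div, div_div, pow_succ]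

lemma avg_add_length (hk : 2 ≤ k) (x : Letter k) (a b : ℕ) (G : List (Letter k) → ℝ) :
    avg x (a + b) G = avg x a fun u => avg (u.getLastD x) b fun v => G (u ++ v) := by
  have := two_mul_sub_one_pos hk
  simp only [avg]
  rw [sum_words_add, ← Finset.sum_div, div_div, pow_add, mul_comm]

end Words

/-! ### Large deviations for quasi-additive functions of reduced words -/

section QuasiAdditive

variable {k : ℕ}

/-- `S` is additive up to an error `B` on freely reduced concatenations. -/
def IsQuasiAdditive (S : List (Letter k) → ℝ) (B : ℝ) : Prop :=
  ∀ u v, FreeGroup.IsReduced (u ++ v) → |S (u ++ v) - S u - S v| ≤ B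

namespace IsQuasiAdditive

variable {S : List (Letter k) → ℝ} {B : ℝ}

lemma nonneg (hS : IsQuasiAdditive S B) : 0 ≤ B :=
  (abs_nonneg _).trans (hS [] [] (by simp))

lemma neg (hS : IsQuasiAdditive S B) : IsQuasiAdditive (fun u => -S u) B := fun u v h => by
  rw [← abs_neg]
  convert hS u v h using 2
  ring

/-- There are finitely many letters, so quasi-additivity bounds the effect of prepending one
uniformly; linear growth follows by induction. The summand `1` in the constant only secures
positivity. -/
lemma exists_cons_bound (hS : IsQuasiAdditive S B) :
    ∃ L, 0 < L ∧ (∀ y u, FreeGroup.IsReduced (y :: u) → |S (y :: u) - S u| ≤ L) ∧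
      ∀ u, FreeGroup.IsReduced u → |S u| ≤ L * (u.length + 1) := by
  classical
  have hB := hS.nonneg
  have hsum : ∀ y : Letter k, |S [y]| ≤ ∑ z : Letter k, |S [z]| := fun y =>
    Finset.single_le_sum (f := fun z : Letter k => |S [z]|) (fun _ _ => abs_nonneg _)
      (Finset.mem_univ y)
  have h0 : (0 : ℝ) ≤ ∑ z : Letter k, |S [z]| := Finset.sum_nonneg fun _ _ => abs_nonneg _
  have hcons : ∀ y u, FreeGroup.IsReduced (y :: u) →
      |S (y :: u) - S u| ≤ B + ∑ z : Letter k, |S [z]| + 1 := by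
    intro y u h
    have h1 := abs_le.1 (hS [y] u h)
    have h2 := abs_le.1 (hsum y)
    rw [List.singleton_append] at h1
    exact abs_le.2 ⟨by linarith, by linarith⟩
  refine ⟨B + ∑ z : Letter k, |S [z]| + 1, by positivity, hcons, fun u => ?_⟩
  induction u with
  | nil =>
    intro _
    have h1 := hS [] [] (by simp)
    simp only [List.append_nil, sub_self, zero_sub, abs_neg] at h1
    simp only [List.length_nil, Nat.cast_zero, zero_add, mul_one]
    linarith
  | cons y u ih =>
    intro h
    have h1 := abs_le.1 (hcons y u h)
    have h2 := abs_le.1 (ih (h.infix ⟨[y], [], by simp⟩))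
    rw [List.length_cons, Nat.cast_succ]
    exact abs_le.2 ⟨by linarith, by linarith⟩

/-- After one step, the means from `x` and from `x'` are, up to `L`, the same total over all letters
with a single summand omitted. Dividing by `2k - 1 ≥ 3` therefore contracts the discrepancy. -/
lemma exists_abs_avg_sub_le (hk : 2 ≤ k) (hS : IsQuasiAdditive S B) :
    ∃ Δ, ∀ n x x', |avg x n S - avg x' n S| ≤ Δ := by
  classical
  obtain ⟨L, hL, hcons, -⟩ := hS.exists_cons_bound
  have h3 := two_mul_sub_one_pos hk
  -- The recursion for the discrepancy is `e ↦ 2L + e / 3`, which preserves `e ≤ 4L`.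
  refine ⟨4 * L, fun n => ?_⟩
  induction n with
  | zero =>
    intro x x'
    simp only [avg, words_zero, sub_self, abs_zero]
    positivity
  | succ n ih =>
    have hstep : ∀ x, |avg x (n + 1) S -
        ((∑ y, avg y n S) - avg (letterInv x) n S) / (2 * k - 1 : ℝ)| ≤ L := by
      intro x
      have e1 : (∑ y, avg y n S) - avg (letterInv x) n S =
          ∑ y with y ≠ letterInv x, avg y n S := by
        rw [Finset.filter_ne', ← Finset.add_sum_erase _ _ (Finset.mem_univ (letterInv x))]
        ring
      rw [avg_succ hk, e1, ← sub_div, ← Finset.sum_sub_distrib, abs_div,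
        abs_of_pos (by linarith : (0 : ℝ) < 2 * k - 1), div_le_iff₀ (by linarith)]
      refine (Finset.abs_sum_le_sum_abs _ _).trans ?_
      refine (Finset.sum_le_card_nsmul _ _ L fun y _ => ?_).trans ?_
      · exact abs_avg_sub_avg_le hk fun u hu => hcons y u (mem_words.1 hu).2
      · rw [nsmul_eq_mul, card_ne_letterInv x (by omega), mul_comm]
    intro x x'
    have h1 := abs_le.1 (hstep x)
    have h2 := abs_le.1 (hstep x')
    have h4 : |((∑ y, avg y n S) - avg (letterInv x) n S) / (2 * k - 1 : ℝ) -
        ((∑ y, avg y n S) - avg (letterInv x') n S) / (2 * k - 1 : ℝ)| ≤ 4 * L / 3 := by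
      rw [← sub_div, abs_div, abs_of_pos (by linarith : (0 : ℝ) < 2 * k - 1)]
      refine div_le_div₀ (by positivity) ?_ (by norm_num) h3
      rw [sub_sub_sub_cancel_left]
      exact ih (letterInv x') (letterInv x)
    have h5 := abs_le.1 h4
    exact abs_le.2 ⟨by linarith, by linarith⟩

/-- The means of a quasi-additive function over words of length `n` grow linearly, up to a bounded
error. -/
lemma exists_mean (hk : 2 ≤ k) (hS : IsQuasiAdditive S B) :
    ∃ l Δ, 0 ≤ Δ ∧ ∀ n x, |avg x n S - l * n| ≤ Δ := by
  have x₀ : Letter k := (⟨0, by omega⟩, true)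
  obtain ⟨Δ, hΔ⟩ := hS.exists_abs_avg_sub_le hk
  have hB := hS.nonneg
  have hΔ0 : 0 ≤ Δ := (abs_nonneg _).trans (hΔ 0 x₀ x₀)
  have hadd : ∀ a b, |avg x₀ (a + b) S - avg x₀ a S - avg x₀ b S| ≤ B + Δ := by
    intro a b
    have h1 : avg x₀ (a + b) S = avg x₀ a fun u => avg (u.getLastD x₀) b fun v => S (u ++ v) :=
      avg_add_length hk _ _ _ _
    have h2 : |(avg x₀ a fun u => avg (u.getLastD x₀) b fun v => S (u ++ v)) -
        avg x₀ a (fun u => S u + avg x₀ b S)| ≤ B + Δ := by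
      refine abs_avg_sub_avg_le hk fun u hu => ?_
      have h3 : |(avg (u.getLastD x₀) b fun v => S (u ++ v)) -
          avg (u.getLastD x₀) b (fun v => S u + S v)| ≤ B :=
        abs_avg_sub_avg_le hk fun v hv => by
          rw [← sub_sub]
          exact hS u v (isReduced_append_of_mem_words hu hv)
      rw [avg_add, avg_const hk] at h3
      have h3 := abs_le.1 h3
      have h4 := abs_le.1 (hΔ b (u.getLastD x₀) x₀)
      exact abs_le.2 ⟨by linarith, by linarith⟩
    rw [avg_add, avg_const hk, ← h1] at h2
    rwa [sub_sub]
  obtain ⟨L, hL, -, hbound⟩ := hS.exists_cons_bound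
  have hm : ∀ n, |avg x₀ n S| ≤ L * (n + 1) := by
    intro n
    have := abs_avg_sub_avg_le hk (x := x₀) (n := n) (G := S) (H := fun _ => 0)
      (c := L * (n + 1)) fun u hu => by
        have := hbound u (isReduced_of_mem_words hu)
        rw [(mem_words.1 hu).1] at this
        simpa using this
    rwa [avg_const hk, sub_zero] at this
  -- Fekete's lemma for `m + (B + Δ)`. Applying it to the means and to their negatives gives the
  -- same rate with a bounded error on both sides.
  have key : ∀ m : ℕ → ℝ, (∀ n, |m n| ≤ L * (n + 1)) →
      (∀ a b, |m (a + b) - m a - m b| ≤ B + Δ) →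
      ∃ l, Tendsto (fun n : ℕ => m n / n) atTop (𝓝 l) ∧ ∀ n, l * n ≤ m n + (B + Δ) := by
    intro m hm hadd
    have hsub : Subadditive fun n => m n + (B + Δ) := fun a b => by
      linarith [(abs_le.1 (hadd a b)).2]
    have hbdd : BddBelow (Set.range fun n : ℕ => (m n + (B + Δ)) / n) := by
      refine ⟨-(2 * L), ?_⟩
      rintro _ ⟨n, rfl⟩
      rcases Nat.eq_zero_or_pos n with rfl | hn
      · simpa using hL.le
      · have hn' : (1 : ℝ) ≤ n := by exact_mod_cast hn
        simp only
        rw [le_div_iff₀ (by linarith)]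
        have := (abs_le.1 (hm n)).1
        nlinarith
    refine ⟨hsub.lim, ?_, ?_⟩
    · have h1 := hsub.tendsto_lim hbdd
      have h2 : Tendsto (fun n : ℕ => (B + Δ) / (n : ℝ)) atTop (𝓝 0) :=
        tendsto_const_div_atTop_nhds_zero_nat _
      have h3 := h1.sub h2
      simp only [sub_zero] at h3
      refine h3.congr fun n => ?_
      rw [add_div]
      ring
    · intro n
      rcases Nat.eq_zero_or_pos n with rfl | hn
      · have := abs_le.1 (hadd 0 0)
        simp only [add_zero, sub_self, zero_sub] at this
        simp only [Nat.cast_zero, mul_zero]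
        linarith
      · have hn' : (0 : ℝ) < n := by exact_mod_cast hn
        have := hsub.lim_le_div hbdd hn.ne'
        rwa [le_div_iff₀ hn'] at this
  obtain ⟨l, hl, hl1⟩ := key (fun n => avg x₀ n S) hm hadd
  obtain ⟨l', hl', hl2⟩ := key (fun n => -avg x₀ n S) (fun n => by rw [abs_neg]; exact hm n)
    (fun a b => by
      rw [← abs_neg]
      convert hadd a b using 2
      ring)
  have : l' = -l := by
    refine tendsto_nhds_unique hl' (hl.neg.congr fun n => ?_)
    rw [neg_div]
  subst this
  refine ⟨l, B + Δ + Δ, by positivity, fun n x => ?_⟩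
  have h1 := hl1 n
  have h2 := hl2 n
  have h3 := abs_le.1 (hΔ n x x₀)
  exact abs_le.2 ⟨by linarith, by linarith⟩

/-- Exponential moments are submultiplicative in the length, up to the factor `exp (θB)` that the
junction costs. Uniformity in the preceding letter replaces independence. -/
lemma avg_exp_add_le (hk : 2 ≤ k) (hS : IsQuasiAdditive S B) {θ : ℝ} (hθ : 0 ≤ θ) {a b : ℕ}
    {c d : ℝ} (hd0 : 0 ≤ d) (hc : ∀ x, avg x a (fun u => Real.exp (θ * S u)) ≤ c)
    (hd : ∀ x, avg x b (fun u => Real.exp (θ * S u)) ≤ d) (x : Letter k) :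
    avg x (a + b) (fun u => Real.exp (θ * S u)) ≤ Real.exp (θ * B) * c * d := by
  rw [avg_add_length hk]
  calc avg x a (fun u => avg (u.getLastD x) b fun v => Real.exp (θ * S (u ++ v)))
      ≤ avg x a (fun u => (Real.exp (θ * B) * d) * Real.exp (θ * S u)) := by
        refine avg_mono hk fun u hu => ?_
        have h1 : (avg (u.getLastD x) b fun v => Real.exp (θ * S (u ++ v))) ≤
            avg (u.getLastD x) b fun v =>
              (Real.exp (θ * B) * Real.exp (θ * S u)) * Real.exp (θ * S v) := by
          refine avg_mono hk fun v hv => ?_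
          rw [← Real.exp_add, ← Real.exp_add, Real.exp_le_exp]
          have := (abs_le.1 (hS u v (isReduced_append_of_mem_words hu hv))).2
          nlinarith
        rw [avg_const_mul] at h1
        refine h1.trans ?_
        rw [mul_right_comm]
        exact mul_le_mul_of_nonneg_right
          (mul_le_mul_of_nonneg_left (hd _) (by positivity)) (by positivity)
    _ ≤ Real.exp (θ * B) * c * d := by
        rw [avg_const_mul, mul_right_comm]
        exact mul_le_mul_of_nonneg_right
          (mul_le_mul_of_nonneg_left (hc x) (by positivity)) hd0

/-- A block length `N` is chosen so large that the junction and mean errors `B + Δ` cost less than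
`εN / 2`, and then `θ` so small that the quadratic term of the exponential costs at most the other
half. Submultiplicativity propagates the bound from one block to all lengths, and the incomplete
block only affects the constant. -/
lemma exists_avg_exp_le (hk : 2 ≤ k) (hS : IsQuasiAdditive S B) {l Δ : ℝ}
    (hl : ∀ n x, |avg x n S - l * n| ≤ Δ) {ε : ℝ} (hε : 0 < ε) :
    ∃ θ D : ℝ, 0 < θ ∧ 0 < D ∧ ∀ n x,
      avg x n (fun u => Real.exp (θ * S u)) ≤ D * Real.exp (θ * (l + ε) * n) := by
  have hB := hS.nonneg
  have x₀ : Letter k := (⟨0, by omega⟩, true)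
  have hΔ : 0 ≤ Δ := (abs_nonneg _).trans (hl 0 x₀)
  obtain ⟨L, hL, -, hbound⟩ := hS.exists_cons_bound
  obtain ⟨N, hN⟩ := exists_nat_gt (2 * (B + Δ) / ε)
  have hN0 : (0 : ℝ) < N := lt_of_le_of_lt (by positivity) hN
  rw [div_lt_iff₀ hε] at hN
  have hA : (0 : ℝ) < L * (N + 1) := by positivity
  set A : ℝ := L * (N + 1) with hA'
  -- The first bound gives `|θS| ≤ 1` on a block, so that `exp s ≤ 1 + s + s²` applies; the second
  -- gives `θA² ≤ εN / 2`.
  set θ : ℝ := min (1 / A) (ε * N / (2 * A ^ 2)) with hθ'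
  have hθ : 0 < θ := lt_min (by positivity) (by positivity)
  have hθ1 : θ * A ≤ 1 := by
    rw [← le_div_iff₀ hA]
    exact min_le_left _ _
  have hθ2 : θ * (2 * A ^ 2) ≤ ε * N := by
    rw [← le_div_iff₀ (by positivity)]
    exact min_le_right _ _
  have hbd : ∀ n ≤ N, ∀ x, ∀ u ∈ words x n, |S u| ≤ A := by
    intro n hn x u hu
    have := hbound u (isReduced_of_mem_words hu)
    rw [(mem_words.1 hu).1] at this
    refine this.trans (mul_le_mul_of_nonneg_left ?_ hL.le)
    have : (n : ℝ) ≤ N := by exact_mod_cast hn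
    linarith
  have hblock : ∀ x, Real.exp (θ * B) * avg x N (fun u => Real.exp (θ * S u)) ≤
      Real.exp (θ * (l + ε) * N) := by
    intro x
    have h1 : avg x N (fun u => Real.exp (θ * S u)) ≤
        avg x N (fun u => (1 + (θ * A) ^ 2) + θ * S u) := by
      refine avg_mono hk fun u hu => ?_
      have h2 : |θ * S u| ≤ θ * A := by
        rw [abs_mul, abs_of_pos hθ]
        exact mul_le_mul_of_nonneg_left (hbd N le_rfl x u hu) hθ.le
      have h3 := Real.abs_exp_sub_one_sub_id_le (h2.trans hθ1)
      have h4 : (θ * S u) ^ 2 ≤ (θ * A) ^ 2 := sq_le_sq' (abs_le.1 h2).1 (abs_le.1 h2).2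
      linarith [(abs_le.1 h3).2]
    rw [avg_add, avg_const hk, avg_const_mul] at h1
    have h5 : avg x N (fun u => Real.exp (θ * S u)) ≤
        Real.exp ((θ * A) ^ 2 + θ * avg x N S) :=
      (h1.trans (by linarith)).trans (Real.add_one_le_exp _)
    refine (mul_le_mul_of_nonneg_left h5 (by positivity)).trans ?_
    rw [← Real.exp_add, Real.exp_le_exp]
    have h6 := (abs_le.1 (hl N x)).2
    have h7 : θ * (A ^ 2 * θ + avg x N S + B) ≤ θ * ((l + ε) * N) :=
      mul_le_mul_of_nonneg_left (by linarith) hθ.le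
    nlinarith
  have hNpos : 0 < N := by exact_mod_cast hN0
  have hq : ∀ r < N, ∀ q : ℕ, ∀ x, avg x (q * N + r) (fun u => Real.exp (θ * S u)) ≤
      Real.exp 1 * Real.exp (θ * (l + ε) * (q * N)) := by
    intro r hr q
    induction q with
    | zero =>
      intro x
      rw [zero_mul, zero_add, Nat.cast_zero, zero_mul, mul_zero, Real.exp_zero, mul_one,
        ← avg_const hk x r (Real.exp 1)]
      refine avg_mono hk fun u hu => ?_
      rw [Real.exp_le_exp]
      have := (abs_le.1 (hbd r hr.le x u hu)).2
      nlinarith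
    | succ q ih =>
      intro x
      rw [show (q + 1) * N + r = N + (q * N + r) by ring]
      have h1 := hS.avg_exp_add_le hk hθ.le (a := N) (b := q * N + r)
        -- Dividing the block bound by `exp (θB)` compensates for the junction, so no loss
        -- accumulates with the number of blocks.
        (c := Real.exp (θ * (l + ε) * N) / Real.exp (θ * B))
        (d := Real.exp 1 * Real.exp (θ * (l + ε) * (q * N))) (by positivity)
        (fun x => by
          rw [le_div_iff₀ (by positivity), mul_comm]
          exact hblock x) ih x
      refine h1.trans (le_of_eq ?_)
      rw [mul_div_cancel₀ _ (Real.exp_ne_zero _)]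
      push_cast
      rw [show θ * (l + ε) * ((q + 1) * N) = θ * (l + ε) * N + θ * (l + ε) * (q * N) by ring,
        Real.exp_add]
      ring
  refine ⟨θ, Real.exp 1 * Real.exp (|θ * (l + ε)| * N), hθ, by positivity, fun n x => ?_⟩
  have h1 := hq (n % N) (Nat.mod_lt _ hNpos) (n / N) x
  rw [mul_comm (n / N) N, Nat.div_add_mod] at h1
  refine h1.trans ?_
  rw [mul_assoc (Real.exp 1)]
  refine mul_le_mul_of_nonneg_left ?_ (Real.exp_pos 1).le
  rw [← Real.exp_add, Real.exp_le_exp]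
  have h2 : ((n / N : ℕ) : ℝ) * N + ((n % N : ℕ) : ℝ) = n := by
    exact_mod_cast Nat.div_add_mod' n N
  have h3 : ((n % N : ℕ) : ℝ) ≤ N := by exact_mod_cast (Nat.mod_lt _ hNpos).le
  have h4 : (0 : ℝ) ≤ ((n % N : ℕ) : ℝ) := Nat.cast_nonneg _
  have h5 : -(θ * (l + ε)) * ((n % N : ℕ) : ℝ) ≤ |θ * (l + ε)| * N :=
    (mul_le_mul_of_nonneg_right (neg_le_abs _) h4).trans
      (mul_le_mul_of_nonneg_left h3 (abs_nonneg _))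
  rw [← h2]
  linarith

/-- Markov's inequality for `exp (θS)`: a moment bound at rate `l + ε / 2` against the threshold `l
+ ε` leaves the decay `exp (-θεn / 2)`. -/
lemma exists_card_upper_le (hk : 2 ≤ k) (hS : IsQuasiAdditive S B) {l Δ : ℝ}
    (hl : ∀ n x, |avg x n S - l * n| ≤ Δ) {ε : ℝ} (hε : 0 < ε) :
    ∃ σ D : ℝ, 0 < σ ∧ σ < 1 ∧ 0 < D ∧ ∀ n x,
      (((words x n).filter fun u => ε * n < S u - l * n).card : ℝ) ≤
        D * σ ^ n * (2 * k - 1 : ℝ) ^ n := by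
  obtain ⟨θ, D, hθ, hD, h⟩ := hS.exists_avg_exp_le hk hl (half_pos hε)
  refine ⟨Real.exp (-(θ * ε / 2)), D, Real.exp_pos _, ?_, hD, fun n x => ?_⟩
  · rw [Real.exp_lt_one_iff]
    have := mul_pos hθ hε
    linarith
  have h3 := two_mul_sub_one_pos hk
  have hpow : (0 : ℝ) < (2 * k - 1 : ℝ) ^ n := by positivity
  have h1 := h n x
  rw [avg, div_le_iff₀ hpow] at h1
  have h2 : (((words x n).filter fun u => ε * n < S u - l * n).card : ℝ) *
      Real.exp (θ * ((l + ε) * n)) ≤ ∑ u ∈ words x n, Real.exp (θ * S u) := by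
    rw [← nsmul_eq_mul]
    refine (Finset.card_nsmul_le_sum _ (fun u => Real.exp (θ * S u)) _ fun u hu => ?_).trans
      (Finset.sum_le_sum_of_subset_of_nonneg (Finset.filter_subset _ _)
        fun _ _ _ => (Real.exp_pos _).le)
    rw [Real.exp_le_exp]
    have := (Finset.mem_filter.1 hu).2
    exact mul_le_mul_of_nonneg_left (by linarith) hθ.le
  have h4 := h2.trans h1
  rw [← le_div_iff₀ (Real.exp_pos _)] at h4
  refine h4.trans (le_of_eq ?_)
  rw [← Real.exp_nat_mul, div_eq_iff (Real.exp_ne_zero _)]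
  have : Real.exp (θ * (l + ε / 2) * n) =
      Real.exp (n * -(θ * ε / 2)) * Real.exp (θ * ((l + ε) * n)) := by
    rw [← Real.exp_add]
    congr 1
    ring
  rw [this]
  ring

/-- Large deviations: the proportion of words on which a quasi-additive function is far from its
mean decays exponentially. -/
theorem exists_card_le (hk : 2 ≤ k) (hS : IsQuasiAdditive S B) {l Δ : ℝ}
    (hl : ∀ n x, |avg x n S - l * n| ≤ Δ) {ε : ℝ} (hε : 0 < ε) :
    ∃ σ D : ℝ, 0 < σ ∧ σ < 1 ∧ 0 < D ∧ ∀ n x,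
      (((words x n).filter fun u => ε * n < |S u - l * n|).card : ℝ) ≤
        D * σ ^ n * (2 * k - 1 : ℝ) ^ n := by
  classical
  obtain ⟨σ, D, hσ, hσ1, hD, h⟩ := hS.exists_card_upper_le hk hl hε
  obtain ⟨σ', D', hσ', hσ1', hD', h'⟩ := hS.neg.exists_card_upper_le hk (l := -l) (Δ := Δ)
    (fun n x => by
      have := avg_const_mul x n (-1) S
      simp only [neg_one_mul] at this
      rw [this, ← abs_neg]
      convert hl n x using 2
      ring) hε
  have h3 := two_mul_sub_one_pos hk
  refine ⟨max σ σ', D + D', lt_max_of_lt_left hσ, max_lt hσ1 hσ1', by positivity, fun n x => ?_⟩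
  have hsub : ((words x n).filter fun u => ε * n < |S u - l * n|) ⊆
      ((words x n).filter fun u => ε * n < S u - l * n) ∪
        ((words x n).filter fun u => ε * n < -S u - -l * n) := by
    intro u hu
    rw [Finset.mem_filter] at hu
    rw [Finset.mem_union, Finset.mem_filter, Finset.mem_filter]
    rcases lt_abs.1 hu.2 with h | h
    · exact Or.inl ⟨hu.1, h⟩
    · exact Or.inr ⟨hu.1, by linarith⟩
  have hc : (((words x n).filter fun u => ε * n < |S u - l * n|).card : ℝ) ≤
      ((words x n).filter fun u => ε * n < S u - l * n).card +
        ((words x n).filter fun u => ε * n < -S u - -l * n).card := by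
    exact_mod_cast (Finset.card_le_card hsub).trans (Finset.card_union_le _ _)
  refine hc.trans ((add_le_add (h n x) (h' n x)).trans ?_)
  rw [← add_mul, add_mul D D']
  gcongr
  · exact le_max_left _ _
  · exact le_max_right _ _

end IsQuasiAdditive

end QuasiAdditive

/-! ### Occurrences of two-letter subwords -/

section PairCount

variable {k : ℕ}

/-- The number of occurrences of the two-letter word `p q` in a word. -/
def pairCount (p q : Letter k) (u : List (Letter k)) : ℕ :=
  ∑ j ∈ Finset.range u.length, if u[j]? = some p ∧ u[j + 1]? = some q then 1 else 0

lemma pairCount_cons (p q x : Letter k) (u : List (Letter k)) :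
    pairCount p q (x :: u) = pairCount p q u + if x = p ∧ u.head? = some q then 1 else 0 := by
  rw [pairCount, List.length_cons, Finset.sum_range_succ', pairCount]
  simp [List.head?_eq_getElem?]

/-- Occurrences inside either factor survive, and at most one new occurrence straddles the junction.
-/
lemma pairCount_append (p q : Letter k) (u v : List (Letter k)) :
    pairCount p q u + pairCount p q v ≤ pairCount p q (u ++ v) ∧
      pairCount p q (u ++ v) ≤ pairCount p q u + pairCount p q v + 1 := by
  induction u with
  | nil => simp [pairCount]
  | cons x u ih =>
    rw [List.cons_append, pairCount_cons, pairCount_cons]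
    rcases u with _ | ⟨y, u⟩
    · simp only [pairCount, List.nil_append, List.length_nil, Finset.range_zero, Finset.sum_empty,
        List.head?_nil]
      split_ifs <;> simp_all
    · have e : (y :: u ++ v).head? = (y :: u).head? := rfl
      rw [e]
      omega

lemma isQuasiAdditive_pairCount (p q : Letter k) :
    IsQuasiAdditive (fun u => (pairCount p q u : ℝ)) 1 := fun u v _ => by
  obtain ⟨h1, h2⟩ := pairCount_append p q u v
  have h1' : (pairCount p q u + pairCount p q v : ℝ) ≤ pairCount p q (u ++ v) := by
    exact_mod_cast h1
  have h2' : (pairCount p q (u ++ v) : ℝ) ≤ pairCount p q u + pairCount p q v + 1 := by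
    exact_mod_cast h2
  exact abs_le.2 ⟨by linarith, by linarith⟩

lemma pairCount_flatten_replicate (p q : Letter k) (u : List (Letter k)) (N : ℕ) :
    N * pairCount p q u ≤ pairCount p q (List.replicate N u).flatten := by
  induction N with
  | zero => simp
  | succ N ih =>
    rw [List.replicate_succ, List.flatten_cons]
    have := (pairCount_append p q u (List.replicate N u).flatten).1
    linarith

/-- The uniform distribution on letters is stationary, because every letter has `2k - 1` admissible
predecessors. Each additional letter thus contributes the same amount to the sum over initial
letters, which makes it exact rather than asymptotic. -/
lemma sum_avg_pairCount (hk : 2 ≤ k) {p q : Letter k} (hpq : q ≠ letterInv p) (n : ℕ) :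
    ∑ y, avg y n (fun u => (pairCount p q (y :: u) : ℝ)) = n / (2 * k - 1 : ℝ) := by
  classical
  have h3 := two_mul_sub_one_pos hk
  induction n with
  | zero => simp [avg, words_zero, pairCount]
  | succ n ih =>
    have h1 : ∀ y : Letter k, avg y (n + 1) (fun u => (pairCount p q (y :: u) : ℝ)) =
        (∑ z with z ≠ letterInv y, ((if y = p ∧ z = q then 1 else 0) +
          avg z n (fun u => (pairCount p q (z :: u) : ℝ)))) / (2 * k - 1 : ℝ) := by
      intro y
      rw [avg_succ hk]
      congr 1
      refine Finset.sum_congr rfl fun z _ => ?_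
      rw [← avg_const hk z n (if y = p ∧ z = q then (1 : ℝ) else 0), ← avg_add]
      refine avg_congr fun u _ => ?_
      rw [pairCount_cons p q y]
      simp [add_comm]
    simp_rw [h1]
    rw [← Finset.sum_div]
    congr 1
    simp_rw [Finset.sum_add_distrib]
    have h4 : ∑ y : Letter k, ∑ z with z ≠ letterInv y, (if y = p ∧ z = q then (1 : ℝ) else 0) =
        1 := by
      simp_rw [Finset.sum_filter]
      rw [Finset.sum_eq_single p, Finset.sum_eq_single q]
      · simp [hpq]
      · intro z _ hz
        simp [hz]
      · simp
      · intro y _ hy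
        simp [hy]
      · simp
    have h5 : ∑ y : Letter k, ∑ z with z ≠ letterInv y,
        avg z n (fun u => (pairCount p q (z :: u) : ℝ)) = n := by
      simp_rw [Finset.sum_filter]
      rw [Finset.sum_comm]
      have : ∀ z : Letter k, ∑ y : Letter k, (if z ≠ letterInv y then
          avg z n (fun u => (pairCount p q (z :: u) : ℝ)) else 0) =
          (2 * k - 1 : ℝ) * avg z n (fun u => (pairCount p q (z :: u) : ℝ)) := by
        intro z
        rw [← Finset.sum_filter, Finset.sum_const, nsmul_eq_mul]
        congr 1
        rw [← card_ne_letterInv z (by omega)]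
        congr 2
        ext y
        simp only [Finset.mem_filter, Finset.mem_univ, true_and, ne_eq, not_iff_not]
        exact ⟨fun h => by rw [h, letterInv_letterInv], fun h => by rw [h, letterInv_letterInv]⟩
      rw [Finset.sum_congr rfl fun z _ => this z, ← Finset.mul_sum, ih]
      field_simp
    rw [h4, h5]
    push_cast
    ring

/-- `exists_mean` supplies some linear rate. Prepending the initial letter changes a count by at
most `1`, so the exact sum over the `2k` initial letters identifies that rate. -/
lemma exists_avg_pairCount (hk : 2 ≤ k) {p q : Letter k} (hpq : q ≠ letterInv p) :
    ∃ Δ, ∀ n x, |avg x n (fun u => (pairCount p q u : ℝ)) - 1 / (2 * k * (2 * k - 1)) * n| ≤ Δ := by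
  classical
  have h3 := two_mul_sub_one_pos hk
  have hk0 : (0 : ℝ) < k := by positivity
  obtain ⟨l, Δ, hΔ, h⟩ := (isQuasiAdditive_pairCount p q).exists_mean hk
  suffices hl : l = 1 / (2 * k * (2 * k - 1)) from ⟨Δ, hl ▸ h⟩
  have key : ∀ n : ℕ, |n / (2 * k - 1 : ℝ) - 2 * k * (l * n)| ≤ 2 * k * (Δ + 1) := by
    intro n
    rw [← sum_avg_pairCount hk hpq n]
    have hc : (Finset.univ : Finset (Letter k)).card = 2 * k := by simp [mul_comm]
    have : (2 * k * (l * n) : ℝ) = ∑ _y : Letter k, l * n := by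
      rw [Finset.sum_const, hc, nsmul_eq_mul]
      push_cast
      ring
    rw [this, ← Finset.sum_sub_distrib]
    refine (Finset.abs_sum_le_sum_abs _ _).trans
      ((Finset.sum_le_card_nsmul _ _ (Δ + 1) fun y _ => ?_).trans (le_of_eq ?_))
    · have h1 : |avg y n (fun u => (pairCount p q (y :: u) : ℝ)) -
          avg y n (fun u => (pairCount p q u : ℝ))| ≤ 1 := by
        refine abs_avg_sub_avg_le hk fun u _ => ?_
        rw [pairCount_cons]
        push_cast
        rw [add_sub_cancel_left]
        split_ifs <;> simp
      have h1 := abs_le.1 h1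
      have h2 := abs_le.1 (h n y)
      exact abs_le.2 ⟨by linarith, by linarith⟩
    · rw [hc, nsmul_eq_mul]
      push_cast
      ring
  have hzero : 1 / (2 * k - 1 : ℝ) - 2 * k * l = 0 := by
    by_contra hne
    have hpos : 0 < |1 / (2 * k - 1 : ℝ) - 2 * k * l| := abs_pos.2 hne
    obtain ⟨n, hn⟩ := exists_nat_gt (2 * k * (Δ + 1) / |1 / (2 * k - 1 : ℝ) - 2 * k * l|)
    rw [div_lt_iff₀ hpos] at hn
    have h1 := key n
    rw [show (n / (2 * k - 1 : ℝ) - 2 * k * (l * n)) = n * (1 / (2 * k - 1 : ℝ) - 2 * k * l) by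
      ring, abs_mul, Nat.abs_cast] at h1
    linarith
  have h4 : (2 * k - 1 : ℝ) ≠ 0 := by linarith
  field_simp at hzero ⊢
  linarith

end PairCount

/-! ### Cones and crossing numbers -/

section Crossing

variable {k : ℕ}

lemma toWord_mk_of_isReduced {u : List (Letter k)} (h : FreeGroup.IsReduced u) :
    (FreeGroup.mk u).toWord = u := by
  rw [FreeGroup.toWord_mk, h.reduce_eq]

lemma norm_mk_of_isReduced {u : List (Letter k)} (h : FreeGroup.IsReduced u) :
    (FreeGroup.mk u).norm = u.length := by
  rw [FreeGroup.norm, toWord_mk_of_isReduced h]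

lemma toWord_mk_singleton (x : Letter k) : (FreeGroup.mk [x]).toWord = [x] :=
  toWord_mk_of_isReduced (by simp)

lemma mk_singleton_inv (x : Letter k) :
    (FreeGroup.mk [x])⁻¹ = (FreeGroup.mk [letterInv x] : FreeGroup (Fin k)) := by
  simp [FreeGroup.inv_mk, FreeGroup.invRev, letterInv]

lemma mk_cons (x : Letter k) (u : List (Letter k)) :
    (FreeGroup.mk (x :: u) : FreeGroup (Fin k)) = FreeGroup.mk [x] * FreeGroup.mk u := by
  simp [FreeGroup.mul_mk]

lemma toWord_mul_of_isReduced {g h : FreeGroup (Fin k)}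
    (H : FreeGroup.IsReduced (g.toWord ++ h.toWord)) : (g * h).toWord = g.toWord ++ h.toWord := by
  rw [FreeGroup.toWord_mul, H.reduce_eq]

lemma isReduced_append {u v : List (Letter k)} :
    FreeGroup.IsReduced (u ++ v) ↔ FreeGroup.IsReduced u ∧ FreeGroup.IsReduced v ∧
      ∀ x ∈ u.getLast?, ∀ y ∈ v.head?, y ≠ letterInv x := by
  simp only [ne_letterInv_iff]
  exact List.isChain_append

lemma head?_toWord_inv (g : FreeGroup (Fin k)) :
    g⁻¹.toWord.head? = g.toWord.getLast?.map letterInv := by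
  rw [FreeGroup.toWord_inv, FreeGroup.invRev, List.head?_reverse, List.getLast?_map]
  rfl

lemma isReduced_toWord_append {g h : FreeGroup (Fin k)} :
    FreeGroup.IsReduced (g.toWord ++ h.toWord) ↔
      ∀ x ∈ g.toWord.getLast?, ∀ y ∈ h.toWord.head?, y ≠ letterInv x := by
  rw [isReduced_append]
  exact ⟨fun h => h.2.2, fun h => ⟨FreeGroup.isReduced_toWord, FreeGroup.isReduced_toWord, h⟩⟩

/-- The elements `g` for which the geodesic from `v` to `g` starts in the direction `x`. -/
def cone (v : FreeGroup (Fin k)) (x : Letter k) : Set (FreeGroup (Fin k)) :=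
  {g | (v⁻¹ * g).toWord.head? = some x}

/-- The translates `g` of the geodesic from `1` to `h` that join `X` with its complement. -/
def crossing (X : Set (FreeGroup (Fin k))) (h : FreeGroup (Fin k)) : Set (FreeGroup (Fin k)) :=
  {g | ¬(g ∈ X ↔ g * h ∈ X)}

/-- `X` has finite coboundary. -/
def IsAlmostInvariant (X : Set (FreeGroup (Fin k))) : Prop := ∀ h, (crossing X h).Finite

lemma ncard_preimage_mul_right (u : FreeGroup (Fin k)) (s : Set (FreeGroup (Fin k))) :
    {g | g * u ∈ s}.ncard = s.ncard := by
  have : {g | g * u ∈ s} = (fun g => g * u⁻¹) '' s := by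
    ext g
    simp only [Set.mem_ofPred_eq, Set.mem_image]
    exact ⟨fun h => ⟨_, h, by simp⟩, by rintro ⟨g, h, rfl⟩; simpa using h⟩
  rw [this, Set.ncard_image_of_injective _ (mul_left_injective _)]

lemma finite_preimage_mul_right (u : FreeGroup (Fin k)) {s : Set (FreeGroup (Fin k))}
    (hs : s.Finite) : {g | g * u ∈ s}.Finite :=
  hs.preimage (mul_left_injective u).injOn

lemma crossing_mul (X : Set (FreeGroup (Fin k))) (u v : FreeGroup (Fin k)) :
    crossing X (u * v) =
      (crossing X u \ {g | g * u ∈ crossing X v}) ∪ ({g | g * u ∈ crossing X v} \ crossing X u) := by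
  ext g
  simp only [crossing, Set.mem_union, Set.mem_sdiff, Set.mem_ofPred_eq, mul_assoc]
  tauto

lemma finite_crossing_mul {X : Set (FreeGroup (Fin k))} {u v : FreeGroup (Fin k)}
    (hu : (crossing X u).Finite) (hv : (crossing X v).Finite) : (crossing X (u * v)).Finite := by
  rw [crossing_mul]
  exact (hu.subset Set.sdiff_subset).union
    ((finite_preimage_mul_right u hv).subset Set.sdiff_subset)

/-- A concatenated path has its ends on different sides exactly when one of its two halves does and
the other does not. A translate with both halves crossing is counted twice on the right and not at
all on the left. -/
lemma ncard_crossing_mul {X : Set (FreeGroup (Fin k))} {u v : FreeGroup (Fin k)}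
    (hu : (crossing X u).Finite) (hv : (crossing X v).Finite) :
    (crossing X (u * v)).ncard + 2 * (crossing X u ∩ {g | g * u ∈ crossing X v}).ncard =
      (crossing X u).ncard + (crossing X v).ncard := by
  have hv' := finite_preimage_mul_right u hv
  rw [crossing_mul, Set.ncard_union_eq _ (hu.subset Set.sdiff_subset) (hv'.subset Set.sdiff_subset),
    ← ncard_preimage_mul_right u (crossing X v)]
  · have h1 := Set.ncard_inter_add_ncard_sdiff_eq_ncard (crossing X u)
      {g | g * u ∈ crossing X v} hu
    have h2 := Set.ncard_inter_add_ncard_sdiff_eq_ncard {g | g * u ∈ crossing X v}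
      (crossing X u) hv'
    rw [Set.inter_comm] at h2
    omega
  · exact Set.disjoint_left.2 fun g h1 h2 => h1.2 h2.1

lemma crossing_one (X : Set (FreeGroup (Fin k))) : crossing X 1 = ∅ := by
  simp [crossing]

lemma isAlmostInvariant_of_letters {X : Set (FreeGroup (Fin k))}
    (h : ∀ x, (crossing X (FreeGroup.mk [x])).Finite) : IsAlmostInvariant X := by
  intro g
  rw [← FreeGroup.mk_toWord (x := g)]
  induction g.toWord with
  | nil => simp [← FreeGroup.one_eq_mk, crossing_one]
  | cons x u ih =>
    rw [mk_cons]
    exact finite_crossing_mul (h x) ih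

/-- Right multiplication acts at the end of the word, so it can change the first letter only if the
word is empty or becomes empty. -/
lemma head?_toWord_mul_letter {g : FreeGroup (Fin k)} {y : Letter k} (h1 : g ≠ 1)
    (h2 : g ≠ FreeGroup.mk [letterInv y]) :
    (g * FreeGroup.mk [y]).toWord.head? = g.toWord.head? := by
  obtain ⟨u, z, huz⟩ : ∃ u z, g.toWord = u ++ [z] := by
    rcases List.eq_nil_or_concat g.toWord with h | ⟨u, z, h⟩
    · exact absurd (FreeGroup.toWord_eq_nil_iff.1 h) h1
    · exact ⟨u, z, by simpa using h⟩
  by_cases hz : y = letterInv z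
  · have hu : FreeGroup.IsReduced u :=
      (huz ▸ FreeGroup.isReduced_toWord (x := g)).infix ⟨[], [z], by simp⟩
    have hg : g = FreeGroup.mk u * FreeGroup.mk [z] := by
      rw [FreeGroup.mul_mk, ← huz, FreeGroup.mk_toWord]
    have : g * FreeGroup.mk [y] = FreeGroup.mk u := by
      rw [hg, hz, ← mk_singleton_inv, mul_assoc, mul_inv_cancel, mul_one]
    rw [this, toWord_mk_of_isReduced hu, huz]
    rcases u with _ | ⟨a, u⟩
    · exfalso
      apply h2
      rw [hg, hz, letterInv_letterInv, ← FreeGroup.one_eq_mk, one_mul]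
    · rfl
  · rw [toWord_mul_of_isReduced, huz]
    · rcases u with _ | ⟨a, u⟩ <;> rfl
    · rw [isReduced_toWord_append, huz, toWord_mk_singleton]
      simpa using hz

lemma mem_cone_one {x : Letter k} {g : FreeGroup (Fin k)} :
    g ∈ cone 1 x ↔ g.toWord.head? = some x := by
  simp [cone]

/-- The coboundary of the cone is the single edge between `1` and `x`, traversed from `1` by the
letter `x` and from `x` by its inverse. -/
lemma crossing_cone_letter (x y : Letter k) :
    crossing (cone 1 x) (FreeGroup.mk [y]) =
      if y = x then {1} else if y = letterInv x then {FreeGroup.mk [x]} else ∅ := by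
  ext g
  simp only [crossing, Set.mem_ofPred_eq, mem_cone_one]
  by_cases h1 : g = 1
  · subst h1
    rw [one_mul, toWord_mk_singleton]
    have : (1 : FreeGroup (Fin k)) ≠ FreeGroup.mk [x] := fun h => by
      have := congrArg FreeGroup.toWord h
      rw [toWord_mk_singleton] at this
      simp at this
    split_ifs with h h' <;> simp [h, this]
  · by_cases h2 : g = FreeGroup.mk [letterInv y]
    · subst h2
      rw [← mk_singleton_inv, inv_mul_cancel, mk_singleton_inv, toWord_mk_singleton]
      have h3 : ∀ z w : Letter k, (FreeGroup.mk [z] : FreeGroup (Fin k)) = FreeGroup.mk [w] ↔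
          z = w := fun z w => by
        rw [← FreeGroup.toWord_inj, toWord_mk_singleton, toWord_mk_singleton]
        simp
      split_ifs with h h'
      · subst h
        simpa [letterInv_ne] using h1
      · subst h'
        simp
      · have : letterInv y ≠ x := fun e => h' (letterInv_eq_comm.1 e)
        simp [this]
    · rw [head?_toWord_mul_letter h1 h2]
      split_ifs with h h'
      · simpa using h1
      · have : g ≠ FreeGroup.mk [x] := by
          rw [h', letterInv_letterInv] at h2
          exact h2
        simpa using this
      · simp

lemma isAlmostInvariant_cone_one (x : Letter k) : IsAlmostInvariant (cone 1 x) := by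
  refine isAlmostInvariant_of_letters fun y => ?_
  rw [crossing_cone_letter]
  split_ifs <;> simp

/-- The number of edges labelled by `x` that a geodesic crosses. -/
lemma ncard_crossing_cone_one (x : Letter k) (h : FreeGroup (Fin k)) :
    (crossing (cone 1 x) h).ncard = h.toWord.countP fun y => y.1 = x.1 := by
  obtain ⟨u, hu, rfl⟩ : ∃ u, FreeGroup.IsReduced u ∧ FreeGroup.mk u = h :=
    ⟨_, FreeGroup.isReduced_toWord, FreeGroup.mk_toWord⟩
  rw [toWord_mk_of_isReduced hu]
  induction u with
  | nil => simp [← FreeGroup.one_eq_mk, crossing_one]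
  | cons y u ih =>
    have hu' : FreeGroup.IsReduced u := hu.infix ⟨[y], [], by simp⟩
    have h1 := ncard_crossing_mul (isAlmostInvariant_cone_one x (FreeGroup.mk [y]))
      (isAlmostInvariant_cone_one x (FreeGroup.mk u))
    rw [← mk_cons, ih hu'] at h1
    have hhead : ∀ z ∈ u.head?, z ≠ letterInv y := by
      intro z hz
      rcases u with _ | ⟨a, u⟩
      · simp at hz
      · obtain rfl : a = z := by simpa using hz
        exact (isReduced_cons_cons.1 hu).1
    -- A reduced path does not recross an edge, so no translate crosses in both parts and the counts
    -- add exactly.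
    have h2 : crossing (cone 1 x) (FreeGroup.mk [y]) ∩
        {g | g * FreeGroup.mk [y] ∈ crossing (cone 1 x) (FreeGroup.mk u)} = ∅ := by
      rw [crossing_cone_letter, Set.eq_empty_iff_forall_notMem]
      rintro g ⟨hg1, hg2⟩
      split_ifs at hg1 with hy hy'
      · obtain rfl : g = 1 := hg1
        subst hy
        apply hg2
        rw [one_mul, mem_cone_one, mem_cone_one, ← mk_cons, toWord_mk_singleton,
          toWord_mk_of_isReduced hu]
        simp
      · obtain rfl : g = _ := hg1
        apply hg2
        rw [hy', ← mk_singleton_inv, mul_inv_cancel, one_mul, mem_cone_one, mem_cone_one,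
          toWord_mk_of_isReduced hu']
        simp only [FreeGroup.toWord_one, List.head?_nil, reduceCtorEq, false_iff]
        exact fun e => hhead x e (by rw [hy', letterInv_letterInv])
      · exact hg1
    rw [h2, Set.ncard_empty, mul_zero, add_zero] at h1
    rw [h1, List.countP_cons, add_comm, crossing_cone_letter]
    congr 1
    by_cases hy : y.1 = x.1
    · have : y = x ∨ y = letterInv x := by
        rcases x with ⟨i, b⟩
        rcases y with ⟨j, c⟩
        simp only at hy
        subst hy
        cases b <;> cases c <;> simp [letterInv]
      rcases this with rfl | rfl
      · simp
      · rw [if_neg (letterInv_ne x), if_pos rfl]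
        simp [letterInv]
    · have h3 : y ≠ x := fun e => hy (by rw [e])
      have h4 : y ≠ letterInv x := fun e => hy (by rw [e]; rfl)
      simp [h3, h4, hy]

/-- Each letter of `h` is counted for exactly one generator. The point is to express length through
sets, on which automorphisms act by preimage. -/
lemma norm_eq_sum_ncard_crossing (h : FreeGroup (Fin k)) :
    h.norm = ∑ i : Fin k, (crossing (cone 1 (i, true)) h).ncard := by
  simp_rw [ncard_crossing_cone_one]
  rw [FreeGroup.norm]
  induction h.toWord with
  | nil => simp
  | cons y u ih =>
    simp_rw [List.countP_cons]
    rw [Finset.sum_add_distrib, ← ih]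
    simp

lemma crossing_preimage (φ : MulAut (FreeGroup (Fin k))) (X : Set (FreeGroup (Fin k)))
    (h : FreeGroup (Fin k)) : crossing (φ ⁻¹' X) h = φ ⁻¹' crossing X (φ h) := by
  ext g
  simp [crossing]

lemma isAlmostInvariant_preimage (φ : MulAut (FreeGroup (Fin k))) {X : Set (FreeGroup (Fin k))}
    (hX : IsAlmostInvariant X) : IsAlmostInvariant (φ ⁻¹' X) := fun h => by
  rw [crossing_preimage]
  exact (hX _).preimage φ.injective.injOn

/-- The length of the image is computed in the source tree: `φ` is a bijection between the crossing
translates of `h` for the pulled-back cone and those of `φ h` for the cone. -/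
lemma norm_apply_eq_sum (φ : MulAut (FreeGroup (Fin k))) (h : FreeGroup (Fin k)) :
    (φ h).norm = ∑ i : Fin k, (crossing (φ ⁻¹' cone 1 (i, true)) h).ncard := by
  rw [norm_eq_sum_ncard_crossing]
  refine Finset.sum_congr rfl fun i _ => ?_
  rw [crossing_preimage]
  exact (Set.ncard_preimage_of_injective_subset_range φ.injective
    (by rw [φ.surjective.range_eq]; exact Set.subset_univ _)).symm

/-! ### Bounded cancellation. -/

lemma finite_norm_lt (R : ℕ) : {g : FreeGroup (Fin k) | g.norm < R}.Finite :=
  (List.finite_length_lt (Letter k) R).preimage FreeGroup.toWord_injective.injOn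

/-- An almost invariant set is constant on the branches outside a large ball. -/
lemma IsAlmostInvariant.exists_radius {X : Set (FreeGroup (Fin k))} (hX : IsAlmostInvariant X) :
    ∃ R, ∀ g t : FreeGroup (Fin k), R ≤ g.norm → FreeGroup.IsReduced (g.toWord ++ t.toWord) →
      (g ∈ X ↔ g * t ∈ X) := by
  -- Along a branch, membership can change only at a coboundary edge, and the starting points of all
  -- these edges lie in one ball.
  have hfin : (⋃ x : Letter k, crossing X (FreeGroup.mk [x])).Finite :=
    Set.finite_iUnion fun x => hX _
  obtain ⟨R, hR⟩ := (hfin.image FreeGroup.norm).bddAbove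
  refine ⟨R + 1, fun g t hg ht => ?_⟩
  obtain ⟨u, hu, rfl⟩ : ∃ u, FreeGroup.IsReduced u ∧ FreeGroup.mk u = t :=
    ⟨_, FreeGroup.isReduced_toWord, FreeGroup.mk_toWord⟩
  rw [toWord_mk_of_isReduced hu] at ht
  induction u generalizing g with
  | nil => simp [← FreeGroup.one_eq_mk]
  | cons x u ih =>
    have hx : FreeGroup.IsReduced (g.toWord ++ (FreeGroup.mk [x]).toWord) := by
      rw [toWord_mk_singleton]
      exact ht.infix ⟨[], u, by simp⟩
    have h1 : g ∈ X ↔ g * FreeGroup.mk [x] ∈ X := by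
      by_contra hc
      have := hR (Set.mem_image_of_mem _ (Set.mem_iUnion.2 ⟨x, hc⟩))
      omega
    rw [h1, mk_cons x u, ← mul_assoc]
    refine ih _ ?_ (hu.infix ⟨[x], [], by simp⟩) ?_
    · rw [FreeGroup.norm, toWord_mul_of_isReduced hx, List.length_append]
      exact hg.trans (Nat.le_add_right _ _)
    · rw [toWord_mul_of_isReduced hx, toWord_mk_singleton]
      simpa using ht

/-- If the junction `g * u` is far from `1`, then, `u * v` being reduced there, at least one of `v`
and `u⁻¹` leads outward from it, and the corresponding half does not cross. So translates with both
halves crossing have their junction in a fixed ball. -/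
lemma IsAlmostInvariant.exists_ncard_crossing_mul {X : Set (FreeGroup (Fin k))}
    (hX : IsAlmostInvariant X) :
    ∃ B : ℕ, ∀ u v : FreeGroup (Fin k), FreeGroup.IsReduced (u.toWord ++ v.toWord) →
      (crossing X (u * v)).ncard ≤ (crossing X u).ncard + (crossing X v).ncard ∧
      (crossing X u).ncard + (crossing X v).ncard ≤ (crossing X (u * v)).ncard + B := by
  obtain ⟨R, hR⟩ := hX.exists_radius
  refine ⟨2 * {g : FreeGroup (Fin k) | g.norm < R}.ncard, fun u v huv => ?_⟩
  have h1 := ncard_crossing_mul (hX u) (hX v)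
  have h2 : (crossing X u ∩ {g | g * u ∈ crossing X v}).ncard ≤
      {g : FreeGroup (Fin k) | g.norm < R}.ncard := by
    rw [← ncard_preimage_mul_right u {g : FreeGroup (Fin k) | g.norm < R}]
    refine Set.ncard_le_ncard ?_ (finite_preimage_mul_right u (finite_norm_lt R))
    rintro g ⟨hg1, hg2⟩
    by_contra hg
    simp only [Set.mem_ofPred_eq, not_lt] at hg
    by_cases hr : FreeGroup.IsReduced ((g * u).toWord ++ v.toWord)
    · exact hg2 (hR _ _ hg hr)
    · refine hg1 ((hR _ u⁻¹ hg ?_).trans (by simp)).symm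
      rw [isReduced_toWord_append] at huv hr ⊢
      push Not at hr
      obtain ⟨x, hx, y, hy, rfl⟩ := hr
      intro x' hx' y' hy'
      obtain rfl : x = x' := Option.some_injective _ (hx.symm.trans hx')
      rw [head?_toWord_inv, Option.mem_def, Option.map_eq_some_iff] at hy'
      obtain ⟨z, hz, rfl⟩ := hy'
      intro e
      exact huv z hz _ hy (by rw [letterInv_injective e])
  omega

/-- Bounded cancellation for automorphisms of the free group. -/
theorem exists_isQuasiAdditive_norm (φ : MulAut (FreeGroup (Fin k))) :
    ∃ B, IsQuasiAdditive (fun u => ((φ (FreeGroup.mk u)).norm : ℝ)) B := by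
  choose B hB using fun i : Fin k =>
    (isAlmostInvariant_preimage φ (isAlmostInvariant_cone_one (i, true))).exists_ncard_crossing_mul
  refine ⟨((∑ i, B i : ℕ) : ℝ), fun u v h => ?_⟩
  have huv := isReduced_append.1 h
  have h' : FreeGroup.IsReduced ((FreeGroup.mk u).toWord ++ (FreeGroup.mk v).toWord) := by
    rwa [toWord_mk_of_isReduced huv.1, toWord_mk_of_isReduced huv.2.1]
  have h1 : (φ (FreeGroup.mk (u ++ v))).norm ≤
      (φ (FreeGroup.mk u)).norm + (φ (FreeGroup.mk v)).norm := by
    rw [← FreeGroup.mul_mk, map_mul]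
    exact FreeGroup.norm_mul_le _ _
  have h2 : (φ (FreeGroup.mk u)).norm + (φ (FreeGroup.mk v)).norm ≤
      (φ (FreeGroup.mk (u ++ v))).norm + ∑ i, B i := by
    rw [← FreeGroup.mul_mk, norm_apply_eq_sum, norm_apply_eq_sum, norm_apply_eq_sum,
      ← Finset.sum_add_distrib, ← Finset.sum_add_distrib]
    exact Finset.sum_le_sum fun i _ => (hB i _ _ h').2
  have h1' : ((φ (FreeGroup.mk (u ++ v))).norm : ℝ) ≤
      (φ (FreeGroup.mk u)).norm + (φ (FreeGroup.mk v)).norm := by exact_mod_cast h1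
  have h2' : ((φ (FreeGroup.mk u)).norm : ℝ) + (φ (FreeGroup.mk v)).norm ≤
      (φ (FreeGroup.mk (u ++ v))).norm + ((∑ i, B i : ℕ) : ℝ) := by exact_mod_cast h2
  have : (0 : ℝ) ≤ ((∑ i, B i : ℕ) : ℝ) := Nat.cast_nonneg _
  exact abs_le.2 ⟨by linarith, by linarith⟩

end Crossing

/-! ### Structure of almost invariant sets -/

section Cones

variable {k : ℕ}

/-- Up to a finite set, the part of `X` in the direction `x` from `v` is everything if `b` is `true`
and empty if `b` is `false`. -/
def IsEventually (X : Set (FreeGroup (Fin k))) (v : FreeGroup (Fin k)) (x : Letter k) (b : Bool) :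
    Prop :=
  (cone v x ∩ {g | ¬(g ∈ X ↔ b = true)}).Finite

/-- In all directions from `v` but `z` the set `X` is eventually constant, and it is not the same
constant in all these directions. -/
def IsTerminal (X : Set (FreeGroup (Fin k))) (v : FreeGroup (Fin k)) (z : Letter k) : Prop :=
  ∃ b : Letter k → Bool, (∀ y, y ≠ z → IsEventually X v y (b y)) ∧
    ∃ y y', y ≠ z ∧ y' ≠ z ∧ b y ≠ b y'

lemma eq_or_exists_mem_cone (v g : FreeGroup (Fin k)) : g = v ∨ ∃ x, g ∈ cone v x := by
  rcases h : (v⁻¹ * g).toWord with _ | ⟨x, u⟩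
  · left
    rw [FreeGroup.toWord_eq_nil_iff, inv_mul_eq_one] at h
    exact h.symm
  · exact Or.inr ⟨x, by simp [cone, h]⟩

lemma eq_or_exists_mem_cone_mul {v g : FreeGroup (Fin k)} {x : Letter k} (hg : g ∈ cone v x) :
    g = v * FreeGroup.mk [x] ∨
      ∃ y, y ≠ letterInv x ∧ g ∈ cone (v * FreeGroup.mk [x]) y := by
  have hg : (v⁻¹ * g).toWord.head? = some x := hg
  obtain ⟨u, hu⟩ : ∃ u, (v⁻¹ * g).toWord = x :: u := by
    rcases h : (v⁻¹ * g).toWord with _ | ⟨y, u⟩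
    · simp [h] at hg
    · exact ⟨u, by simpa [h] using hg⟩
  have hr : FreeGroup.IsReduced (x :: u) := hu ▸ FreeGroup.isReduced_toWord
  have hr' : FreeGroup.IsReduced u := hr.infix ⟨[x], [], by simp⟩
  have h1 : (v * FreeGroup.mk [x])⁻¹ * g = FreeGroup.mk u := by
    rw [mul_inv_rev, mul_assoc, ← FreeGroup.mk_toWord (x := v⁻¹ * g), hu, mk_cons x u, ← mul_assoc,
      inv_mul_cancel, one_mul]
  rcases u with _ | ⟨y, u⟩
  · left
    rw [← FreeGroup.one_eq_mk, inv_mul_eq_one] at h1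
    exact h1.symm
  · right
    refine ⟨y, (isReduced_cons_cons.1 hr).1, ?_⟩
    show _ = _
    rw [h1, toWord_mk_of_isReduced hr']
    rfl

/-- Removing the edge between `v` and `vx` leaves two half-trees, each being a cone seen from the
end of the edge in the other one. -/
lemma compl_cone (v : FreeGroup (Fin k)) (x : Letter k) :
    (cone v x)ᶜ = cone (v * FreeGroup.mk [x]) (letterInv x) := by
  ext g
  simp only [cone, Set.mem_compl_iff, Set.mem_ofPred_eq, mul_inv_rev, mul_assoc, mk_singleton_inv]
  generalize v⁻¹ * g = s
  obtain ⟨u, hu, rfl⟩ : ∃ u, FreeGroup.IsReduced u ∧ FreeGroup.mk u = s :=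
    ⟨_, FreeGroup.isReduced_toWord, FreeGroup.mk_toWord⟩
  rw [toWord_mk_of_isReduced hu]
  rcases u with _ | ⟨y, u⟩
  · simp [← FreeGroup.one_eq_mk, toWord_mk_singleton, -FreeGroup.toWord_mk]
  · by_cases hy : y = x
    · subst hy
      rw [mk_cons y u, ← mul_assoc, ← mk_singleton_inv, inv_mul_cancel, one_mul,
        toWord_mk_of_isReduced (hu.infix ⟨[y], [], by simp⟩)]
      simp only [List.head?_cons, not_true_eq_false, false_iff]
      rcases u with _ | ⟨z, u⟩
      · simp
      · simpa using (isReduced_cons_cons.1 hu).1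
    · have : FreeGroup.IsReduced (letterInv x :: y :: u) := by
        rw [isReduced_cons_cons, letterInv_letterInv]
        exact ⟨hy, hu⟩
      rw [← mk_cons, toWord_mk_of_isReduced this]
      simpa using hy

lemma isEventually_of_forall_mul {X : Set (FreeGroup (Fin k))} {v : FreeGroup (Fin k)}
    {x : Letter k} {b : Bool}
    (h : ∀ y, y ≠ letterInv x → IsEventually X (v * FreeGroup.mk [x]) y b) :
    IsEventually X v x b := by
  refine Set.Finite.subset (s := {v * FreeGroup.mk [x]} ∪
    ⋃ y : {y : Letter k // y ≠ letterInv x},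
      (cone (v * FreeGroup.mk [x]) y ∩ {g | ¬(g ∈ X ↔ b = true)}))
    ((Set.finite_singleton _).union (Set.finite_iUnion fun y => h y y.2)) ?_
  rintro g ⟨hg, hg'⟩
  rcases eq_or_exists_mem_cone_mul hg with h | ⟨y, hy, h⟩
  · exact Or.inl h
  · exact Or.inr (Set.mem_iUnion.2 ⟨⟨y, hy⟩, h, hg'⟩)

lemma finite_of_forall_isEventually {X : Set (FreeGroup (Fin k))} {v : FreeGroup (Fin k)} {b : Bool}
    (h : ∀ y, IsEventually X v y b) : {g | ¬(g ∈ X ↔ b = true)}.Finite := by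
  refine Set.Finite.subset (s := {v} ∪ ⋃ y : Letter k, (cone v y ∩ {g | ¬(g ∈ X ↔ b = true)}))
    ((Set.finite_singleton _).union (Set.finite_iUnion h)) ?_
  intro g hg
  rcases eq_or_exists_mem_cone v g with h | ⟨y, h⟩
  · exact Or.inl h
  · exact Or.inr (Set.mem_iUnion.2 ⟨y, h, hg⟩)

lemma IsAlmostInvariant.translate {X : Set (FreeGroup (Fin k))} (hX : IsAlmostInvariant X)
    (v : FreeGroup (Fin k)) : IsAlmostInvariant {g | v * g ∈ X} := fun h => by
  have : crossing {g | v * g ∈ X} h = (fun g => v * g) ⁻¹' crossing X h := by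
    ext g
    simp [crossing, mul_assoc]
  rw [this]
  exact (hX h).preimage (mul_right_injective v).injOn

/-- A branch on which `X` is not eventually constant contains a terminal vertex. -/
lemma IsAlmostInvariant.exists_isTerminal {X : Set (FreeGroup (Fin k))} (hX : IsAlmostInvariant X)
    {v : FreeGroup (Fin k)} {x : Letter k} (hx : ∀ b, ¬IsEventually X v x b) :
    ∃ w z, w ∈ cone v x ∧ v ∈ cone w z ∧ IsTerminal X w z := by
  obtain ⟨R, hR⟩ := (hX.translate v).exists_radius
  -- Descent along the branch: `v * s` is the current vertex, `z` the direction back to `v`, and `n`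
  -- bounds the remaining depth before radius `R`. The invariant is that no single constant serves
  -- all directions other than `z`.
  have key : ∀ n (s : FreeGroup (Fin k)) (z : Letter k), R ≤ s.norm + n →
      s.toWord.head? = some x → s⁻¹.toWord.head? = some z →
      (∀ b, ∃ y, y ≠ z ∧ ¬IsEventually X (v * s) y b) →
      ∃ w z, w ∈ cone v x ∧ v ∈ cone w z ∧ IsTerminal X w z := by
    intro n
    induction n with
    | zero =>
      intro s z hs _ hz hne
      exfalso
      classical
      -- Beyond radius `R` the set keeps its value at `v * s` in every outward direction, which
      -- contradicts the invariant for that value.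
      obtain ⟨y, hyz, hy⟩ := hne (decide (v * s ∈ X))
      refine hy (Set.Finite.subset Set.finite_empty ?_)
      rintro g ⟨hg1, hg2⟩
      refine hg2 ?_
      have hred : FreeGroup.IsReduced (s.toWord ++ ((v * s)⁻¹ * g).toWord) := by
        rw [isReduced_toWord_append]
        intro a ha y' hy'
        have hg1 : ((v * s)⁻¹ * g).toWord.head? = some y := hg1
        rw [hg1, Option.mem_some_iff] at hy'
        rw [head?_toWord_inv, ha, Option.map_some, Option.some_inj] at hz
        rw [← hy', hz]
        exact hyz
      have := hR s _ (by simpa using hs) hred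
      simp only [Set.mem_ofPred_eq] at this
      rw [decide_eq_true_iff, this]
      simp [mul_assoc]
    | succ n ih =>
      intro s z hs hsx hz hne
      -- If every outward direction has a constant, the invariant makes two of them differ and the
      -- vertex is terminal. Otherwise the descent continues in a direction without a constant.
      by_cases hall : ∀ y, y ≠ z → ∃ b, IsEventually X (v * s) y b
      · choose! b hb using hall
        refine ⟨v * s, z, by simpa [cone] using hsx, by simpa [cone] using hz, b, hb, ?_⟩
        obtain ⟨y, hy, -⟩ := hne true
        obtain ⟨y', hy', hy'b⟩ := hne (b y)
        exact ⟨y, y', hy, hy', fun e => hy'b (e ▸ hb y' hy')⟩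
      · push Not at hall
        obtain ⟨y, hyz, hy⟩ := hall
        have hred : FreeGroup.IsReduced (s.toWord ++ (FreeGroup.mk [y]).toWord) := by
          rw [isReduced_toWord_append]
          intro a ha y' hy'
          rw [toWord_mk_singleton, List.head?_cons, Option.mem_some_iff] at hy'
          rw [head?_toWord_inv, ha, Option.map_some, Option.some_inj] at hz
          rw [← hy', hz]
          exact hyz
        have hw := toWord_mul_of_isReduced hred
        rw [toWord_mk_singleton] at hw
        refine ih (s * FreeGroup.mk [y]) (letterInv y) ?_ ?_ ?_ ?_
        · rw [FreeGroup.norm, hw, List.length_append, List.length_singleton]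
          rw [FreeGroup.norm] at hs
          omega
        · rw [hw]
          simp [hsx]
        · rw [head?_toWord_inv, hw]
          simp
        · intro b
          by_contra hc
          push Not at hc
          rw [← mul_assoc] at hc
          exact hy b (isEventually_of_forall_mul hc)
  refine key R (FreeGroup.mk [x]) (letterInv x) (by omega) (by rw [toWord_mk_singleton]; rfl)
    (by rw [mk_singleton_inv, toWord_mk_singleton]; rfl) fun b => ?_
  by_contra hc
  push Not at hc
  exact hx b (isEventually_of_forall_mul hc)

/-- An almost invariant set is determined, up to finite sets, by its behaviour in the directions
from one vertex, or there are two terminal vertices facing each other. -/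
lemma IsAlmostInvariant.dichotomy {X : Set (FreeGroup (Fin k))} (hX : IsAlmostInvariant X) :
    (∃ (v : FreeGroup (Fin k)) (b : Letter k → Bool), ∀ y, IsEventually X v y (b y)) ∨
    ∃ v w x z, w ∈ cone v x ∧ v ∈ cone w z ∧ IsTerminal X v x ∧ IsTerminal X w z := by
  by_cases h1 : ∀ y, ∃ b, IsEventually X 1 y b
  · choose b hb using h1
    exact Or.inl ⟨1, b, hb⟩
  · push Not at h1
    obtain ⟨y, hy⟩ := h1
    obtain ⟨v, x, -, -, hv⟩ := hX.exists_isTerminal hy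
    -- The remaining direction `x` at the terminal vertex `v` decides. If it has a constant, `v`
    -- sees constants everywhere. If not, a second search starting from `v` in direction `x` ends at
    -- a terminal vertex facing `v`.
    by_cases h2 : ∃ b, IsEventually X v x b
    · classical
      obtain ⟨c, hc⟩ := h2
      obtain ⟨b, hb, -⟩ := hv
      refine Or.inl ⟨v, Function.update b x c, fun y => ?_⟩
      by_cases hyx : y = x
      · subst hyx
        simpa using hc
      · rw [Function.update_of_ne hyx]
        exact hb y hyx
    · push Not at h2
      obtain ⟨w, z, h3, h4, hw⟩ := hX.exists_isTerminal h2
      exact Or.inr ⟨v, w, x, z, h3, h4, hv, hw⟩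

/-- `X` agrees with a cone up to a finite set. -/
def IsAlmostCone (X : Set (FreeGroup (Fin k))) (v : FreeGroup (Fin k)) (x : Letter k) : Prop :=
  {g | ¬(g ∈ X ↔ g ∈ cone v x)}.Finite

lemma isAlmostCone_of_isEventually {X : Set (FreeGroup (Fin k))} {v : FreeGroup (Fin k)}
    {b : Letter k → Bool} (h : ∀ y, IsEventually X v y (b y)) {x : Letter k} (hx : b x = true)
    (hb : ∀ y, y ≠ x → b y = false) : IsAlmostCone X v x := by
  refine Set.Finite.subset (s := {v} ∪ ⋃ y : Letter k, (cone v y ∩ {g | ¬(g ∈ X ↔ b y = true)}))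
    ((Set.finite_singleton _).union (Set.finite_iUnion h)) ?_
  intro g hg
  rcases eq_or_exists_mem_cone v g with h | ⟨y, h⟩
  · exact Or.inl h
  · refine Or.inr (Set.mem_iUnion.2 ⟨y, h, ?_⟩)
    simp only [Set.mem_ofPred_eq] at hg ⊢
    by_cases hy : y = x
    · subst hy
      simpa [hx, h] using hg
    · have h' : g ∉ cone v x := fun e => hy (Option.some_injective _ (h.symm.trans e))
      simpa [hb y hy, h'] using hg

/-- Passing to the complement reduces to the previous case, because the complement of a cone is the
cone at the other end of its edge. -/
lemma isAlmostCone_of_isEventually' {X : Set (FreeGroup (Fin k))} {v : FreeGroup (Fin k)}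
    {b : Letter k → Bool} (h : ∀ y, IsEventually X v y (b y)) {x : Letter k} (hx : b x = false)
    (hb : ∀ y, y ≠ x → b y = true) :
    IsAlmostCone X (v * FreeGroup.mk [x]) (letterInv x) := by
  have h1 : ∀ y, IsEventually Xᶜ v y (!b y) := fun y => by
    refine (h y).subset ?_
    rintro g ⟨hg, hg'⟩
    refine ⟨hg, ?_⟩
    simp only [Set.mem_ofPred_eq, Set.mem_compl_iff] at hg' ⊢
    cases hb : b y <;> simp_all
  have h2 := isAlmostCone_of_isEventually h1 (x := x) (by simp [hx]) fun y hy => by simp [hb y hy]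
  refine h2.subset fun g hg => ?_
  rw [← compl_cone] at hg
  simp only [Set.mem_ofPred_eq, Set.mem_compl_iff] at hg ⊢
  tauto

/-! ### Lower bounds for crossing numbers -/

/-- The vertex `v` lies on the translate by `g` of the geodesic from `1` to `h`, which leaves `v`
in directions from `Q`. -/
def Traverses (Q : Finset (Letter k)) (v h g : FreeGroup (Fin k)) : Prop :=
  ∃ j, g * FreeGroup.mk (h.toWord.take (j + 1)) = v ∧
    (∃ x ∈ Q, h.toWord[j]? = some (letterInv x)) ∧ ∃ y ∈ Q, h.toWord[j + 1]? = some y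

lemma mem_cone_of_take {v h g : FreeGroup (Fin k)} {j : ℕ} {x y : Letter k}
    (hj : g * FreeGroup.mk (h.toWord.take (j + 1)) = v)
    (hx : h.toWord[j]? = some (letterInv x)) (hy : h.toWord[j + 1]? = some y) :
    g ∈ cone v x ∧ g * h ∈ cone v y := by
  have hr := FreeGroup.isReduced_toWord (x := h)
  have h1 : FreeGroup.IsReduced (h.toWord.take (j + 1)) := hr.infix (List.take_prefix _ _).isInfix
  have h2 : FreeGroup.IsReduced (h.toWord.drop (j + 1)) := hr.infix (List.drop_suffix _ _).isInfix
  have h3 : h = FreeGroup.mk (h.toWord.take (j + 1)) * FreeGroup.mk (h.toWord.drop (j + 1)) := by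
    rw [FreeGroup.mul_mk, List.take_append_drop, FreeGroup.mk_toWord]
  constructor
  · show (v⁻¹ * g).toWord.head? = some x
    rw [← hj, mul_inv_rev, mul_assoc, inv_mul_cancel, mul_one, head?_toWord_inv,
      toWord_mk_of_isReduced h1, List.getLast?_take]
    simp [hx]
  · show (v⁻¹ * (g * h)).toWord.head? = some y
    have : v⁻¹ * (g * h) = FreeGroup.mk (h.toWord.drop (j + 1)) := by
      rw [← hj, ← mul_assoc, mul_inv_rev, inv_mul_cancel_right, inv_mul_eq_iff_eq_mul]
      exact h3
    rw [this, toWord_mk_of_isReduced h2, List.head?_drop, hy]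

lemma mem_cone_of_take_lt {v w h g : FreeGroup (Fin k)} {i j : ℕ} {y : Letter k} (hij : i < j)
    (hi : g * FreeGroup.mk (h.toWord.take (i + 1)) = v)
    (hj : g * FreeGroup.mk (h.toWord.take (j + 1)) = w)
    (hy : h.toWord[i + 1]? = some y) : w ∈ cone v y := by
  have hr := FreeGroup.isReduced_toWord (x := h)
  have h2 : FreeGroup.IsReduced ((h.toWord.take (j + 1)).drop (i + 1)) :=
    (hr.infix (List.take_prefix _ _).isInfix).infix (List.drop_suffix _ _).isInfix
  have h3 : (FreeGroup.mk (h.toWord.take (j + 1)) : FreeGroup (Fin k)) =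
      FreeGroup.mk (h.toWord.take (i + 1)) *
        FreeGroup.mk ((h.toWord.take (j + 1)).drop (i + 1)) := by
    rw [FreeGroup.mul_mk]
    congr 1
    conv_lhs => rw [← List.take_append_drop (i + 1) (h.toWord.take (j + 1))]
    rw [List.take_take, min_eq_left (by omega)]
  show (v⁻¹ * w).toWord.head? = some y
  have : v⁻¹ * w = FreeGroup.mk ((h.toWord.take (j + 1)).drop (i + 1)) := by
    rw [← hi, ← hj, h3]
    group
  rw [this, toWord_mk_of_isReduced h2, List.head?_drop, List.getElem?_take_of_lt (by omega), hy]

/-- A geodesic visiting both vertices leaves whichever comes first in the direction of the other,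
and that direction is excluded. Hence the contributions of two facing terminal vertices are never
counted twice. -/
lemma not_traverses_of_traverses {v w h g : FreeGroup (Fin k)} {x z : Letter k}
    {Q Q' : Finset (Letter k)} (hw : w ∈ cone v x) (hv : v ∈ cone w z) (hx : x ∉ Q) (hz : z ∉ Q')
    (h1 : Traverses Q v h g) : ¬Traverses Q' w h g := by
  rintro ⟨j, hj, -, y, hyQ, hy⟩
  obtain ⟨i, hi, -, y', hyQ', hy'⟩ := h1
  rcases lt_trichotomy i j with hij | rfl | hij
  · have := mem_cone_of_take_lt hij hi hj hy'
    obtain rfl : y' = x := Option.some_injective _ (this.symm.trans hw)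
    exact hx hyQ'
  · rw [hi] at hj
    subst hj
    simp [cone] at hw
  · have := mem_cone_of_take_lt hij hj hi hy
    obtain rfl : y = z := Option.some_injective _ (this.symm.trans hv)
    exact hz hyQ

/-- If `X` is eventually constant in the directions `Q` from `v`, then the passages through `v`
between directions with different constants contribute to the crossing number. -/
lemma exists_traverses {X : Set (FreeGroup (Fin k))} {v : FreeGroup (Fin k)}
    {Q : Finset (Letter k)} {b : Letter k → Bool} (hQ : ∀ y ∈ Q, IsEventually X v y (b y)) :
    ∃ C : ℕ, ∀ h : FreeGroup (Fin k), ∃ S : Finset (FreeGroup (Fin k)),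
      (∀ g ∈ S, Traverses Q v h g) ∧
      ((S : Set (FreeGroup (Fin k))) \ crossing X h).ncard ≤ C ∧
      ∑ p ∈ (Q ×ˢ Q).filter (fun p => b p.1 ≠ b p.2), pairCount (letterInv p.1) p.2 h.toWord ≤
        S.card := by
  classical
  -- The finite set of points where `X` deviates from its constants. A traversing translate between
  -- different constants fails to cross only if one of its two ends lies in `E`, whence the constant
  -- `2|E|`.
  set E : Set (FreeGroup (Fin k)) := ⋃ y : Q, (cone v y ∩ {g | ¬(g ∈ X ↔ b y = true)}) with hE
  have hEfin : E.Finite := Set.finite_iUnion fun y => hQ y y.2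
  refine ⟨E.ncard + E.ncard, fun h => ?_⟩
  set P := (Q ×ˢ Q).filter (fun p => b p.1 ≠ b p.2) with hP
  set T : Finset (ℕ × Letter k × Letter k) := (Finset.range h.toWord.length ×ˢ P).filter
    (fun q => h.toWord[q.1]? = some (letterInv q.2.1) ∧ h.toWord[q.1 + 1]? = some q.2.2) with hT
  have hTmem : ∀ q ∈ T, (q.2.1 ∈ Q ∧ q.2.2 ∈ Q) ∧ b q.2.1 ≠ b q.2.2 ∧
      h.toWord[q.1]? = some (letterInv q.2.1) ∧ h.toWord[q.1 + 1]? = some q.2.2 := by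
    intro q hq
    rw [hT, Finset.mem_filter, Finset.mem_product, hP, Finset.mem_filter, Finset.mem_product] at hq
    exact ⟨hq.1.2.1, hq.1.2.2, hq.2⟩
  -- The translate that places at `v` the vertex of the geodesic between the two letters of the
  -- occurrence.
  let f : ℕ × Letter k × Letter k → FreeGroup (Fin k) := fun q =>
    v * (FreeGroup.mk (h.toWord.take (q.1 + 1)))⁻¹
  have hf : ∀ q, f q * FreeGroup.mk (h.toWord.take (q.1 + 1)) = v := fun q => by
    simp only [f]
    rw [inv_mul_cancel_right]
  refine ⟨T.image f, ?_, ?_, ?_⟩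
  · intro g hg
    obtain ⟨q, hq, rfl⟩ := Finset.mem_image.1 hg
    obtain ⟨h1, -, h2, h3⟩ := hTmem q hq
    exact ⟨q.1, hf q, ⟨_, h1.1, h2⟩, _, h1.2, h3⟩
  · refine (Set.ncard_le_ncard (t := E ∪ {g | g * h ∈ E}) ?_
      (hEfin.union (finite_preimage_mul_right h hEfin))).trans
      ((Set.ncard_union_le _ _).trans (by rw [ncard_preimage_mul_right]))
    rintro g ⟨hg, hgX⟩
    obtain ⟨q, hq, rfl⟩ := Finset.mem_image.1 hg
    obtain ⟨h1, h4, h2, h3⟩ := hTmem q hq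
    obtain ⟨h5, h6⟩ := mem_cone_of_take (hf q) h2 h3
    by_contra hc
    simp only [Set.mem_union, not_or] at hc
    have h7 : f q ∈ X ↔ b q.2.1 = true := by
      by_contra h8
      exact hc.1 (Set.mem_iUnion.2 ⟨⟨_, h1.1⟩, h5, h8⟩)
    have h9 : f q * h ∈ X ↔ b q.2.2 = true := by
      by_contra h8
      exact hc.2 (Set.mem_iUnion.2 ⟨⟨_, h1.2⟩, h6, h8⟩)
    refine hgX fun h10 => h4 ?_
    rw [h7, h9] at h10
    exact Bool.eq_iff_iff.2 h10
  · rw [Finset.card_image_of_injOn]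
    · rw [hT, Finset.card_filter, Finset.sum_product, Finset.sum_comm]
      rfl
    · intro q hq q' hq' e
      obtain ⟨-, -, h2, h3⟩ := hTmem q hq
      obtain ⟨-, -, h2', h3'⟩ := hTmem q' hq'
      have hr := FreeGroup.isReduced_toWord (x := h)
      have e1 : FreeGroup.mk (h.toWord.take (q.1 + 1)) = FreeGroup.mk (h.toWord.take (q'.1 + 1)) :=
        inv_injective (mul_left_cancel e)
      have e2 := congrArg FreeGroup.norm e1
      rw [norm_mk_of_isReduced (hr.infix (List.take_prefix _ _).isInfix),
        norm_mk_of_isReduced (hr.infix (List.take_prefix _ _).isInfix), List.length_take,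
        List.length_take] at e2
      -- A letter follows each of the two vertices, so neither prefix is truncated and equal prefix
      -- lengths force equal positions.
      have l1 := (List.getElem?_eq_some_iff.1 h3).1
      have l2 := (List.getElem?_eq_some_iff.1 h3').1
      have e3 : q.1 = q'.1 := by omega
      rw [e3, h2', Option.some_inj] at h2
      rw [e3, h3', Option.some_inj] at h3
      exact Prod.ext e3 (Prod.ext (letterInv_injective h2.symm) h3.symm)

lemma card_separated (Q : Finset (Letter k)) (b : Letter k → Bool) :
    ((Q ×ˢ Q).filter (fun p => b p.1 ≠ b p.2)).card =
      2 * ((Q.filter fun x => b x = true).card * (Q.filter fun x => b x = false).card) := by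
  classical
  have : (Q ×ˢ Q).filter (fun p => b p.1 ≠ b p.2) =
      ((Q.filter fun x => b x = true) ×ˢ (Q.filter fun x => b x = false)) ∪
      ((Q.filter fun x => b x = false) ×ˢ (Q.filter fun x => b x = true)) := by
    ext ⟨x, y⟩
    simp only [Finset.mem_filter, Finset.mem_product, Finset.mem_union]
    cases b x <;> cases b y <;> simp
  rw [this, Finset.card_union_of_disjoint, Finset.card_product, Finset.card_product]
  · ring
  · rw [Finset.disjoint_left]
    rintro ⟨x, y⟩ h1 h2
    simp only [Finset.mem_filter, Finset.mem_product] at h1 h2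
    simp [h1.1.2] at h2

lemma card_filter_add (Q : Finset (Letter k)) (b : Letter k → Bool) :
    (Q.filter fun x => b x = true).card + (Q.filter fun x => b x = false).card = Q.card := by
  rw [← Finset.card_filter_add_card_filter_not (s := Q) (fun x => b x = true)]
  simp

lemma mul_le_sum_pairCount {Q : Finset (Letter k)} {b : Letter k → Bool}
    {u : List (Letter k)} {t : ℝ} {N : ℕ} (ht : 0 ≤ t)
    (htu : ∀ p q : Letter k, q ≠ letterInv p → t ≤ pairCount p q u)
    (hN : N ≤ 2 * ((Q.filter fun x => b x = true).card * (Q.filter fun x => b x = false).card)) :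
    N * t ≤ ((∑ p ∈ (Q ×ˢ Q).filter (fun p => b p.1 ≠ b p.2),
      pairCount (letterInv p.1) p.2 u : ℕ) : ℝ) := by
  rw [← card_separated] at hN
  push_cast
  refine (mul_le_mul_of_nonneg_right (Nat.cast_le.2 hN) ht).trans ?_
  rw [← nsmul_eq_mul]
  refine Finset.card_nsmul_le_sum _ _ _ fun p hp => htu _ _ ?_
  rw [letterInv_letterInv]
  rintro e
  exact (Finset.mem_filter.1 hp).2 (by rw [e])

/-- A product with fixed sum is smallest at the most unequal admissible split. It is used with `c =
1` and `c = 2`, according to whether a single direction may be in the minority. -/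
lemma two_mul_sub_le_mul {a b n c : ℕ} (ha : c ≤ a) (hb : c ≤ b) (h : a + b = n) :
    c * (n - c) ≤ a * b := by
  obtain ⟨a, rfl⟩ := Nat.exists_eq_add_of_le ha
  obtain ⟨b, rfl⟩ := Nat.exists_eq_add_of_le hb
  subst h
  rw [show c + a + (c + b) - c = a + c + b by omega]
  nlinarith [Nat.zero_le (a * b)]

lemma one_le_card_filter {Q : Finset (Letter k)} {b : Letter k → Bool} {y y' : Letter k}
    (hy : y ∈ Q) (hy' : y' ∈ Q) (h : b y ≠ b y') (c : Bool) :
    1 ≤ (Q.filter fun x => b x = c).card := by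
  rw [Nat.one_le_iff_ne_zero, Finset.card_ne_zero]
  rcases eq_or_ne (b y) c with h1 | h1
  · exact ⟨y, Finset.mem_filter.2 ⟨hy, h1⟩⟩
  · refine ⟨y', Finset.mem_filter.2 ⟨hy', ?_⟩⟩
    revert h h1
    cases b y <;> cases b y' <;> cases c <;> simp

/-- Crossing numbers of a nontrivial almost invariant set are bounded below in terms of the numbers
of occurrences of two-letter subwords, and the bound improves if the set is not a cone. -/
theorem IsAlmostInvariant.exists_le_ncard_crossing (hk : 2 ≤ k) {X : Set (FreeGroup (Fin k))}
    (hX : IsAlmostInvariant X) (h1 : X.Infinite) (h2 : Xᶜ.Infinite) :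
    ∃ C : ℝ, ∀ (h : FreeGroup (Fin k)) (t : ℝ), 0 ≤ t →
      (∀ p q : Letter k, q ≠ letterInv p → t ≤ pairCount p q h.toWord) →
      2 * (2 * k - 1) * t ≤ (crossing X h).ncard + C ∧
      ((¬∃ v x, IsAlmostCone X v x) → 4 * (2 * k - 2) * t ≤ (crossing X h).ncard + C) := by
  classical
  have hcard : (Finset.univ : Finset (Letter k)).card = 2 * k := by simp [mul_comm]
  have hk' : (2 : ℝ) ≤ k := by exact_mod_cast hk
  rcases hX.dichotomy with ⟨v, b, hb⟩ | ⟨v, w, x, z, hw, hv, hvT, hwT⟩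
  · obtain ⟨C, hC⟩ := exists_traverses (Q := Finset.univ) (b := b) fun y _ => hb y
    refine ⟨C, fun h t ht htu => ?_⟩
    obtain ⟨S, -, hS1, hS2⟩ := hC h
    have hS3 : S.card ≤ (crossing X h).ncard + C := by
      rw [← Set.ncard_coe_finset,
        ← Set.ncard_inter_add_ncard_sdiff_eq_ncard (S : Set (FreeGroup (Fin k))) (crossing X h)
          S.finite_toSet]
      exact add_le_add (Set.ncard_le_ncard Set.inter_subset_right (hX h)) hS1
    have hS4 : ((∑ p ∈ (Finset.univ ×ˢ Finset.univ).filter (fun p => b p.1 ≠ b p.2),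
        pairCount (letterInv p.1) p.2 h.toWord : ℕ) : ℝ) ≤ (crossing X h).ncard + C := by
      exact_mod_cast hS2.trans hS3
    -- A single constant in all directions would make `X` or its complement finite.
    have hne : ∀ c, ∃ y, b y ≠ c := by
      intro c
      by_contra hc
      push Not at hc
      have := finite_of_forall_isEventually (X := X) (v := v) (b := c) fun y => hc y ▸ hb y
      cases c
      · exact h1 (this.subset fun g hg => by simpa using hg)
      · exact h2 (this.subset fun g hg => by simpa using hg)
    obtain ⟨y, hy⟩ := hne true
    obtain ⟨y', hy'⟩ := hne (b y)
    have hone := fun c => one_le_card_filter (b := b) (Finset.mem_univ y) (Finset.mem_univ y')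
      hy'.symm c
    have hadd := card_filter_add Finset.univ b
    constructor
    · have h3 := two_mul_sub_le_mul (hone true) (hone false) hadd
      rw [hcard] at h3
      have h4 := mul_le_sum_pairCount (N := 2 * (2 * k - 1)) ht htu (Q := Finset.univ) (b := b)
        (by omega)
      push_cast [Nat.cast_sub (by omega : 1 ≤ 2 * k)] at h4
      push_cast at hS4
      linarith
    · intro hcone
      -- A value taken in just one direction would make `X` an almost cone.
      have htwo : ∀ c, 2 ≤ ((Finset.univ : Finset (Letter k)).filter fun x => b x = c).card := by
        intro c
        by_contra hc
        have h3 : (Finset.univ.filter fun x => b x = c).card = 1 := by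
          have := hone c
          omega
        obtain ⟨x, hx⟩ := Finset.card_eq_one.1 h3
        have hx1 : b x = c := by
          have : x ∈ Finset.univ.filter fun x => b x = c := by
            rw [hx]
            exact Finset.mem_singleton_self x
          simpa using this
        have hx2 : ∀ y, y ≠ x → b y = !c := by
          intro y hy
          have : y ∉ Finset.univ.filter fun x => b x = c := by
            rw [hx]
            simpa using hy
          exact Bool.eq_not_of_ne (by simpa using this)
        cases c
        · exact hcone ⟨_, _, isAlmostCone_of_isEventually' hb hx1 hx2⟩
        · exact hcone ⟨_, _, isAlmostCone_of_isEventually hb hx1 hx2⟩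
      have h3 := two_mul_sub_le_mul (htwo true) (htwo false) hadd
      rw [hcard] at h3
      have h4 := mul_le_sum_pairCount (N := 4 * (2 * k - 2)) ht htu (Q := Finset.univ) (b := b)
        (by omega)
      push_cast [Nat.cast_sub (by omega : 2 ≤ 2 * k)] at h4
      push_cast at hS4
      linarith
  · obtain ⟨b, hb, y, y', hy, hy', hyb⟩ := hvT
    obtain ⟨b', hb', a, a', ha, ha', hab⟩ := hwT
    obtain ⟨C, hC⟩ := exists_traverses (Q := Finset.univ.erase x) (b := b)
      fun y hy => hb y (Finset.ne_of_mem_erase hy)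
    obtain ⟨C', hC'⟩ := exists_traverses (Q := Finset.univ.erase z) (b := b')
      fun y hy => hb' y (Finset.ne_of_mem_erase hy)
    -- Each terminal vertex has `2k - 1` directions with constants, not all equal, hence at least
    -- `2(2k - 2)` separated ordered pairs. The passages through the two vertices are disjoint, so
    -- these numbers add up.
    have main : ∀ (h : FreeGroup (Fin k)) (t : ℝ), 0 ≤ t →
        (∀ p q : Letter k, q ≠ letterInv p → t ≤ pairCount p q h.toWord) →
        4 * (2 * k - 2) * t ≤ (crossing X h).ncard + (C + C') := by
      intro h t ht htu
      obtain ⟨S, hS0, hS1, hS2⟩ := hC h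
      obtain ⟨S', hS0', hS1', hS2'⟩ := hC' h
      have hdisj : Disjoint S S' := Finset.disjoint_left.2 fun g hg hg' =>
        not_traverses_of_traverses hw hv (Finset.notMem_erase x _) (Finset.notMem_erase z _)
          (hS0 g hg) (hS0' g hg')
      have hS3 : S.card + S'.card ≤ (crossing X h).ncard + (C + C') := by
        rw [← Finset.card_union_of_disjoint hdisj, ← Set.ncard_coe_finset,
          ← Set.ncard_inter_add_ncard_sdiff_eq_ncard
            ((S ∪ S' : Finset (FreeGroup (Fin k))) : Set (FreeGroup (Fin k))) (crossing X h)
            (S ∪ S').finite_toSet]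
        refine add_le_add (Set.ncard_le_ncard Set.inter_subset_right (hX h)) ?_
        rw [Finset.coe_union, Set.union_sdiff_distrib]
        exact (Set.ncard_union_le _ _).trans (add_le_add hS1 hS1')
      have hS4 : (S.card : ℝ) + S'.card ≤ (crossing X h).ncard + (C + C') := by
        exact_mod_cast hS3
      have bound : ∀ (Q : Finset (Letter k)) (b : Letter k → Bool) (y y' : Letter k),
          Q.card = 2 * k - 1 → y ∈ Q → y' ∈ Q → b y ≠ b y' → 2 * (2 * k - 2) * t ≤
          ((∑ p ∈ (Q ×ˢ Q).filter (fun p => b p.1 ≠ b p.2),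
            pairCount (letterInv p.1) p.2 h.toWord : ℕ) : ℝ) := by
        intro Q b y y' hQ hy hy' hne
        have h3 := two_mul_sub_le_mul (one_le_card_filter hy hy' hne true)
          (one_le_card_filter hy hy' hne false) (card_filter_add Q b)
        rw [hQ] at h3
        have h4 := mul_le_sum_pairCount (N := 2 * (2 * k - 2)) ht htu (Q := Q) (b := b)
          (by omega)
        rw [Nat.cast_mul, Nat.cast_sub (by omega : 2 ≤ 2 * k)] at h4
        push_cast at h4 ⊢
        linarith
      have hcard' : ∀ z : Letter k, (Finset.univ.erase z).card = 2 * k - 1 := fun z => by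
        rw [Finset.card_erase_of_mem (Finset.mem_univ _), hcard]
      have b1 := bound (Finset.univ.erase x) b y y' (hcard' x)
        (Finset.mem_erase.2 ⟨hy, Finset.mem_univ _⟩) (Finset.mem_erase.2 ⟨hy', Finset.mem_univ _⟩)
        hyb
      have b2 := bound (Finset.univ.erase z) b' a a' (hcard' z)
        (Finset.mem_erase.2 ⟨ha, Finset.mem_univ _⟩) (Finset.mem_erase.2 ⟨ha', Finset.mem_univ _⟩)
        hab
      have c1 := b1.trans (Nat.cast_le.2 hS2)
      have c2 := b2.trans (Nat.cast_le.2 hS2')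
      linarith
    refine ⟨C + C', fun h t ht htu => ⟨?_, fun _ => main h t ht htu⟩⟩
    refine le_trans ?_ (main h t ht htu)
    exact mul_le_mul_of_nonneg_right (by linarith) ht

end Cones

/-! ### Cyclic length -/

section CyclicLength

variable {k : ℕ}

lemma length_flatten_replicate (N : ℕ) (u : List (Letter k)) :
    (List.replicate N u).flatten.length = N * u.length := by
  simp [List.length_flatten]

/-- A nontrivial power is, without cancellation, a conjugate of the power of the cyclically reduced
core. With `norm_pow_le` this makes cyclic length the growth rate of the powers, the form in which
it is used below. -/
lemma mul_cyclicLength_le_norm_pow (w : FreeGroup (Fin k)) (N : ℕ) :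
    N * cyclicLength w ≤ (w ^ N).norm := by
  rw [FreeGroup.norm, FreeGroup.toWord_pow,
    FreeGroup.reduceCyclically.reduce_flatten_replicate FreeGroup.isReduced_toWord]
  split_ifs with h
  · simp [h]
  · simp [cyclicLength]
    omega

lemma norm_pow_le (w : FreeGroup (Fin k)) (N : ℕ) :
    (w ^ N).norm ≤ N * cyclicLength w + 2 * w.norm := by
  have h1 := congrArg List.length
    (FreeGroup.reduceCyclically.conj_conjugator_reduceCyclically w.toWord)
  simp only [List.length_append, FreeGroup.invRev_length] at h1
  rw [FreeGroup.norm, FreeGroup.toWord_pow,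
    FreeGroup.reduceCyclically.reduce_flatten_replicate FreeGroup.isReduced_toWord]
  split_ifs with h
  · simp
  · simp only [List.length_append, length_flatten_replicate, FreeGroup.invRev_length,
      cyclicLength, FreeGroup.norm]
    omega

lemma cyclicLength_le_norm (w : FreeGroup (Fin k)) : cyclicLength w ≤ w.norm := by
  simpa using mul_cyclicLength_le_norm_pow w 1

lemma le_of_forall_mul_le_mul_add {a b C : ℝ} (h : ∀ N : ℕ, N * a ≤ N * b + C) : a ≤ b := by
  by_contra hab
  push Not at hab
  obtain ⟨N, hN⟩ := exists_nat_gt (C / (a - b))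
  rw [div_lt_iff₀ (by linarith)] at hN
  have := h N
  linarith

/-- An additive error that is uniform over all powers disappears after division by the exponent. -/
lemma cyclicLength_le_of_forall_norm_pow_le {u v : FreeGroup (Fin k)} {C : ℕ}
    (h : ∀ N : ℕ, (u ^ N).norm ≤ (v ^ N).norm + C) : cyclicLength u ≤ cyclicLength v := by
  have : (cyclicLength u : ℝ) ≤ cyclicLength v := by
    refine le_of_forall_mul_le_mul_add (C := ((2 * v.norm + C : ℕ) : ℝ)) fun N => ?_
    have h1 := mul_cyclicLength_le_norm_pow u N
    have h2 := norm_pow_le v N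
    have h3 := h N
    exact_mod_cast (by omega : N * cyclicLength u ≤ N * cyclicLength v + (2 * v.norm + C))
  exact_mod_cast this

lemma norm_conj_le (g u : FreeGroup (Fin k)) : (g * u * g⁻¹).norm ≤ u.norm + 2 * g.norm := by
  have h1 := FreeGroup.norm_mul_le (g * u) g⁻¹
  have h2 := FreeGroup.norm_mul_le g u
  rw [FreeGroup.norm_inv_eq] at h1
  omega

lemma norm_le_norm_conj (g u : FreeGroup (Fin k)) : u.norm ≤ (g * u * g⁻¹).norm + 2 * g.norm := by
  have h := norm_conj_le g⁻¹ (g * u * g⁻¹)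
  rw [FreeGroup.norm_inv_eq] at h
  convert h using 3
  group

lemma cyclicLength_conj (g u : FreeGroup (Fin k)) :
    cyclicLength (g * u * g⁻¹) = cyclicLength u := by
  refine le_antisymm (cyclicLength_le_of_forall_norm_pow_le (C := 2 * g.norm) fun N => ?_)
    (cyclicLength_le_of_forall_norm_pow_le (C := 2 * g.norm) fun N => ?_)
  · rw [conj_pow]
    exact norm_conj_le _ _
  · rw [conj_pow]
    exact norm_le_norm_conj _ _

lemma exists_norm_conj_eq (u : FreeGroup (Fin k)) :
    ∃ g, (g⁻¹ * u * g).norm = cyclicLength u := by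
  refine ⟨FreeGroup.mk (FreeGroup.reduceCyclically.conjugator u.toWord), ?_⟩
  have h := FreeGroup.reduceCyclically.conj_conjugator_reduceCyclically u.toWord
  have h1 : u = FreeGroup.mk (FreeGroup.reduceCyclically.conjugator u.toWord) *
      FreeGroup.mk (FreeGroup.reduceCyclically u.toWord) *
      (FreeGroup.mk (FreeGroup.reduceCyclically.conjugator u.toWord))⁻¹ := by
    rw [FreeGroup.inv_mk, FreeGroup.mul_mk, FreeGroup.mul_mk, h, FreeGroup.mk_toWord]
  have h2 : (FreeGroup.mk (FreeGroup.reduceCyclically.conjugator u.toWord))⁻¹ * u *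
      FreeGroup.mk (FreeGroup.reduceCyclically.conjugator u.toWord) =
      FreeGroup.mk (FreeGroup.reduceCyclically u.toWord) := by
    nth_rw 2 [h1]
    group
  rw [h2]
  exact norm_mk_of_isReduced
    (FreeGroup.reduceCyclically.isCyclicallyReduced FreeGroup.isReduced_toWord).isReduced

lemma eq_one_of_cyclicLength_eq_zero {u : FreeGroup (Fin k)} (h : cyclicLength u = 0) : u = 1 := by
  obtain ⟨g, hg⟩ := exists_norm_conj_eq u
  rw [h, FreeGroup.norm_eq_zero] at hg
  have : u = g * (g⁻¹ * u * g) * g⁻¹ := by group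
  rw [this, hg]
  group

lemma cyclicLength_of_isCyclicallyReduced {w : FreeGroup (Fin k)}
    (h : FreeGroup.IsCyclicallyReduced w.toWord) : cyclicLength w = w.norm := by
  refine le_antisymm (cyclicLength_le_norm w) ?_
  have : (w.norm : ℝ) ≤ cyclicLength w := by
    refine le_of_forall_mul_le_mul_add (C := ((2 * w.norm : ℕ) : ℝ)) fun N => ?_
    have h1 : (w ^ N).norm = N * w.norm := by
      rw [FreeGroup.norm, FreeGroup.toWord_pow, (h.flatten_replicate N).isReduced.reduce_eq,
        length_flatten_replicate, FreeGroup.norm]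
    exact_mod_cast h1 ▸ norm_pow_le w N
  exact_mod_cast this

lemma toWord_pow_of_isCyclicallyReduced {w : FreeGroup (Fin k)}
    (h : FreeGroup.IsCyclicallyReduced w.toWord) (N : ℕ) :
    (w ^ N).toWord = (List.replicate N w.toWord).flatten := by
  rw [FreeGroup.toWord_pow, (h.flatten_replicate N).isReduced.reduce_eq]

end CyclicLength

/-! ### Simple automorphisms -/

section Simple

variable {k : ℕ}

lemma mk_singleton_injective :
    Function.Injective fun x : Letter k => (FreeGroup.mk [x] : FreeGroup (Fin k)) := fun x y h => by
  have := congrArg FreeGroup.toWord h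
  simpa only [toWord_mk_singleton, List.cons.injEq, and_true] using this

lemma IsRelabeling.inv {τ : MulAut (FreeGroup (Fin k))} (h : IsRelabeling τ) :
    IsRelabeling τ⁻¹ := by
  obtain ⟨t, ht⟩ := h
  refine ⟨t⁻¹, fun x => ?_⟩
  rw [MulAut.inv_apply, MulEquiv.symm_apply_eq, ht]
  simp

lemma IsRelabeling.norm_apply_le {τ : MulAut (FreeGroup (Fin k))} (h : IsRelabeling τ)
    (g : FreeGroup (Fin k)) : (τ g).norm ≤ g.norm := by
  obtain ⟨t, ht⟩ := h
  have : τ g = FreeGroup.mk (g.toWord.map t) := by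
    conv_lhs => rw [← FreeGroup.mk_toWord (x := g)]
    induction g.toWord with
    | nil => simp [← FreeGroup.one_eq_mk]
    | cons x u ih => rw [mk_cons, map_mul, ih, ht, ← mk_cons, List.map_cons]
  rw [this]
  exact FreeGroup.norm_mk_le.trans (by rw [List.length_map, FreeGroup.norm])

lemma IsRelabeling.norm_apply {τ : MulAut (FreeGroup (Fin k))} (h : IsRelabeling τ)
    (g : FreeGroup (Fin k)) : (τ g).norm = g.norm := by
  refine le_antisymm (h.norm_apply_le g) ?_
  simpa using h.inv.norm_apply_le (τ g)

lemma IsSimple.exists_abs_norm_sub_le {φ : MulAut (FreeGroup (Fin k))} (h : IsSimple φ) :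
    ∃ D : ℝ, 0 < D ∧ ∀ g, |((φ g).norm : ℝ) - g.norm| ≤ D := by
  obtain ⟨c, τ, hτ, rfl⟩ := h
  refine ⟨2 * c.norm + 1, by positivity, fun g => ?_⟩
  rw [MulAut.mul_apply, MulAut.conj_apply]
  have h1 := norm_conj_le c (τ g)
  have h2 := norm_le_norm_conj c (τ g)
  rw [hτ.norm_apply] at h1 h2
  have h1' : ((c * τ g * c⁻¹).norm : ℝ) ≤ g.norm + 2 * c.norm := by exact_mod_cast h1
  have h2' : (g.norm : ℝ) ≤ (c * τ g * c⁻¹).norm + 2 * c.norm := by exact_mod_cast h2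
  exact abs_le.2 ⟨by linarith, by linarith⟩

lemma IsSimple.cyclicLength_apply {φ : MulAut (FreeGroup (Fin k))} (h : IsSimple φ)
    (g : FreeGroup (Fin k)) : cyclicLength (φ g) = cyclicLength g := by
  obtain ⟨c, τ, hτ, rfl⟩ := h
  rw [MulAut.mul_apply, MulAut.conj_apply, cyclicLength_conj]
  refine le_antisymm (cyclicLength_le_of_forall_norm_pow_le (C := 0) fun N => ?_)
    (cyclicLength_le_of_forall_norm_pow_le (C := 0) fun N => ?_)
  · rw [← map_pow, hτ.norm_apply, add_zero]
  · rw [← map_pow, hτ.norm_apply, add_zero]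

lemma IsSimple.of_conj_mul {φ : MulAut (FreeGroup (Fin k))} {c : FreeGroup (Fin k)}
    (h : IsSimple (MulAut.conj c * φ)) : IsSimple φ := by
  obtain ⟨g, τ, hτ, e⟩ := h
  refine ⟨c⁻¹ * g, τ, hτ, ?_⟩
  rw [map_mul, mul_assoc, ← e, map_inv, inv_mul_cancel_left]

/-! ### Automorphisms that do not increase cyclic lengths. -/

lemma exists_eq_mk_singleton {g : FreeGroup (Fin k)} (h1 : g ≠ 1) (h2 : g.norm ≤ 1) :
    ∃ y, g = FreeGroup.mk [y] := by
  have h3 : g.norm ≠ 0 := by simpa using h1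
  have h4 : g.toWord.length = 1 := by
    rw [FreeGroup.norm] at h2 h3
    omega
  obtain ⟨y, hy⟩ := List.length_eq_one_iff.1 h4
  exact ⟨y, by rw [← hy, FreeGroup.mk_toWord]⟩

lemma mk_singleton_ne_one (x : Letter k) : (FreeGroup.mk [x] : FreeGroup (Fin k)) ≠ 1 := fun h => by
  have := congrArg FreeGroup.toWord h
  rw [toWord_mk_singleton] at this
  simp at this

lemma isRelabeling_of_norm_le {φ : MulAut (FreeGroup (Fin k))}
    (h : ∀ x, (φ (FreeGroup.mk [x])).norm ≤ 1) : IsRelabeling φ := by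
  choose t ht using fun x : Letter k => exists_eq_mk_singleton
    (fun e => mk_singleton_ne_one x (φ.injective (e.trans (map_one φ).symm))) (h x)
  have hinj : Function.Injective t := fun x y e => by
    refine mk_singleton_injective (φ.injective ?_)
    show φ (FreeGroup.mk [x]) = φ (FreeGroup.mk [y])
    rw [ht, ht, e]
  exact ⟨Equiv.ofBijective t (Finite.injective_iff_bijective.1 hinj), ht⟩

/-- A word of length at least `2` and cyclic length at most `1` is not cyclically reduced, so its
end letters are inverse to each other. Were the first letter neither `y` nor its inverse, `y * β`
would be cyclically reduced of length at least `3`. -/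
lemma exists_toWord_eq_of_cyclicLength_le {y : Letter k} {β : FreeGroup (Fin k)}
    (h1 : 2 ≤ β.norm) (h2 : cyclicLength β ≤ 1) (h3 : cyclicLength (FreeGroup.mk [y] * β) ≤ 2) :
    ∃ s M, β.toWord = s :: (M ++ [letterInv s]) ∧ (s = y ∨ s = letterInv y) := by
  have hr := FreeGroup.isReduced_toWord (x := β)
  obtain ⟨s, M, s', hM⟩ : ∃ s M s', β.toWord = s :: (M ++ [s']) := by
    rw [FreeGroup.norm] at h1
    rcases h : β.toWord with _ | ⟨s, L⟩
    · simp [h] at h1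
    · rcases List.eq_nil_or_concat L with rfl | ⟨M, s', rfl⟩
      · simp [h] at h1
      · exact ⟨s, M, s', by simp⟩
  have hs : s' = letterInv s := by
    by_contra hne
    have : FreeGroup.IsCyclicallyReduced β.toWord := by
      refine ⟨hr, ?_⟩
      rw [hM]
      intro a ha b hb
      rw [← List.cons_append, List.getLast?_concat, Option.mem_some_iff] at ha
      rw [List.head?_cons, Option.mem_some_iff] at hb
      subst ha hb
      rw [← ne_letterInv_iff]
      exact fun e => hne (by rw [e, letterInv_letterInv])
    rw [cyclicLength_of_isCyclicallyReduced this] at h2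
    omega
  subst hs
  refine ⟨s, M, hM, ?_⟩
  by_contra hne
  push Not at hne
  have hred : FreeGroup.IsReduced (y :: s :: (M ++ [letterInv s])) := by
    rw [isReduced_cons_cons, ← hM]
    exact ⟨hne.2, hr⟩
  have hw : (FreeGroup.mk [y] * β).toWord = y :: s :: (M ++ [letterInv s]) := by
    conv_lhs => rw [← FreeGroup.mk_toWord (x := β)]
    rw [← mk_cons, hM, toWord_mk_of_isReduced hred]
  have hc : FreeGroup.IsCyclicallyReduced (FreeGroup.mk [y] * β).toWord := by
    rw [hw]
    refine ⟨hred, ?_⟩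
    intro a ha b hb
    rw [← List.cons_append, ← List.cons_append, List.getLast?_concat, Option.mem_some_iff] at ha
    rw [List.head?_cons, Option.mem_some_iff] at hb
    subst ha hb
    rw [← ne_letterInv_iff, letterInv_letterInv]
    exact hne.1.symm
  rw [cyclicLength_of_isCyclicallyReduced hc, FreeGroup.norm, hw] at h3
  simp at h3

/-- As long as `β` is long, its outer letters are `y^{±1}` and its inverse. Conjugating them away
shortens `β`, fixes `y` and preserves both cyclic lengths, so induction applies. -/
lemma exists_commute_norm_conj_le {y : Letter k} {β : FreeGroup (Fin k)}
    (h2 : cyclicLength β ≤ 1) (h3 : cyclicLength (FreeGroup.mk [y] * β) ≤ 2) :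
    ∃ c, Commute c (FreeGroup.mk [y]) ∧ (c * β * c⁻¹).norm ≤ 1 := by
  induction h : β.norm using Nat.strong_induction_on generalizing β with
  | _ n ih =>
  by_cases h1 : 2 ≤ β.norm
  · obtain ⟨s, M, hM, hs⟩ := exists_toWord_eq_of_cyclicLength_le h1 h2 h3
    have hcomm : Commute (FreeGroup.mk [s])⁻¹ (FreeGroup.mk [y] : FreeGroup (Fin k)) := by
      rcases hs with rfl | rfl
      · exact (Commute.refl _).inv_left
      · rw [mk_singleton_inv, letterInv_letterInv]
    have hβ : (FreeGroup.mk [s])⁻¹ * β * (FreeGroup.mk [s])⁻¹⁻¹ = FreeGroup.mk M := by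
      have : β = FreeGroup.mk [s] * (FreeGroup.mk M * (FreeGroup.mk [s])⁻¹) := by
        rw [mk_singleton_inv, FreeGroup.mul_mk, ← mk_cons, ← hM, FreeGroup.mk_toWord]
      rw [this]
      group
    have hlt : (FreeGroup.mk M : FreeGroup (Fin k)).norm < n := by
      rw [← h]
      refine FreeGroup.norm_mk_le.trans_lt ?_
      rw [FreeGroup.norm, hM]
      simp
    obtain ⟨c, hc, hc'⟩ := ih _ hlt (β := FreeGroup.mk M) (by rwa [← hβ, cyclicLength_conj])
      (by
        have : FreeGroup.mk [y] * FreeGroup.mk M =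
            (FreeGroup.mk [s])⁻¹ * (FreeGroup.mk [y] * β) * (FreeGroup.mk [s])⁻¹⁻¹ := by
          rw [← hβ, ← mul_assoc, ← mul_assoc, ← mul_assoc, hcomm.eq]
        rwa [this, cyclicLength_conj]) rfl
    refine ⟨c * (FreeGroup.mk [s])⁻¹, hc.mul_left hcomm, ?_⟩
    rw [← hβ] at hc'
    convert hc' using 2
    group
  · exact ⟨1, Commute.one_left _, by simpa using (by omega : β.norm ≤ 1)⟩

/-- An automorphism that does not increase cyclic lengths is simple. -/
theorem isSimple_of_cyclicLength_le (hk : 2 ≤ k) {φ : MulAut (FreeGroup (Fin k))}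
    (h : ∀ w, cyclicLength (φ w) ≤ cyclicLength w) : IsSimple φ := by
  have hconj : ∀ {ψ : MulAut (FreeGroup (Fin k))} (c : FreeGroup (Fin k)),
      (∀ w, cyclicLength (ψ w) ≤ cyclicLength w) →
      ∀ w, cyclicLength ((MulAut.conj c * ψ) w) ≤ cyclicLength w := fun c h w => by
    rw [MulAut.mul_apply, MulAut.conj_apply, cyclicLength_conj]
    exact h w
  have hone : ∀ x : Letter k, cyclicLength (FreeGroup.mk [x] : FreeGroup (Fin k)) ≤ 1 := fun x =>
    (cyclicLength_le_norm _).trans FreeGroup.norm_mk_le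
  have htwo : ∀ x y : Letter k,
      cyclicLength (FreeGroup.mk [x] * FreeGroup.mk [y] : FreeGroup (Fin k)) ≤ 2 := fun x y =>
    (cyclicLength_le_norm _).trans (by
      rw [FreeGroup.mul_mk]
      exact FreeGroup.norm_mk_le)
  let x₁ : Letter k := (⟨0, by omega⟩, true)
  let x₂ : Letter k := (⟨1, by omega⟩, true)
  have hx : x₁ ≠ x₂ ∧ x₁ ≠ letterInv x₂ := by simp [x₁, x₂, letterInv]
  -- After a conjugation the image of `x₁` is a single letter `y₁`.
  obtain ⟨c₁, hc₁⟩ := exists_norm_conj_eq (φ (FreeGroup.mk [x₁]))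
  refine IsSimple.of_conj_mul (c := c₁⁻¹) ?_
  replace h := hconj c₁⁻¹ h
  have h1 : ((MulAut.conj c₁⁻¹ * φ) (FreeGroup.mk [x₁])).norm ≤ 1 := by
    rw [MulAut.mul_apply, MulAut.conj_apply, inv_inv, hc₁]
    have := h (FreeGroup.mk [x₁])
    rw [MulAut.mul_apply, MulAut.conj_apply, cyclicLength_conj] at this
    exact this.trans (hone _)
  generalize MulAut.conj c₁⁻¹ * φ = ψ at h h1
  have hne : ∀ (ψ : MulAut (FreeGroup (Fin k))) x, ψ (FreeGroup.mk [x]) ≠ 1 := fun ψ x e =>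
    mk_singleton_ne_one x (ψ.injective (e.trans (map_one ψ).symm))
  obtain ⟨y₁, hy₁⟩ := exists_eq_mk_singleton (hne ψ x₁) h1
  -- A second conjugation, by an element commuting with `y₁`, makes the image of `x₂` a letter
  -- without changing that of `x₁`.
  obtain ⟨c₂, hc₂, hc₂'⟩ := exists_commute_norm_conj_le (y := y₁)
    (β := ψ (FreeGroup.mk [x₂])) ((h _).trans (hone _)) (by
      rw [← hy₁, ← map_mul]
      exact (h _).trans (htwo _ _))
  refine IsSimple.of_conj_mul (c := c₂) ?_
  replace h := hconj c₂ h
  have h2 : (MulAut.conj c₂ * ψ) (FreeGroup.mk [x₁]) = FreeGroup.mk [y₁] := by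
    rw [MulAut.mul_apply, MulAut.conj_apply, hy₁, hc₂.eq, mul_inv_cancel_right]
  have h3 : ((MulAut.conj c₂ * ψ) (FreeGroup.mk [x₂])).norm ≤ 1 := by
    rw [MulAut.mul_apply, MulAut.conj_apply]
    exact hc₂'
  generalize MulAut.conj c₂ * ψ = χ at h h2 h3
  obtain ⟨y₂, hy₂⟩ := exists_eq_mk_singleton (hne χ x₂) h3
  have hy : y₁ ≠ y₂ ∧ y₁ ≠ letterInv y₂ := by
    constructor
    · rintro rfl
      exact hx.1 (mk_singleton_injective (χ.injective (h2.trans hy₂.symm)))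
    · rintro rfl
      refine hx.2 (mk_singleton_injective (χ.injective (h2.trans ?_)))
      show _ = χ (FreeGroup.mk [letterInv x₂])
      rw [← mk_singleton_inv, ← mk_singleton_inv, map_inv, hy₂]
  refine ⟨1, χ, isRelabeling_of_norm_le fun x => ?_, by simp⟩
  -- An image of length at least `2` would have to begin with `y₁^{±1}` and also with `y₂^{±1}`,
  -- which are different letters.
  by_contra hx'
  have hcl := (h (FreeGroup.mk [x])).trans (hone x)
  obtain ⟨s, M, hM, hs⟩ := exists_toWord_eq_of_cyclicLength_le (y := y₁) (by omega) hcl (by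
    rw [← h2, ← map_mul]
    exact (h _).trans (htwo _ _))
  obtain ⟨s', M', hM', hs'⟩ := exists_toWord_eq_of_cyclicLength_le (y := y₂) (by omega) hcl (by
    rw [← hy₂, ← map_mul]
    exact (h _).trans (htwo _ _))
  obtain rfl : s = s' := (List.cons.inj (hM.symm.trans hM')).1
  rcases hs with rfl | rfl <;> rcases hs' with h5 | h5
  · exact hy.1 h5
  · exact hy.2 h5
  · exact hy.2 (letterInv_eq_comm.1 h5)
  · exact hy.1 (letterInv_injective h5)

/-! ### Growth of simple and non-simple automorphisms -/

lemma ncard_crossing_cone (v : FreeGroup (Fin k)) (x : Letter k) (h : FreeGroup (Fin k)) :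
    (crossing (cone v x) h).Finite ∧
      (crossing (cone v x) h).ncard = h.toWord.countP fun y => y.1 = x.1 := by
  have : crossing (cone v x) h = (fun g => v * g) '' crossing (cone 1 x) h := by
    ext g
    constructor
    · intro hg
      refine ⟨v⁻¹ * g, ?_, by simp⟩
      simpa [crossing, cone, mul_assoc] using hg
    · rintro ⟨g, hg, rfl⟩
      simpa [crossing, cone, mul_assoc] using hg
  rw [this, Set.ncard_image_of_injective _ (mul_right_injective v), ncard_crossing_cone_one]
  exact ⟨(isAlmostInvariant_cone_one x h).image _, rfl⟩

/-- Altering the set on a finite `E` only affects the translates with an end in `E`, at most `2|E|`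
of them. -/
lemma IsAlmostCone.exists_ncard_crossing_le {X : Set (FreeGroup (Fin k))} {v : FreeGroup (Fin k)}
    {x : Letter k} (hX : IsAlmostCone X v x) :
    ∃ C : ℕ, ∀ h, (crossing X h).ncard ≤ (h.toWord.countP fun y => y.1 = x.1) + C := by
  set E := {g | ¬(g ∈ X ↔ g ∈ cone v x)} with hE
  have hEfin : E.Finite := hX
  refine ⟨E.ncard + E.ncard, fun h => ?_⟩
  obtain ⟨h1, h2⟩ := ncard_crossing_cone v x h
  have hsub : crossing X h ⊆ crossing (cone v x) h ∪ (E ∪ {g | g * h ∈ E}) := by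
    intro g hg
    simp only [crossing, hE, Set.mem_union, Set.mem_ofPred_eq] at hg ⊢
    tauto
  refine (Set.ncard_le_ncard hsub (h1.union
    (hEfin.union (finite_preimage_mul_right h hEfin)))).trans ((Set.ncard_union_le _ _).trans ?_)
  rw [h2]
  refine Nat.add_le_add_left ((Set.ncard_union_le _ _).trans ?_) _
  rw [ncard_preimage_mul_right]

/-- Each pulled-back cone counts, up to a constant, the occurrences of one generator. If the
generators so assigned are a permutation of all of them, the counts add up to `|g|`; hence `|φ g| ≤
|g| + C`, and powers turn this into monotonicity of cyclic lengths. -/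
lemma isSimple_of_isAlmostCone (hk : 2 ≤ k) {φ : MulAut (FreeGroup (Fin k))}
    (h : ∀ i : Fin k, ∃ v x, IsAlmostCone (φ ⁻¹' cone 1 (i, true)) v x) : IsSimple φ := by
  choose v x hx using h
  choose C hC using fun i => (hx i).exists_ncard_crossing_le
  have hbound : ∀ g : FreeGroup (Fin k), (φ g).norm ≤
      ∑ i, (g.toWord.countP fun y => y.1 = (x i).1) + ∑ i, C i := fun g => by
    rw [norm_apply_eq_sum, ← Finset.sum_add_distrib]
    exact Finset.sum_le_sum fun i _ => hC i g
  -- The powers of a generator that is never counted would have images of bounded length, forcing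
  -- its image to be trivial.
  have hsurj : Function.Surjective fun i => (x i).1 := by
    intro j
    by_contra hj
    push Not at hj
    have h1 : ∀ N : ℕ, N * cyclicLength (φ (FreeGroup.of j)) ≤ ∑ i, C i := fun N => by
      refine (mul_cyclicLength_le_norm_pow _ N).trans ?_
      rw [← map_pow]
      refine (hbound _).trans (le_of_eq ?_)
      rw [Finset.sum_eq_zero, zero_add]
      intro i _
      rw [FreeGroup.toWord_of_pow, List.countP_eq_zero]
      intro y hy
      rw [List.eq_of_mem_replicate hy]
      simpa using (hj i).symm
    have h2 : cyclicLength (φ (FreeGroup.of j)) = 0 := by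
      by_contra hne
      have h3 := h1 (∑ i, C i + 1)
      have h4 := Nat.le_mul_of_pos_right (∑ i, C i + 1) (Nat.pos_of_ne_zero hne)
      omega
    exact FreeGroup.of_ne_one j
      (φ.injective ((eq_one_of_cyclicLength_eq_zero h2).trans (map_one φ).symm))
  have hbij := Finite.surjective_iff_bijective.1 hsurj
  have hbound' : ∀ g : FreeGroup (Fin k), (φ g).norm ≤ g.norm + ∑ i, C i := fun g => by
    refine (hbound g).trans (Nat.add_le_add_right (le_of_eq ?_) _)
    rw [hbij.sum_comp fun j => g.toWord.countP fun y => y.1 = j, norm_eq_sum_ncard_crossing]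
    exact Finset.sum_congr rfl fun i _ => (ncard_crossing_cone_one (i, true) g).symm
  refine isSimple_of_cyclicLength_le hk fun w =>
    cyclicLength_le_of_forall_norm_pow_le (C := ∑ i, C i) fun N => ?_
  rw [← map_pow]
  exact hbound' _

lemma infinite_cone_one (x : Letter k) : (cone 1 x).Infinite := by
  refine Set.infinite_of_injective_forall_mem (f := fun n : ℕ =>
    (FreeGroup.mk (List.replicate (n + 1) x) : FreeGroup (Fin k))) ?_ fun n => ?_
  · intro n m e
    have := congrArg (fun g => g.toWord.length) e
    simpa using this
  · rw [mem_cone_one, FreeGroup.toWord_mk, FreeGroup.reduce_replicate]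
    rfl

/-- Lower bounds for the growth of an automorphism in terms of the numbers of occurrences of
two-letter subwords. -/
theorem exists_le_norm_apply (hk : 2 ≤ k) (φ : MulAut (FreeGroup (Fin k))) :
    ∃ C : ℝ, ∀ (h : FreeGroup (Fin k)) (t : ℝ), 0 ≤ t →
      (∀ p q : Letter k, q ≠ letterInv p → t ≤ pairCount p q h.toWord) →
      2 * k * (2 * k - 1) * t ≤ (φ h).norm + C ∧
      (¬IsSimple φ → (2 * k * (2 * k - 1) + 2 * (2 * k - 3)) * t ≤ (φ h).norm + C) := by
  classical
  have hinf : ∀ i : Fin k, (φ ⁻¹' cone 1 (i, true)).Infinite := fun i =>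
    (infinite_cone_one _).preimage (by rw [φ.surjective.range_eq]; exact Set.subset_univ _)
  have hinf' : ∀ i : Fin k, (φ ⁻¹' cone 1 (i, true))ᶜ.Infinite := fun i => by
    rw [← Set.preimage_compl]
    refine Set.Infinite.preimage ((infinite_cone_one (i, false)).mono ?_)
      (by rw [φ.surjective.range_eq]; exact Set.subset_univ _)
    intro g hg hg'
    rw [mem_cone_one] at hg hg'
    rw [hg] at hg'
    simp at hg'
  choose C hC using fun i : Fin k => IsAlmostInvariant.exists_le_ncard_crossing hk
    (isAlmostInvariant_preimage φ (isAlmostInvariant_cone_one (i, true))) (hinf i) (hinf' i)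
  refine ⟨∑ i, C i, fun h t ht htu => ?_⟩
  have hnorm : ((φ h).norm : ℝ) + ∑ i, C i =
      ∑ i, (((crossing (φ ⁻¹' cone 1 (i, true)) h).ncard : ℝ) + C i) := by
    rw [norm_apply_eq_sum, Finset.sum_add_distrib]
    push_cast
    rfl
  rw [hnorm]
  have hlow := fun i => (hC i h t ht htu).1
  constructor
  · refine le_trans (le_of_eq ?_) (Finset.sum_le_sum fun i _ => hlow i)
    rw [Finset.sum_const, Finset.card_univ, Fintype.card_fin, nsmul_eq_mul]
    ring
  · intro hφ
    obtain ⟨i, hi⟩ : ∃ i : Fin k, ¬∃ v x, IsAlmostCone (φ ⁻¹' cone 1 (i, true)) v x := by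
      by_contra hc
      push Not at hc
      exact hφ (isSimple_of_isAlmostCone hk hc)
    -- One index that is not an almost cone adds `4(2k - 2) - 2(2k - 1) = 2(2k - 3)` to the
    -- coefficient.
    rw [← Finset.add_sum_erase _ _ (Finset.mem_univ i)]
    refine le_trans (le_of_eq ?_) (add_le_add ((hC i h t ht htu).2 hi)
      (Finset.sum_le_sum fun j (_ : j ∈ Finset.univ.erase i) => hlow j))
    rw [Finset.sum_const, Finset.card_erase_of_mem (Finset.mem_univ _), Finset.card_univ,
      Fintype.card_fin, nsmul_eq_mul, Nat.cast_sub (by omega)]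
    push_cast
    ring

end Simple

/-! ### Limit theorems for uniformly random rays -/

section Rays

variable {k : ℕ}

lemma toWord_rayPoint (w : Boundary k) (n : ℕ) :
    (rayPoint w n).toWord = List.ofFn fun i : Fin n => w.1 i := by
  refine toWord_mk_of_isReduced ?_
  rw [FreeGroup.IsReduced, List.isChain_iff_getElem]
  intro i hi
  simp only [List.getElem_ofFn]
  exact ne_letterInv_iff.1 (w.2 i)

lemma norm_rayPoint (w : Boundary k) (n : ℕ) : (rayPoint w n).norm = n := by
  rw [FreeGroup.norm, toWord_rayPoint, List.length_ofFn]

lemma finite_sphere (n : ℕ) : {g : FreeGroup (Fin k) | g.norm = n}.Finite :=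
  (finite_norm_lt (n + 1)).subset fun g (hg : g.norm = n) => by
    simp [hg]

/-- A reduced word may be preceded by its own first letter, so the families `words x` cover the
sphere. Their overlaps are harmless for an upper bound. -/
lemma ncard_sphere_le (hk : 1 ≤ k) (P : FreeGroup (Fin k) → Prop) [DecidablePred P] (n : ℕ) :
    {g : FreeGroup (Fin k) | g.norm = n ∧ P g}.ncard ≤
      ∑ x : Letter k, ((words x n).filter fun u => P (FreeGroup.mk u)).card := by
  classical
  refine le_trans ?_ Finset.card_biUnion_le
  rw [← Set.ncard_coe_finset, ← Set.ncard_image_of_injective _ FreeGroup.toWord_injective]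
  refine Set.ncard_le_ncard ?_ (Finset.finite_toSet _)
  rintro _ ⟨g, ⟨hg, hP⟩, rfl⟩
  rw [Finset.mem_coe, Finset.mem_biUnion]
  let y : Letter k := g.toWord.headD (⟨0, hk⟩, true)
  refine ⟨y, Finset.mem_univ _, ?_⟩
  rw [Finset.mem_filter, FreeGroup.mk_toWord, mem_words]
  refine ⟨⟨hg, ?_⟩, hP⟩
  have hr := FreeGroup.isReduced_toWord (x := g)
  rcases h : g.toWord with _ | ⟨z, u⟩
  · simp
  · have : y = z := by simp [y, h]
    rw [this, isReduced_cons_cons, ← h]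
    exact ⟨(letterInv_ne z).symm, hr⟩

lemma IsQuasiAdditive.exists_ncard_sphere_le (hk : 2 ≤ k) {S : List (Letter k) → ℝ} {B l Δ : ℝ}
    (hS : IsQuasiAdditive S B) (hl : ∀ n x, |avg x n S - l * n| ≤ Δ) {ε : ℝ} (hε : 0 < ε) :
    ∃ σ D : ℝ, 0 < σ ∧ σ < 1 ∧ 0 < D ∧ ∀ n : ℕ,
      ({g : FreeGroup (Fin k) | g.norm = n ∧ ε * n < |S g.toWord - l * n|}.ncard : ℝ) ≤
        D * σ ^ n * (2 * k - 1 : ℝ) ^ n := by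
  classical
  obtain ⟨σ, D, hσ, hσ1, hD, h⟩ := hS.exists_card_le hk hl hε
  refine ⟨σ, 2 * k * D, hσ, hσ1, by positivity, fun n => ?_⟩
  have h1 := ncard_sphere_le (by omega : 1 ≤ k)
    (fun g : FreeGroup (Fin k) => ε * n < |S g.toWord - l * n|) n
  have h2 : (∑ x : Letter k, (((words x n).filter fun u =>
      ε * n < |S (FreeGroup.mk u).toWord - l * n|).card : ℝ)) ≤
      ∑ _x : Letter k, D * σ ^ n * (2 * k - 1 : ℝ) ^ n := by
    refine Finset.sum_le_sum fun x _ => ?_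
    rw [Finset.filter_congr fun u hu => by
      rw [toWord_mk_of_isReduced (isReduced_of_mem_words hu)]]
    exact h n x
  have hc : (Finset.univ : Finset (Letter k)).card = 2 * k := by simp [mul_comm]
  rw [Finset.sum_const, hc, nsmul_eq_mul] at h2
  refine (Nat.cast_le.2 h1).trans ?_
  push_cast at h2 ⊢
  linarith

lemma uniformMeasure_rayPoint_le (hk : 2 ≤ k) {n : ℕ} (hn : n ≠ 0) {A : Set (FreeGroup (Fin k))}
    (hA : ∀ g ∈ A, g.norm = n) :
    uniformMeasure k {w | rayPoint w n ∈ A} ≤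
      ENNReal.ofReal (A.ncard / (2 * k - 1 : ℝ) ^ (n - 1)) := by
  classical
  have h3 := two_mul_sub_one_pos hk
  have hfin : A.Finite := (finite_sphere n).subset hA
  have h1 : {w : Boundary k | rayPoint w n ∈ A} =
      ⋃ g ∈ hfin.toFinset, {w : Boundary k | rayPoint w n = g} := by
    ext w
    simp
  rw [h1]
  refine (measure_biUnion_finset_le _ _).trans ?_
  have h2 : ∀ g ∈ hfin.toFinset, uniformMeasure k {w : Boundary k | rayPoint w n = g} ≤
      ENNReal.ofReal (1 / (2 * k - 1 : ℝ) ^ (n - 1)) := by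
    intro g hg
    have hg := hA g (hfin.mem_toFinset.1 hg)
    have hg1 : g ≠ 1 := by
      rintro rfl
      simp at hg
      omega
    have h4 := uniformMeasure_cylinder k (by omega) g hg1
    rw [hg] at h4
    rw [h4, one_div, ENNReal.ofReal_inv_of_pos (by positivity), ENNReal.inv_le_inv]
    have h5 : ((2 * k - 1 : ℝ) ^ (n - 1)) = (((2 * k - 1) ^ (n - 1) : ℕ) : ℝ) := by
      push_cast [Nat.cast_sub (by omega : 1 ≤ 2 * k)]
      rfl
    rw [h5, ENNReal.ofReal_natCast, Nat.cast_le]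
    exact Nat.le_mul_of_pos_left _ (by omega)
  refine (Finset.sum_le_sum h2).trans (le_of_eq ?_)
  rw [Finset.sum_const, nsmul_eq_mul, ← ENNReal.ofReal_natCast,
    ← ENNReal.ofReal_mul (Nat.cast_nonneg _), Set.ncard_eq_toFinset_card A hfin]
  congr 1
  ring

/-- The strong law of large numbers for quasi-additive functions along random rays. -/
theorem IsQuasiAdditive.ae_tendsto (hk : 2 ≤ k) {S : List (Letter k) → ℝ} {B l Δ : ℝ}
    (hS : IsQuasiAdditive S B) (hl : ∀ n x, |avg x n S - l * n| ≤ Δ) :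
    ∀ᵐ w ∂(uniformMeasure k),
      Tendsto (fun n : ℕ => S (rayPoint w n).toWord / n) atTop (𝓝 l) := by
  have h3 := two_mul_sub_one_pos hk
  -- Borel–Cantelli for the tolerances `1 / (m + 1)`, of which there are countably many. The
  -- cylinder estimate does not cover `n = 0`, so that term is bounded by `1` separately.
  have key : ∀ m : ℕ, ∀ᵐ w ∂(uniformMeasure k), ∀ᶠ n : ℕ in atTop,
      w ∉ {w : Boundary k | rayPoint w n ∈ {g : FreeGroup (Fin k) |
        g.norm = n ∧ (1 / (m + 1) : ℝ) * n < |S g.toWord - l * n|}} := by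
    intro m
    refine ae_eventually_notMem ?_
    obtain ⟨σ, D, hσ, hσ1, hD, h⟩ := hS.exists_ncard_sphere_le hk hl
      (ε := 1 / (m + 1)) (by positivity)
    have hbound : ∀ n : ℕ, uniformMeasure k {w : Boundary k | rayPoint w n ∈
        {g : FreeGroup (Fin k) | g.norm = n ∧ (1 / (m + 1) : ℝ) * n < |S g.toWord - l * n|}} ≤
        ENNReal.ofReal (D * (2 * k - 1) * σ ^ n + if n = 0 then 1 else 0) := by
      intro n
      rcases Nat.eq_zero_or_pos n with rfl | hn
      · have := uniformMeasure_isProbabilityMeasure k (by omega)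
        refine prob_le_one.trans ?_
        rw [← ENNReal.ofReal_one]
        refine ENNReal.ofReal_le_ofReal ?_
        simp only [pow_zero, mul_one, if_true]
        have : 0 ≤ D * (2 * k - 1 : ℝ) := mul_nonneg hD.le (by linarith)
        linarith
      · refine (uniformMeasure_rayPoint_le hk hn.ne' fun g hg => hg.1).trans
          (ENNReal.ofReal_le_ofReal ?_)
        rw [if_neg hn.ne', add_zero, div_le_iff₀ (by positivity)]
        refine (h n).trans (le_of_eq ?_)
        obtain ⟨n, rfl⟩ := Nat.exists_eq_succ_of_ne_zero hn.ne'
        simp only [Nat.succ_eq_add_one, Nat.add_sub_cancel]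
        ring
    refine ne_top_of_le_ne_top ?_ (ENNReal.tsum_le_tsum hbound)
    refine Summable.tsum_ofReal_ne_top (Summable.add ?_ ?_)
    · exact (summable_geometric_of_lt_one hσ.le hσ1).mul_left _
    · exact summable_of_hasFiniteSupport ((Set.finite_singleton 0).subset fun n hn => by
        by_contra h
        simp only [Set.mem_singleton_iff] at h
        simp [h] at hn)
  filter_upwards [ae_all_iff.2 key] with w hw
  rw [Metric.tendsto_atTop]
  intro ε hε
  obtain ⟨m, hm⟩ := exists_nat_one_div_lt hε
  obtain ⟨N, hN⟩ := eventually_atTop.1 (hw m)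
  refine ⟨max N 1, fun n hn => ?_⟩
  have h1 := hN n (le_of_max_le_left hn)
  have hn0 : (0 : ℝ) < n := by exact_mod_cast le_of_max_le_right hn
  simp only [not_and, not_lt, norm_rayPoint, true_imp_iff] at h1
  rw [Real.dist_eq, ← mul_lt_mul_iff_left₀ hn0]
  refine lt_of_le_of_lt ?_ (mul_lt_mul_of_pos_right hm hn0)
  refine le_trans (le_of_eq ?_) h1
  rw [← abs_of_pos hn0, ← abs_mul, abs_of_pos hn0, sub_mul, div_mul_cancel₀ _ hn0.ne']

lemma measurable_norm_rayPoint (φ : MulAut (FreeGroup (Fin k))) (n : ℕ) :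
    Measurable fun w : Boundary k => ((φ (rayPoint w n)).norm : ℝ) := by
  have h1 : Measurable fun w : Boundary k => fun i : Fin n => w.1 i :=
    measurable_pi_lambda _ fun i => (measurable_pi_apply _).comp measurable_subtype_coe
  have h2 : Measurable fun u : Fin n → Letter k => ((φ (FreeGroup.mk (List.ofFn u))).norm : ℝ) :=
    Measurable.of_discrete
  exact h2.comp h1

/-- Generic stretching factors exist. -/
theorem exists_isGenericStretchingFactor (hk : 2 ≤ k) (φ : MulAut (FreeGroup (Fin k))) :
    ∃ l, IsGenericStretchingFactor φ.toMonoidHom l := by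
  have hprob := uniformMeasure_isProbabilityMeasure k (by omega)
  obtain ⟨B, hB⟩ := exists_isQuasiAdditive_norm φ
  obtain ⟨l, Δ, -, hl⟩ := hB.exists_mean hk
  obtain ⟨L, hL, -, hbound⟩ := hB.exists_cons_bound
  have hae : ∀ᵐ w ∂(uniformMeasure k),
      Tendsto (fun n : ℕ => ((φ.toMonoidHom (rayPoint w n)).norm : ℝ) / n) atTop (𝓝 l) := by
    filter_upwards [hB.ae_tendsto hk hl] with w hw
    simp only [FreeGroup.mk_toWord] at hw
    exact hw
  refine ⟨l, hae, ?_⟩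
  simp_rw [eLpNorm_one_eq_lintegral_enorm]
  have h0 : (0 : ENNReal) = ∫⁻ _w : Boundary k, 0 ∂(uniformMeasure k) := by simp
  rw [h0]
  -- The dominating constant comes from `L * (n + 1) ≤ 2 * L * n` for `n ≥ 1`; at `n = 0` the
  -- quotient is `0`.
  refine tendsto_lintegral_of_dominated_convergence (fun _ => ENNReal.ofReal (2 * L + |l|)) ?_ ?_ ?_
    ?_
  · intro n
    exact (((measurable_norm_rayPoint φ n).div_const _).sub_const _).enorm
  · intro n
    refine Eventually.of_forall fun w => ?_
    show ‖((φ (rayPoint w n)).norm : ℝ) / n - l‖ₑ ≤ ENNReal.ofReal (2 * L + |l|)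
    rw [← ofReal_norm]
    refine ENNReal.ofReal_le_ofReal ((norm_sub_le _ _).trans (add_le_add ?_ le_rfl))
    have h1 := hbound (rayPoint w n).toWord FreeGroup.isReduced_toWord
    have h2 := norm_rayPoint w n
    rw [FreeGroup.norm] at h2
    rw [FreeGroup.mk_toWord, h2] at h1
    rw [Real.norm_eq_abs, abs_div, Nat.abs_cast n]
    rcases Nat.eq_zero_or_pos n with rfl | hn
    · simpa using hL.le
    · have hn1 : (1 : ℝ) ≤ n := by exact_mod_cast hn
      rw [div_le_iff₀ (by linarith)]
      refine h1.trans ?_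
      nlinarith
  · simp
  · filter_upwards [hae] with w hw
    have h1 := (hw.sub_const l).enorm
    simpa using h1

lemma isGenericStretchingFactor_genericStretchingFactor (hk : 2 ≤ k)
    (φ : MulAut (FreeGroup (Fin k))) :
    IsGenericStretchingFactor φ.toMonoidHom (genericStretchingFactor φ.toMonoidHom) := by
  obtain ⟨l, hl⟩ := exists_isGenericStretchingFactor hk φ
  rwa [hl.eq (by omega)]

lemma genericStretchingFactor_eq_of_abs_le (hk : 2 ≤ k) {φ : MulAut (FreeGroup (Fin k))} {c D : ℝ}
    (h : ∀ g, |((φ g).norm : ℝ) - c * g.norm| ≤ D) :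
    genericStretchingFactor φ.toMonoidHom = c := by
  have hprob := uniformMeasure_isProbabilityMeasure k (by omega)
  obtain ⟨w, hw⟩ := (isGenericStretchingFactor_genericStretchingFactor hk φ).1.exists
  refine tendsto_nhds_unique hw ?_
  rw [tendsto_iff_dist_tendsto_zero]
  refine squeeze_zero' (Eventually.of_forall fun n => dist_nonneg) ?_
    (tendsto_const_div_atTop_nhds_zero_nat D)
  filter_upwards [eventually_gt_atTop 0] with n hn
  have hn0 : (0 : ℝ) < n := by exact_mod_cast hn
  rw [Real.dist_eq, le_div_iff₀ hn0, ← abs_of_pos hn0, ← abs_mul, abs_of_pos hn0, sub_mul,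
    div_mul_cancel₀ _ hn0.ne']
  have := h (rayPoint w n)
  rwa [norm_rayPoint] at this

/-- A linear lower bound in terms of numbers of occurrences of two-letter subwords yields a lower
bound for the generic stretching factor. -/
lemma le_genericStretchingFactor (hk : 2 ≤ k) {φ : MulAut (FreeGroup (Fin k))} {M C : ℝ}
    (hM : 0 < M)
    (h : ∀ (g : FreeGroup (Fin k)) (t : ℝ), 0 ≤ t →
      (∀ p q : Letter k, q ≠ letterInv p → t ≤ pairCount p q g.toWord) →
      M * t ≤ (φ g).norm + C) :
    M * (1 / (2 * k * (2 * k - 1))) ≤ genericStretchingFactor φ.toMonoidHom := by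
  have h3 := two_mul_sub_one_pos hk
  have hprob := uniformMeasure_isProbabilityMeasure k (by omega)
  set c₀ : ℝ := 1 / (2 * k * (2 * k - 1)) with hc₀
  have hc₀pos : 0 < c₀ := by
    have : (0 : ℝ) < k := by linarith
    rw [hc₀]
    have : (0 : ℝ) < 2 * k - 1 := by linarith
    positivity
  set l := genericStretchingFactor φ.toMonoidHom with hl
  have hcount : ∀ᵐ w ∂(uniformMeasure k), ∀ p q : Letter k, q ≠ letterInv p →
      Tendsto (fun n : ℕ => (pairCount p q (rayPoint w n).toWord : ℝ) / n) atTop (𝓝 c₀) := by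
    rw [ae_all_iff]
    intro p
    rw [ae_all_iff]
    intro q
    by_cases hpq : q ≠ letterInv p
    · obtain ⟨Δ, hΔ⟩ := exists_avg_pairCount hk hpq
      filter_upwards [(isQuasiAdditive_pairCount p q).ae_tendsto hk hΔ] with w hw _
      exact hw
    · exact Eventually.of_forall fun w h => absurd h hpq
  obtain ⟨w, hw1, hw2⟩ :=
    ((isGenericStretchingFactor_genericStretchingFactor hk φ).1.and hcount).exists
  -- For `c` below the common frequency `c₀`, almost every ray eventually contains each admissible
  -- pair at least `c * n` times, so `t = c * n` is allowed. Afterwards `c` is taken arbitrarily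
  -- close to `c₀`.
  have key : ∀ c, 0 < c → c < c₀ → M * c ≤ l := by
    intro c hc hcc
    have h4 : Tendsto (fun n : ℕ => ((φ (rayPoint w n)).norm : ℝ) / n + C / n) atTop (𝓝 (l + 0)) :=
      hw1.add (tendsto_const_div_atTop_nhds_zero_nat C)
    rw [add_zero] at h4
    refine ge_of_tendsto h4 ?_
    have h5 : ∀ᶠ n : ℕ in atTop, ∀ p q : Letter k, q ≠ letterInv p →
        c < (pairCount p q (rayPoint w n).toWord : ℝ) / n := by
      rw [eventually_all]
      intro p
      rw [eventually_all]
      intro q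
      by_cases hpq : q ≠ letterInv p
      · filter_upwards [(hw2 p q hpq).eventually (lt_mem_nhds hcc)] with n hn _
        exact hn
      · exact Eventually.of_forall fun w h => absurd h hpq
    filter_upwards [h5, eventually_gt_atTop 0] with n hn hn0
    have hn0 : (0 : ℝ) < n := by exact_mod_cast hn0
    rw [← add_div, le_div_iff₀ hn0, mul_assoc]
    refine h _ _ (by positivity) fun p q hpq => ?_
    have := hn p q hpq
    rw [lt_div_iff₀ hn0] at this
    exact this.le
  by_contra hlt
  push Not at hlt
  have hpos : 0 < M * (c₀ / 2) := by positivity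
  have h6 := key (c₀ / 2) (by positivity) (by linarith)
  have h7 : l / M < c₀ := by rwa [div_lt_iff₀ hM, mul_comm]
  have h8 : 0 < l / M := div_pos (by linarith) hM
  have h9 := key ((l / M + c₀) / 2) (by positivity) (by linarith)
  have h10 : M * (l / M) = l := by field_simp
  nlinarith

end Rays

/-! ### Generic cyclically reduced words -/

section Generic

variable {k : ℕ}

/-- Only the inverses of the first and of the last letter are forbidden, and there are at least four
letters. -/
lemma exists_isCyclicallyReduced_concat (hk : 2 ≤ k) {u : List (Letter k)}
    (hu : FreeGroup.IsReduced u) : ∃ z, FreeGroup.IsCyclicallyReduced (u ++ [z]) := by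
  classical
  let x₀ : Letter k := (⟨0, by omega⟩, true)
  obtain ⟨z, -, hz⟩ : ∃ z ∈ (Finset.univ : Finset (Letter k)),
      z ∉ ({letterInv (u.headD x₀), letterInv (u.getLastD x₀)} : Finset (Letter k)) := by
    refine Finset.exists_mem_notMem_of_card_lt_card (Finset.card_le_two.trans_lt ?_)
    rw [Finset.card_univ, Fintype.card_prod, Fintype.card_fin, Fintype.card_bool]
    omega
  simp only [Finset.mem_insert, Finset.mem_singleton, not_or] at hz
  refine ⟨z, isReduced_append.2 ⟨hu, by simp, ?_⟩, ?_⟩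
  · intro a ha b hb
    rw [List.head?_cons, Option.mem_some_iff] at hb
    subst hb
    have : u.getLastD x₀ = a := by
      rw [List.getLastD_eq_getLast?, ha, Option.getD_some]
    rw [← this]
    exact hz.2
  · intro a ha b hb
    rw [List.getLast?_concat, Option.mem_some_iff] at ha
    subst ha
    rw [← ne_letterInv_iff]
    rcases u with _ | ⟨c, u⟩
    · obtain rfl : z = b := by simpa using hb
      exact (letterInv_ne z).symm
    · obtain rfl : c = b := by simpa using hb
      intro e
      exact hz.1 (by rw [List.headD_cons, e, letterInv_letterInv])

/-- Adding a closing letter is injective on the words that may follow a fixed letter. This gives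
cyclically reduced words the same exponential growth rate as all reduced words. -/
lemma pow_le_sphereCount_cyclicallyReducedWords (hk : 2 ≤ k) (n : ℕ) :
    (2 * k - 1 : ℝ) ^ n ≤ sphereCount (cyclicallyReducedWords k) (n + 1) := by
  classical
  let x₀ : Letter k := (⟨0, by omega⟩, true)
  have : Nonempty (Letter k) := ⟨x₀⟩
  choose! z hz using fun (u : List (Letter k)) (hu : FreeGroup.IsReduced u) =>
    exists_isCyclicallyReduced_concat hk hu
  rw [← card_words (by omega) x₀ n, Nat.cast_le, sphereCount,
    ← Set.ncard_image_of_injective _ FreeGroup.toWord_injective,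
    ← Finset.card_image_of_injective (words x₀ n) (f := fun u => u ++ [z u])
      (fun u v e => List.append_inj_left' e rfl), ← Set.ncard_coe_finset]
  refine Set.ncard_le_ncard ?_ (Set.Finite.image _ ((finite_sphere (n + 1)).subset fun g hg => hg.2))
  intro v hv
  obtain ⟨u, hu, rfl⟩ := Finset.mem_image.1 (Finset.mem_coe.1 hv)
  have h1 := hz u (isReduced_of_mem_words hu)
  have h2 := toWord_mk_of_isReduced h1.isReduced
  refine ⟨FreeGroup.mk (u ++ [z u]), ⟨?_, ?_⟩, h2⟩
  · show FreeGroup.IsCyclicallyReduced _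
    rwa [h2]
  · rw [FreeGroup.norm, h2, List.length_append, (mem_words.1 hu).1, List.length_singleton]

/-- The cyclically reduced words in which every two-letter subword has frequency above `δ`. -/
def frequentWords (k : ℕ) (δ : ℝ) : Set (FreeGroup (Fin k)) :=
  {w | w ∈ cyclicallyReducedWords k ∧
    ∀ p q : Letter k, q ≠ letterInv p → δ * w.norm < pairCount p q w.toWord}

/-- A cyclically reduced word outside the set has some pair whose count is below its expected value
by at least `(c₀ - δ)n`, hence by more than half of that. Such words are exponentially rare in the
sphere, and the cyclically reduced ones are a fixed positive proportion of it. -/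
theorem isExponentiallyGeneric_frequentWords (hk : 2 ≤ k) {δ : ℝ}
    (hδ : δ < 1 / (2 * k * (2 * k - 1))) :
    IsExponentiallyGeneric (frequentWords k δ) (cyclicallyReducedWords k) := by
  classical
  have h3 := two_mul_sub_one_pos hk
  set c₀ : ℝ := 1 / (2 * k * (2 * k - 1)) with hc₀
  let ι := {pq : Letter k × Letter k // pq.2 ≠ letterInv pq.1}
  have hne : Nonempty ι := ⟨⟨((⟨0, by omega⟩, true), (⟨0, by omega⟩, true)), by simp [letterInv]⟩⟩
  have hcount : ∀ i : ι, ∃ σ D : ℝ, 0 < σ ∧ σ < 1 ∧ 0 < D ∧ ∀ n : ℕ,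
      ({g : FreeGroup (Fin k) | g.norm = n ∧ (c₀ - δ) / 2 * n <
        |(pairCount i.1.1 i.1.2 g.toWord : ℝ) - c₀ * n|}.ncard : ℝ) ≤
          D * σ ^ n * (2 * k - 1 : ℝ) ^ n := fun i => by
    obtain ⟨Δ, hΔ⟩ := exists_avg_pairCount hk i.2
    exact (isQuasiAdditive_pairCount i.1.1 i.1.2).exists_ncard_sphere_le hk hΔ (by linarith)
  choose σ D hσ hσ1 hD h using hcount
  -- The slowest of the finitely many decay rates serves for all pairs.
  obtain ⟨i₀, hi₀⟩ := Finite.exists_max σ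
  refine ⟨fun w hw => hw.1, σ i₀, (∑ i, D i) * (2 * k - 1), hσ i₀, hσ1 i₀,
    mul_pos (Finset.sum_pos (fun i _ => hD i) Finset.univ_nonempty) (by linarith), fun n hn => ?_⟩
  obtain ⟨n, rfl⟩ := Nat.exists_eq_add_of_le' hn
  set W := {w ∈ cyclicallyReducedWords k | w.norm = n + 1} with hW
  set S := {w ∈ frequentWords k δ | w.norm = n + 1} with hS
  have hWfin : W.Finite := (finite_sphere (n + 1)).subset fun g hg => hg.2
  have hSW : S ⊆ W := fun w hw => ⟨hw.1.1, hw.2⟩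
  have hWpos := pow_le_sphereCount_cyclicallyReducedWords hk n
  have hWpos' : (0 : ℝ) < sphereCount (cyclicallyReducedWords k) (n + 1) :=
    lt_of_lt_of_le (by positivity) hWpos
  have hbad : ((W \ S).ncard : ℝ) ≤
      (∑ i, D i) * σ i₀ ^ (n + 1) * (2 * k - 1 : ℝ) ^ (n + 1) := by
    have hsub : W \ S ⊆ ⋃ i : ι, {g : FreeGroup (Fin k) | g.norm = n + 1 ∧
        (c₀ - δ) / 2 * (n + 1 : ℕ) < |(pairCount i.1.1 i.1.2 g.toWord : ℝ) - c₀ * (n + 1 : ℕ)|} := by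
      rintro w ⟨⟨hw1, hw2⟩, hw3⟩
      have : ¬∀ p q : Letter k, q ≠ letterInv p → δ * w.norm < pairCount p q w.toWord :=
        fun h => hw3 ⟨⟨hw1, h⟩, hw2⟩
      push Not at this
      obtain ⟨p, q, hpq, hle⟩ := this
      refine Set.mem_iUnion.2 ⟨⟨(p, q), hpq⟩, hw2, ?_⟩
      rw [hw2] at hle
      have hn : (0 : ℝ) < (n + 1 : ℕ) := by positivity
      rw [abs_sub_comm]
      refine lt_of_lt_of_le ?_ (le_abs_self _)
      have : 0 < (c₀ - δ) / 2 * (n + 1 : ℕ) := mul_pos (by linarith) hn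
      linarith
    have hle : (W \ S).ncard ≤ ∑ i : ι, {g : FreeGroup (Fin k) | g.norm = n + 1 ∧
        (c₀ - δ) / 2 * (n + 1 : ℕ) <
          |(pairCount i.1.1 i.1.2 g.toWord : ℝ) - c₀ * (n + 1 : ℕ)|}.ncard := by
      refine (Set.ncard_le_ncard hsub (Set.finite_iUnion fun i =>
        (finite_sphere (n + 1)).subset fun g hg => hg.1)).trans ?_
      exact Set.ncard_iUnion_le_of_fintype _
    refine (Nat.cast_le.2 hle).trans ?_
    rw [Nat.cast_sum, Finset.sum_mul, Finset.sum_mul]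
    refine Finset.sum_le_sum fun i _ => (h i (n + 1)).trans ?_
    have := pow_le_pow_left₀ (hσ i).le (hi₀ i) (n + 1)
    have h4 : (0 : ℝ) ≤ (2 * k - 1 : ℝ) ^ (n + 1) := by positivity
    exact mul_le_mul_of_nonneg_right (mul_le_mul_of_nonneg_left this (hD i).le) h4
  have hcard : (sphereCount (frequentWords k δ) (n + 1) : ℝ) + (W \ S).ncard =
      sphereCount (cyclicallyReducedWords k) (n + 1) := by
    have := Set.ncard_sdiff_add_ncard_of_subset hSW hWfin
    rw [add_comm] at this
    exact_mod_cast this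
  rw [div_sub_one hWpos'.ne', abs_div, abs_of_pos hWpos', div_le_iff₀ hWpos', ← hcard,
    sub_add_cancel_left, abs_neg, Nat.abs_cast, hcard]
  refine hbad.trans ?_
  -- The lower bound for the denominator has exponent `n` at length `n + 1`, which accounts for the
  -- extra factor `2k - 1` in the constant.
  rw [pow_succ (2 * k - 1 : ℝ) n]
  have h5 : 0 ≤ (∑ i, D i) * (2 * k - 1 : ℝ) * σ i₀ ^ (n + 1) :=
    mul_nonneg (mul_nonneg (Finset.sum_nonneg fun i _ => (hD i).le) (by linarith))
      (pow_nonneg (hσ i₀).le _)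
  have h6 := mul_le_mul_of_nonneg_left hWpos h5
  linarith

lemma IsExponentiallyGeneric.nonempty {S W : Set (FreeGroup (Fin k))}
    (h : IsExponentiallyGeneric S W) : S.Nonempty := by
  rw [Set.nonempty_iff_ne_empty]
  rintro rfl
  obtain ⟨-, σ, D, hσ, hσ1, hD, h⟩ := h
  have h1 : Tendsto (fun n : ℕ => D * σ ^ n) atTop (𝓝 (D * 0)) :=
    (tendsto_pow_atTop_nhds_zero_of_lt_one hσ.le hσ1).const_mul D
  rw [mul_zero] at h1
  obtain ⟨n, hn1, hn2⟩ := ((h1.eventually (gt_mem_nhds one_pos)).and (eventually_ge_atTop 1)).exists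
  have h2 := h n hn2
  have h3 : sphereCount (∅ : Set (FreeGroup (Fin k))) n = 0 := by simp [sphereCount]
  rw [h3] at h2
  simp only [Nat.cast_zero, zero_div, zero_sub, abs_neg, abs_one] at h2
  linarith

/-- In `w ^ N` each pair occurs at least `N` times as often as in `w`, so the hypothesis applied to
powers and divided by `N` loses the constant `C`. -/
lemma mul_lt_cyclicLength_apply (hk : 2 ≤ k) {φ : MulAut (FreeGroup (Fin k))} {M C δ : ℝ}
    (hM : 0 < M)
    (h : ∀ (g : FreeGroup (Fin k)) (t : ℝ), 0 ≤ t →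
      (∀ p q : Letter k, q ≠ letterInv p → t ≤ pairCount p q g.toWord) →
      M * t ≤ (φ g).norm + C)
    {w : FreeGroup (Fin k)} (hw : w ∈ frequentWords k δ) :
    M * δ * cyclicLength w < cyclicLength (φ w) := by
  let ι := {pq : Letter k × Letter k // pq.2 ≠ letterInv pq.1}
  have hne : Nonempty ι := ⟨⟨((⟨0, by omega⟩, true), (⟨0, by omega⟩, true)), by simp [letterInv]⟩⟩
  -- The smallest actual count is used in place of `δ * |w|`, so that the inequality remains strict
  -- after the limit in `N`.
  obtain ⟨i, hi⟩ := Finite.exists_min fun i : ι => pairCount i.1.1 i.1.2 w.toWord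
  have hcr : FreeGroup.IsCyclicallyReduced w.toWord := hw.1
  rw [cyclicLength_of_isCyclicallyReduced hcr, mul_assoc]
  refine lt_of_lt_of_le (mul_lt_mul_of_pos_left (hw.2 _ _ i.2) hM) ?_
  refine le_of_forall_mul_le_mul_add (C := 2 * (φ w).norm + C) fun N => ?_
  have h1 := h (w ^ N) (N * pairCount i.1.1 i.1.2 w.toWord) (by positivity) fun p q hpq => by
    rw [toWord_pow_of_isCyclicallyReduced hcr]
    have h2 := pairCount_flatten_replicate p q w.toWord N
    have h3 := Nat.mul_le_mul_left N (hi ⟨(p, q), hpq⟩)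
    exact_mod_cast h3.trans h2
  have h4 : ((φ w ^ N).norm : ℝ) ≤ N * cyclicLength (φ w) + 2 * (φ w).norm := by
    exact_mod_cast norm_pow_le (φ w) N
  rw [map_pow] at h1
  linarith

end Generic

/-! ### Rough isometries and rough similarities -/

section Rough

variable {k : ℕ}

lemma wordDist_apply (φ : MulAut (FreeGroup (Fin k))) (x y : FreeGroup (Fin k)) :
    wordDist (φ x) (φ y) = (φ (x⁻¹ * y)).norm := by
  rw [wordDist, ← map_inv, ← map_mul]

lemma IsSimple.isRoughIsometry {φ : MulAut (FreeGroup (Fin k))} (h : IsSimple φ) :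
    IsRoughIsometry wordDist wordDist φ := by
  obtain ⟨D, hD, h⟩ := h.exists_abs_norm_sub_le
  refine ⟨D, hD, fun x y => ?_⟩
  rw [wordDist_apply]
  exact h _

lemma exists_abs_norm_sub_mul_le_of_isRoughSimilarity {φ : MulAut (FreeGroup (Fin k))}
    (h : IsRoughSimilarity wordDist wordDist φ) :
    ∃ c D : ℝ, 0 < c ∧ ∀ g, |((φ g).norm : ℝ) - c * g.norm| ≤ D := by
  obtain ⟨c, D, hc, -, h⟩ := h
  refine ⟨c, D, hc, fun g => ?_⟩
  have := h 1 g
  rw [wordDist_apply] at this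
  simpa [wordDist] using this

/-- The inverse rescales by `1 / c`. This lets the bound `λ ≥ 1` be applied to the inverse as well.
-/
lemma abs_norm_inv_sub_div_le {φ : MulAut (FreeGroup (Fin k))} {c D : ℝ} (hc : 0 < c)
    (h : ∀ g, |((φ g).norm : ℝ) - c * g.norm| ≤ D) (g : FreeGroup (Fin k)) :
    |((φ⁻¹ g).norm : ℝ) - 1 / c * g.norm| ≤ D / c := by
  have h1 := h (φ⁻¹ g)
  rw [MulAut.apply_inv_self] at h1
  rw [le_div_iff₀ hc, ← abs_of_pos hc, ← abs_mul, abs_of_pos hc, ← abs_neg]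
  have e : -((((φ⁻¹ g).norm : ℝ) - 1 / c * g.norm) * c) = g.norm - c * (φ⁻¹ g).norm := by
    rw [sub_mul, mul_right_comm, one_div_mul_cancel hc.ne']
    ring
  rwa [e]

end Rough

end FreeStretch

theorem mainTheorem2 (k : ℕ) (hk : 2 ≤ k) :
    (∀ φ : MulAut (FreeGroup (Fin k)),
      FreeStretch.IsGenericStretchingFactor φ.toMonoidHom
        (FreeStretch.genericStretchingFactor φ.toMonoidHom)) ∧
    (∃ C : Set (FreeGroup (Fin k)),
      FreeStretch.IsExponentiallyGeneric C (FreeStretch.cyclicallyReducedWords k) ∧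
      ∀ φ : MulAut (FreeGroup (Fin k)), List.TFAE [
        FreeStretch.IsSimple φ,
        FreeStretch.genericStretchingFactor φ.toMonoidHom = 1,
        FreeStretch.genericStretchingFactor φ.toMonoidHom
          < 1 + (2 * (k : ℝ) - 3) / (2 * (k : ℝ) ^ 2 - k),
        FreeStretch.IsRoughIsometry FreeStretch.wordDist FreeStretch.wordDist φ,
        FreeStretch.IsRoughSimilarity FreeStretch.wordDist FreeStretch.wordDist φ,
        ∃ w ∈ C, FreeStretch.cyclicLength (φ w) = FreeStretch.cyclicLength w,
        ∀ w ∈ C, FreeStretch.cyclicLength (φ w) = FreeStretch.cyclicLength w,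
        ∃ w ∈ C, (FreeStretch.cyclicLength (φ w) : ℝ)
          ≤ (1 + (2 * (k : ℝ) - 3) / (4 * (k : ℝ) ^ 2 - 2 * k)) * FreeStretch.cyclicLength w,
        ∀ w ∈ C, (FreeStretch.cyclicLength (φ w) : ℝ)
          ≤ (1 + (2 * (k : ℝ) - 3) / (4 * (k : ℝ) ^ 2 - 2 * k)) * FreeStretch.cyclicLength w]) ∧
    ∀ φ : MulAut (FreeGroup (Fin k)),
      FreeStretch.genericStretchingFactor φ.toMonoidHom ∉
        Set.Ioo (1 : ℝ) (1 + (2 * (k : ℝ) - 3) / (2 * (k : ℝ) ^ 2 - k)) := by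
  open FreeStretch in
  have hk' : (2 : ℝ) ≤ k := by exact_mod_cast hk
  have hA : (0 : ℝ) < 2 * k * (2 * k - 1) := by nlinarith
  set M : ℝ := 2 * k * (2 * k - 1) + 2 * (2 * k - 3) with hMdef
  have hM : 0 < M := by linarith
  have hgap : (0 : ℝ) < (2 * k - 3) / (2 * (k : ℝ) ^ 2 - k) := div_pos (by linarith) (by nlinarith)
  have hMA : M * (1 / (2 * k * (2 * k - 1))) = 1 + (2 * (k : ℝ) - 3) / (2 * (k : ℝ) ^ 2 - k) := by
    have h1 : (2 * (k : ℝ) ^ 2 - k) ≠ 0 := by nlinarith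
    have h2 : (2 * (k : ℝ) - 1) ≠ 0 := by linarith
    rw [hMdef, show 2 * (k : ℝ) ^ 2 - k = k * (2 * k - 1) by ring]
    field_simp
  have hd₀ : (2 * (k : ℝ) - 3) / (4 * (k : ℝ) ^ 2 - 2 * k) =
      (2 * k - 3) / (2 * (k : ℝ) ^ 2 - k) / 2 := by
    rw [div_div]
    congr 1
    ring
  set d₀ : ℝ := 1 + (2 * (k : ℝ) - 3) / (4 * (k : ℝ) ^ 2 - 2 * k) with hd₀def
  have hd₀1 : 1 ≤ d₀ := by linarith
  -- Since `d₀` is the midpoint of `1` and the gap bound, the frequency `d₀ / M` is below the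
  -- typical one. It is still large enough for nonsimple automorphisms to stretch by more than `M *
  -- (d₀ / M) = d₀`.
  have hlt : d₀ / M < 1 / (2 * k * (2 * k - 1)) := by
    rw [div_lt_iff₀ hM, mul_comm, hMA]
    linarith
  have one_le : ∀ φ : MulAut (FreeGroup (Fin k)),
      1 ≤ genericStretchingFactor φ.toMonoidHom := fun φ => by
    obtain ⟨C, hC⟩ := exists_le_norm_apply hk φ
    exact le_trans (mul_one_div_cancel hA.ne').ge
      (le_genericStretchingFactor hk hA fun g t ht htu => (hC g t ht htu).1)
  have gap : ∀ φ : MulAut (FreeGroup (Fin k)), ¬IsSimple φ →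
      1 + (2 * (k : ℝ) - 3) / (2 * (k : ℝ) ^ 2 - k) ≤
        genericStretchingFactor φ.toMonoidHom := fun φ hφ => by
    obtain ⟨C, hC⟩ := exists_le_norm_apply hk φ
    rw [← hMA]
    exact le_genericStretchingFactor hk hM fun g t ht htu => (hC g t ht htu).2 hφ
  have simple_eq : ∀ φ : MulAut (FreeGroup (Fin k)), IsSimple φ →
      genericStretchingFactor φ.toMonoidHom = 1 := fun φ hφ => by
    obtain ⟨D, -, hD⟩ := hφ.exists_abs_norm_sub_le
    exact genericStretchingFactor_eq_of_abs_le hk (c := 1) (D := D) (by simpa using hD)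
  have hgen := isExponentiallyGeneric_frequentWords hk hlt
  refine ⟨isGenericStretchingFactor_genericStretchingFactor hk,
    ⟨frequentWords k (d₀ / M), hgen, fun φ => ?_⟩, fun φ hφ => ?_⟩
  · tfae_have 1 → 2 := simple_eq φ
    tfae_have 2 → 3 := fun h => by
      rw [h]
      linarith
    tfae_have 3 → 1 := fun h => by
      by_contra hφ
      exact absurd (gap φ hφ) (not_le.2 h)
    tfae_have 1 → 4 := fun h => h.isRoughIsometry
    tfae_have 4 → 5 := fun ⟨D, hD, h⟩ => ⟨1, D, one_pos, hD, fun x y => by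
      rw [one_mul]
      exact h x y⟩
    -- The factor `c` equals `λ(φ)` and `1 / c` equals `λ(φ⁻¹) ≥ 1`, so `c ≤ 1`, which is impossible
    -- past the gap.
    tfae_have 5 → 1 := fun h => by
      by_contra hφ
      obtain ⟨c, D, hc, h⟩ := exists_abs_norm_sub_mul_le_of_isRoughSimilarity h
      have h1 := gap φ hφ
      rw [genericStretchingFactor_eq_of_abs_le hk h] at h1
      have h2 := one_le φ⁻¹
      rw [genericStretchingFactor_eq_of_abs_le hk (abs_norm_inv_sub_div_le hc h),
        le_div_iff₀ hc] at h2
      linarith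
    tfae_have 1 → 7 := fun h w _ => h.cyclicLength_apply w
    tfae_have 7 → 6 := fun h => by
      obtain ⟨w, hw⟩ := hgen.nonempty
      exact ⟨w, hw, h w hw⟩
    tfae_have 7 → 9 := fun h w hw => by
      rw [h w hw]
      exact le_mul_of_one_le_left (Nat.cast_nonneg _) hd₀1
    tfae_have 9 → 8 := fun h => by
      obtain ⟨w, hw⟩ := hgen.nonempty
      exact ⟨w, hw, h w hw⟩
    tfae_have 6 → 8 := fun ⟨w, hw, h⟩ => ⟨w, hw, by
      rw [h]
      exact le_mul_of_one_le_left (Nat.cast_nonneg _) hd₀1⟩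
    tfae_have 8 → 1 := fun ⟨w, hw, h⟩ => by
      by_contra hφ
      obtain ⟨C, hC⟩ := exists_le_norm_apply hk φ
      have h1 := mul_lt_cyclicLength_apply hk hM (fun g t ht htu => (hC g t ht htu).2 hφ) hw
      rw [mul_div_cancel₀ _ hM.ne'] at h1
      exact absurd h (not_le.2 h1)
    tfae_finish
  · by_cases h : IsSimple φ
    · rw [simple_eq φ h] at hφ
      exact lt_irrefl _ hφ.1
    · exact absurd (gap φ h) (not_le.2 hφ.2)
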